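/- A tensor category is a finite-dimensional $\mathbb{C}$-linear strict monoidal category (all hom-sets are finite-dimensional complex vector spaces, composition and tensor product of morphisms are bilinear) whose unit object $I$ satisfies $\mathrm{End}(I)=\mathbb{C}1_I$. For $d\in\mathbb{C}$ the Temperley–Lieb category $\mathcal{K}_d$ is the tensor category whose objects are the natural numbers, with $\mathrm{Hom}(n,m)$ the complex vector space freely generated by the isotopy classes of families of non-crossing planar curves which join in pairs $n$ points on the lower edge and $m$ points on the upper edge of a rectangle; composition is the bilinear extension of vertical concatenation (first morphism below, second on top), each closed loop being removed and replaced by the factor $d$, and the tensor product is $n\otimes m=n+m$ on objects and the bilinear extension of horizontal juxtaposition on morphisms. Let $X$ denote the object $1$, and let $\epsilon:X\otimes X\to I$ and $\delta:I\to X\otimes X$ be the single arcs. **Lemma.** Let $Y$ be a self-dual object in a tensor category $\mathcal{T}$, with associated morphisms $\epsilon_Y:Y\otimes Y\to I$ and $\delta_Y:I\to Y\otimes Y$, that is, $$(\epsilon_Y\otimes 1_Y)(1_Y\otimes\delta_Y)=1_Y=(1_Y\otimes\epsilon_Y)(\delta_Y\otimes 1_Y),$$ and suppose that $\epsilon_Y\delta_Y=d\,1_I$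 with $d\in\mathbb{C}\setminus\{0\}$. Then there is a $\mathbb{C}$-linear functor $F:\mathcal{K}_d\to\mathcal{T}$ which is (strictly) monoidal, i.e. $F(I)=I$, $F(A\otimes B)=F(A)\otimes F(B)$ for objects and $F(f\otimes g)=F(f)\otimes F(g)$ for morphisms, such that $F(X)=Y$, $F(\epsilon)=\epsilon_Y$ and $F(\delta)=\delta_Y$. -/

import Mathlib

open CategoryTheory MonoidalCategory

namespace TemperleyLieb

universe u₁ u₂ u₃ u₄

section Gluing

variable {α : Type u₁} {β : Type u₂} {γ : Type u₃} {δ : Type u₄}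

/-- Every class of the equivalence relation `R` has exactly two elements. -/
def IsMatching (R : Setoid α) : Prop := ∀ x, ∃! y, y ≠ x ∧ R x y

/-- Glue a relation on the end points `α ⊕ β` to a relation on the end points `β ⊕ γ` along `β`:
two points are related iff they are joined by a path in the glued picture. -/
def glue (R : Setoid (α ⊕ β)) (S : Setoid (β ⊕ γ)) : Setoid (α ⊕ β ⊕ γ) :=
  R.map (Sum.map id Sum.inl) ⊔ S.map Sum.inr

/-- The relation induced by the glued picture on the outer end points. -/
def glueOuter (R : Setoid (α ⊕ β)) (S : Setoid (β ⊕ γ)) : Setoid (α ⊕ γ) :=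
  (glue R S).comap (Sum.map id Sum.inr)

/-- The number of classes of `R` (connected components) that contain no point `f a`. -/
noncomputable def countMissing (R : Setoid β) (f : α → β) : ℕ :=
  Nat.card {c : Quotient R // ∀ a, Quotient.mk R (f a) ≠ c}

/-- The number of components of the glued picture which contain no outer end point
(the closed loops). -/
noncomputable def glueLoops (R : Setoid (α ⊕ β)) (S : Setoid (β ⊕ γ)) : ℕ :=
  countMissing (glue R S) (Sum.map id Sum.inr : α ⊕ γ → α ⊕ β ⊕ γ)

theorem map_le_iff {R : Setoid α} {f : α → β} {S : Setoid β} :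
    R.map f ≤ S ↔ R ≤ S.comap f := by
  constructor
  · intro h x y hxy
    exact h (Setoid.le_comap_map hxy)
  · intro h
    refine Setoid.eqvGen_le ?_
    rintro _ _ ⟨x, y, hxy, rfl, rfl⟩
    exact h hxy

theorem map_sup (R S : Setoid α) (f : α → β) : (R ⊔ S).map f = R.map f ⊔ S.map f := by
  apply le_antisymm
  · rw [map_le_iff]
    exact sup_le (map_le_iff.1 le_sup_left) (map_le_iff.1 le_sup_right)
  · rw [sup_le_iff, map_le_iff, map_le_iff]
    exact ⟨le_sup_left.trans Setoid.le_comap_map, le_sup_right.trans Setoid.le_comap_map⟩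

theorem map_map (R : Setoid α) (f : α → β) (g : β → γ) : (R.map f).map g = R.map (g ∘ f) := by
  apply le_antisymm
  · rw [map_le_iff, map_le_iff]
    exact Setoid.le_comap_map (f := g ∘ f)
  · rw [map_le_iff]
    intro x y h
    exact Setoid.le_comap_map (f := g) (Setoid.le_comap_map (f := f) h)

theorem map_bot (f : α → β) : (⊥ : Setoid α).map f = ⊥ := by
  rw [eq_bot_iff, map_le_iff]
  rintro x y rfl
  exact Setoid.refl' _ _

theorem map_id' (R : Setoid α) : R.map id = R :=
  le_antisymm (map_le_iff.2 le_rfl) (Setoid.le_comap_map (f := id))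

theorem map_rel {R : Setoid α} {f : α → β} (hf : Function.Injective f) {x y : β} :
    R.map f x y ↔ (∃ a b, R a b ∧ f a = x ∧ f b = y) ∨ x = y := by
  have h := Setoid.coe_map_of_ker_le R f (by rw [Setoid.ker_eq_bot_iff.2 hf]; exact bot_le)
  have h2 := congrFun (congrFun h x) y
  simp only [Pi.sup_apply, Relation.Map, sup_Prop_eq] at h2
  exact iff_of_eq h2

/-- Adding a relation supported on the range of `f` and restricting along `f`. -/
theorem sup_rel {R S : Setoid β} {f : α → β}
    (hS : ∀ x y, S x y → x = y ∨ (x ∈ Set.range f ∧ y ∈ Set.range f)) {x y : β} :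
    (R ⊔ S) x y ↔ R x y ∨ ∃ a b, R x (f a) ∧ (R.comap f ⊔ S.comap f) a b ∧ R (f b) y := by
  constructor
  · let T : Setoid β :=
      { r := fun x y => R x y ∨ ∃ a b, R x (f a) ∧ (R.comap f ⊔ S.comap f) a b ∧ R (f b) y
        iseqv := by
          refine ⟨fun x => Or.inl (R.refl x), ?_, ?_⟩
          · rintro x y (h | ⟨a, b, h1, h2, h3⟩)
            · exact Or.inl (R.symm h)
            · exact Or.inr ⟨b, a, R.symm h3, Setoid.symm' _ h2, R.symm h1⟩
          · rintro x y z (h | ⟨a, b, h1, h2, h3⟩) (h' | ⟨a', b', h1', h2', h3'⟩)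
            · exact Or.inl (R.trans h h')
            · exact Or.inr ⟨a', b', R.trans h h1', h2', h3'⟩
            · exact Or.inr ⟨a, b, h1, h2, R.trans h3 h'⟩
            · refine Or.inr ⟨a, b', h1, Setoid.trans' _ h2 (Setoid.trans' _ ?_ h2'), h3'⟩
              exact (le_sup_left : R.comap f ≤ R.comap f ⊔ S.comap f) (R.trans h3 h1') }
    have : R ⊔ S ≤ T := by
      refine sup_le (fun x y h => Or.inl h) ?_
      intro x y h
      rcases hS x y h with rfl | ⟨⟨a, rfl⟩, ⟨b, rfl⟩⟩
      · exact Or.inl (R.refl _)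
      · exact Or.inr ⟨a, b, R.refl _,
          (le_sup_right : S.comap f ≤ R.comap f ⊔ S.comap f) h, R.refl _⟩
    exact fun h => this h
  · have hR : R ≤ R ⊔ S := le_sup_left
    rintro (h | ⟨a, b, h1, h2, h3⟩)
    · exact hR h
    · have h4 : R.comap f ⊔ S.comap f ≤ (R ⊔ S).comap f :=
        sup_le (fun x y h => hR h) (fun x y h => (le_sup_right : S ≤ R ⊔ S) h)
      exact Setoid.trans' _ (hR h1) (Setoid.trans' _ (h4 h2) (hR h3))

theorem comap_sup {R S : Setoid β} {f : α → β}
    (hS : ∀ x y, S x y → x = y ∨ (x ∈ Set.range f ∧ y ∈ Set.range f)) :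
    (R ⊔ S).comap f = R.comap f ⊔ S.comap f := by
  apply le_antisymm
  · intro x y h
    rcases (sup_rel hS).1 h with h | ⟨a, b, h1, h2, h3⟩
    · exact (le_sup_left : R.comap f ≤ R.comap f ⊔ S.comap f) h
    · exact Setoid.trans' _ ((le_sup_left : R.comap f ≤ R.comap f ⊔ S.comap f) h1)
        (Setoid.trans' _ h2 ((le_sup_left : R.comap f ≤ R.comap f ⊔ S.comap f) h3))
  · exact sup_le (fun x y h => (le_sup_left : R ≤ R ⊔ S) h)
      (fun x y h => (le_sup_right : S ≤ R ⊔ S) h)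

/-- Base change for restriction and extension of relations. -/
theorem comap_map_square {U : Type*} {W : Type*} {Z : Type*} {A : Type*} (R : Setoid U)
    {j : U → W} {a : A → W} {k : Z → U} {l : Z → A}
    (hj : Function.Injective j) (ha : Function.Injective a) (hl : Function.Injective l)
    (hsq : ∀ z, j (k z) = a (l z)) (hpb : ∀ u x, j u = a x → ∃ z, k z = u ∧ l z = x) :
    (R.map j).comap a = (R.comap k).map l := by
  ext x y
  rw [Setoid.comap_rel, map_rel hj, map_rel hl]
  constructor
  · rintro (⟨u, v, h, hu, hv⟩ | h)
    · obtain ⟨z, rfl, rfl⟩ := hpb u x hu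
      obtain ⟨z', rfl, rfl⟩ := hpb v y hv
      exact Or.inl ⟨z, z', h, rfl, rfl⟩
    · exact Or.inr (ha h)
  · rintro (⟨z, z', h, rfl, rfl⟩ | rfl)
    · exact Or.inl ⟨k z, k z', h, hsq z, hsq z'⟩
    · exact Or.inr rfl

theorem countMissing_comp [Finite β] (R : Setoid β) (f : α → β) {O : Type*} (g : O → α) :
    countMissing R (f ∘ g) = countMissing R f + countMissing (R.comap f) g := by
  classical
  have e : {c : Quotient R // ∀ a, Quotient.mk R ((f ∘ g) a) ≠ c} ≃
      {c : Quotient R // ∀ a, Quotient.mk R (f a) ≠ c} ⊕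
        {c : Quotient (R.comap f) // ∀ a, Quotient.mk (R.comap f) (g a) ≠ c} := by
    symm
    refine Equiv.ofBijective (Sum.elim (fun c => ⟨c.1, fun a => c.2 (g a)⟩)
      (fun c => ⟨Quotient.map f (fun _ _ h => h) c.1, ?_⟩)) ⟨?_, ?_⟩
    · intro a
      obtain ⟨c, hc⟩ := c
      induction c using Quotient.inductionOn with
      | h x =>
        intro h
        have h' : R (f (g a)) (f x) := Quotient.exact h
        exact hc a (Quotient.sound (s := R.comap f) h')
    · rintro (⟨c, hc⟩ | ⟨c, hc⟩) (⟨c', hc'⟩ | ⟨c', hc'⟩) h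
      · simpa using h
      · induction c' using Quotient.inductionOn with
        | h x => exact absurd (congrArg Subtype.val h).symm (hc x)
      · induction c using Quotient.inductionOn with
        | h x => exact absurd (congrArg Subtype.val h) (hc' x)
      · induction c using Quotient.inductionOn with
        | h x =>
          induction c' using Quotient.inductionOn with
          | h y =>
            have h2 := congrArg Subtype.val h
            have : Quotient.mk (R.comap f) x = Quotient.mk (R.comap f) y :=
              Quotient.sound (s := R.comap f) (Quotient.exact h2 : R (f x) (f y))
            simp [this]
    · rintro ⟨c, hc⟩
      by_cases h : ∃ a, Quotient.mk R (f a) = c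
      · obtain ⟨a, rfl⟩ := h
        refine ⟨Sum.inr ⟨Quotient.mk _ a, ?_⟩, rfl⟩
        intro b hb
        have h' : (R.comap f) (g b) a := Quotient.exact hb
        exact hc b (Quotient.sound (s := R) h')
      · push Not at h
        exact ⟨Sum.inl ⟨c, h⟩, rfl⟩
  unfold countMissing
  have : Finite (Quotient (R.comap f)) := by
    refine Finite.of_injective
      (Quotient.map f (fun _ _ h => h) : Quotient (R.comap f) → Quotient R) ?_
    intro x y
    induction x using Quotient.inductionOn with
    | h x =>
      induction y using Quotient.inductionOn with
      | h y => exact fun h => Quotient.sound (Quotient.exact h : R (f x) (f y))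
  rw [Nat.card_congr e, Nat.card_sum]

theorem countMissing_sup (R S : Setoid β) (f : α → β)
    (hS : ∀ x y, S x y → x = y ∨ (x ∈ Set.range f ∧ y ∈ Set.range f)) :
    countMissing (R ⊔ S) f = countMissing R f := by
  symm
  have hR : R ≤ R ⊔ S := le_sup_left
  refine Nat.card_congr (Equiv.ofBijective
    (fun c => ⟨Quotient.map id (fun _ _ h => hR h) c.1, ?_⟩) ⟨?_, ?_⟩)
  · obtain ⟨c, hc⟩ := c
    induction c using Quotient.inductionOn with
    | h x =>
      intro a h
      rcases (sup_rel hS).1 (Quotient.exact h : (R ⊔ S) (f a) x) with h | ⟨a, b, h1, h2, h3⟩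
      · exact hc a (Quotient.sound h)
      · exact hc b (Quotient.sound h3)
  · rintro ⟨c, hc⟩ ⟨c', hc'⟩ h
    induction c using Quotient.inductionOn with
    | h x =>
      induction c' using Quotient.inductionOn with
      | h y =>
        rcases (sup_rel hS).1 (Quotient.exact (congrArg Subtype.val h) : (R ⊔ S) x y) with
          h | ⟨a, b, h1, h2, h3⟩
        · exact Subtype.ext (Quotient.sound h)
        · exact absurd (Quotient.sound (Setoid.symm' _ h1)) (hc a)
  · rintro ⟨c, hc⟩
    induction c using Quotient.inductionOn with
    | h x =>
      refine ⟨⟨Quotient.mk _ x, fun a h => hc a ?_⟩, rfl⟩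
      exact Quotient.sound (hR (Quotient.exact h : R (f a) x))

theorem countMissing_map {U : Type*} {W : Type*} {Z : Type*} {A : Type*} (R : Setoid U)
    {j : U → W} {a : A → W} {k : Z → U} {l : Z → A} (hj : Function.Injective j)
    (hsq : ∀ z, j (k z) = a (l z)) (hpb : ∀ u x, j u = a x → ∃ z, k z = u ∧ l z = x)
    (hcov : ∀ w, w ∈ Set.range j ∨ w ∈ Set.range a) :
    countMissing (R.map j) a = countMissing R k := by
  symm
  refine Nat.card_congr (Equiv.ofBijective
    (fun c => ⟨Quotient.map j (fun _ _ h => Setoid.le_comap_map h) c.1, ?_⟩) ⟨?_, ?_⟩)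
  · obtain ⟨c, hc⟩ := c
    induction c using Quotient.inductionOn with
    | h x =>
      intro y h
      rcases (map_rel hj).1 (Quotient.exact h : (R.map j) (a y) (j x)) with
        ⟨u, v, h1, h2, h3⟩ | h
      · obtain ⟨z, rfl, rfl⟩ := hpb _ _ h2
        cases hj h3
        exact hc z (Quotient.sound h1)
      · obtain ⟨z, rfl, rfl⟩ := hpb _ _ h.symm
        exact hc z rfl
  · rintro ⟨c, hc⟩ ⟨c', hc'⟩ h
    induction c using Quotient.inductionOn with
    | h x =>
      induction c' using Quotient.inductionOn with
      | h y =>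
        have h2 : (R.map j) (j x) (j y) := Quotient.exact (congrArg Subtype.val h)
        refine Subtype.ext (Quotient.sound ?_)
        rcases (map_rel hj).1 h2 with ⟨u, v, h1, h2, h3⟩ | h
        · cases hj h2
          cases hj h3
          exact h1
        · cases hj h
          exact R.refl _
  · rintro ⟨c, hc⟩
    induction c using Quotient.inductionOn with
    | h w =>
      rcases hcov w with ⟨u, rfl⟩ | ⟨y, rfl⟩
      · refine ⟨⟨Quotient.mk _ u, fun z h => hc (l z) ?_⟩, rfl⟩
        rw [← hsq]
        exact Quotient.sound (Setoid.le_comap_map (Quotient.exact h : R (k z) u))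
      · exact absurd rfl (hc y)

theorem countMissing_eq_zero (R : Setoid β) (f : α → β) (h : ∀ x, ∃ a, R (f a) x) :
    countMissing R f = 0 := by
  have : IsEmpty {c : Quotient R // ∀ a, Quotient.mk R (f a) ≠ c} := by
    refine ⟨?_⟩
    rintro ⟨c, hc⟩
    induction c using Quotient.inductionOn with
    | h x =>
      obtain ⟨a, ha⟩ := h x
      exact hc a (Quotient.sound ha)
  exact Nat.card_of_isEmpty

theorem glueOuter_assoc_aux (R : Setoid (α ⊕ β)) (S : Setoid (β ⊕ γ)) (T : Setoid (γ ⊕ δ)) :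
    ((glue R S).map (Sum.map id (Sum.map id Sum.inl)) ⊔
        T.map (Sum.inr ∘ Sum.inr : γ ⊕ δ → α ⊕ β ⊕ γ ⊕ δ)) =
      (glue S T).map Sum.inr ⊔ R.map (Sum.map id Sum.inl) := by
  unfold glue
  rw [map_sup, map_sup, map_map, map_map, map_map, map_map, sup_assoc, sup_comm]
  congr 2
  funext x
  rcases x with x | x <;> rfl

theorem glue_left (R : Setoid (α ⊕ β)) (S : Setoid (β ⊕ γ)) (T : Setoid (γ ⊕ δ)) :
    ((glue R S).map (Sum.map id (Sum.map id Sum.inl)) ⊔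
        T.map (Sum.inr ∘ Sum.inr : γ ⊕ δ → α ⊕ β ⊕ γ ⊕ δ)).comap
      (Sum.map id Sum.inr : α ⊕ γ ⊕ δ → α ⊕ β ⊕ γ ⊕ δ) = glue (glueOuter R S) T := by
  have ha : Function.Injective (Sum.map id Sum.inr : α ⊕ γ ⊕ δ → α ⊕ β ⊕ γ ⊕ δ) :=
    Function.injective_id.sumMap Sum.inr_injective
  rw [comap_sup]
  · unfold glue
    congr 1
    · refine comap_map_square _ ?_ ha ?_ ?_ ?_
      · exact Function.injective_id.sumMap (Function.injective_id.sumMap Sum.inl_injective)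
      · exact Function.injective_id.sumMap Sum.inl_injective
      · rintro (x | x) <;> rfl
      · rintro (x | x | x) (y | y | y) <;> simp
    · have : (Sum.inr ∘ Sum.inr : γ ⊕ δ → α ⊕ β ⊕ γ ⊕ δ) = Sum.map id Sum.inr ∘ Sum.inr := rfl
      rw [this, ← map_map, Setoid.comap_map_eq _ _ ha]
  · intro x y h
    rcases (map_rel (Sum.inr_injective.comp Sum.inr_injective)).1 h with ⟨a, b, -, rfl, rfl⟩ | h
    · exact Or.inr ⟨⟨Sum.inr a, rfl⟩, ⟨Sum.inr b, rfl⟩⟩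
    · exact Or.inl h

theorem glue_right (R : Setoid (α ⊕ β)) (S : Setoid (β ⊕ γ)) (T : Setoid (γ ⊕ δ)) :
    ((glue S T).map Sum.inr ⊔ R.map (Sum.map id Sum.inl)).comap
      (Sum.map id (Sum.map id Sum.inr) : α ⊕ β ⊕ δ → α ⊕ β ⊕ γ ⊕ δ) =
        glue R (glueOuter S T) := by
  have ha : Function.Injective (Sum.map id (Sum.map id Sum.inr) : α ⊕ β ⊕ δ → α ⊕ β ⊕ γ ⊕ δ) :=
    Function.injective_id.sumMap (Function.injective_id.sumMap Sum.inr_injective)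
  have h0 : (Sum.map id Sum.inl : α ⊕ β → α ⊕ β ⊕ γ ⊕ δ) =
      Sum.map id (Sum.map id Sum.inr) ∘ Sum.map id Sum.inl := by
    funext x
    rcases x with x | x <;> rfl
  rw [comap_sup, sup_comm]
  · unfold glue
    congr 1
    · rw [h0, ← map_map, Setoid.comap_map_eq _ _ ha]
    · refine comap_map_square _ Sum.inr_injective ha Sum.inr_injective ?_ ?_
      · rintro (x | x) <;> rfl
      · rintro (x | x | x) (y | y | y) <;> simp [eq_comm]
  · intro x y h
    rw [h0] at h
    rcases (map_rel (ha.comp (Function.injective_id.sumMap Sum.inl_injective))).1 h with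
      ⟨a, b, -, rfl, rfl⟩ | h
    · exact Or.inr ⟨⟨_, rfl⟩, ⟨_, rfl⟩⟩
    · exact Or.inl h

theorem glueOuter_assoc (R : Setoid (α ⊕ β)) (S : Setoid (β ⊕ γ)) (T : Setoid (γ ⊕ δ)) :
    glueOuter (glueOuter R S) T = glueOuter R (glueOuter S T) := by
  conv_lhs => unfold glueOuter
  conv_rhs => unfold glueOuter
  change (glue (glueOuter R S) T).comap _ = (glue R (glueOuter S T)).comap _
  rw [← glue_left, ← glue_right, ← glueOuter_assoc_aux, ← Setoid.comap_comp, ← Setoid.comap_comp]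
  ext x y
  rcases x with x | x <;> rcases y with y | y <;> exact Iff.rfl

theorem glueLoops_assoc [Finite α] [Finite β] [Finite γ] [Finite δ]
    (R : Setoid (α ⊕ β)) (S : Setoid (β ⊕ γ)) (T : Setoid (γ ⊕ δ)) :
    glueLoops R S + glueLoops (glueOuter R S) T =
      glueLoops S T + glueLoops R (glueOuter S T) := by
  have h1 := countMissing_comp ((glue R S).map (Sum.map id (Sum.map id Sum.inl)) ⊔
        T.map (Sum.inr ∘ Sum.inr : γ ⊕ δ → α ⊕ β ⊕ γ ⊕ δ))
      (Sum.map id Sum.inr : α ⊕ γ ⊕ δ → α ⊕ β ⊕ γ ⊕ δ) (Sum.map id Sum.inr : α ⊕ δ → _)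
  have h2 := countMissing_comp ((glue S T).map Sum.inr ⊔ R.map (Sum.map id Sum.inl))
      (Sum.map id (Sum.map id Sum.inr) : α ⊕ β ⊕ δ → α ⊕ β ⊕ γ ⊕ δ)
      (Sum.map id Sum.inr : α ⊕ δ → _)
  have h3 : countMissing ((glue R S).map (Sum.map id (Sum.map id Sum.inl)) ⊔
        T.map (Sum.inr ∘ Sum.inr : γ ⊕ δ → α ⊕ β ⊕ γ ⊕ δ))
      (Sum.map id Sum.inr : α ⊕ γ ⊕ δ → α ⊕ β ⊕ γ ⊕ δ) = glueLoops R S := by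
    rw [countMissing_sup]
    · refine countMissing_map (l := Sum.map id Sum.inl) _ ?_ ?_ ?_ ?_
      · exact Function.injective_id.sumMap (Function.injective_id.sumMap Sum.inl_injective)
      · rintro (x | x) <;> rfl
      · rintro (x | x | x) (y | y | y) <;> simp
      · rintro (x | x | x | x) <;> simp
    · intro x y h
      rcases (map_rel (Sum.inr_injective.comp Sum.inr_injective)).1 h with
        ⟨a, b, -, rfl, rfl⟩ | h
      · exact Or.inr ⟨⟨Sum.inr a, rfl⟩, ⟨Sum.inr b, rfl⟩⟩
      · exact Or.inl h
  have h4 : countMissing ((glue S T).map Sum.inr ⊔ R.map (Sum.map id Sum.inl))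
      (Sum.map id (Sum.map id Sum.inr) : α ⊕ β ⊕ δ → α ⊕ β ⊕ γ ⊕ δ) = glueLoops S T := by
    rw [countMissing_sup]
    · refine countMissing_map (l := Sum.inr) _ Sum.inr_injective ?_ ?_ ?_
      · rintro (x | x) <;> rfl
      · rintro (x | x | x) (y | y | y) <;> simp [eq_comm]
      · rintro (x | x | x | x) <;> simp
    · intro x y h
      have h0 : (Sum.map id Sum.inl : α ⊕ β → α ⊕ β ⊕ γ ⊕ δ) =
          Sum.map id (Sum.map id Sum.inr) ∘ Sum.map id Sum.inl := by
        funext x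
        rcases x with x | x <;> rfl
      rcases (map_rel (Function.injective_id.sumMap Sum.inl_injective)).1 h with
        ⟨a, b, -, rfl, rfl⟩ | h
      · rw [h0]
        exact Or.inr ⟨⟨_, rfl⟩, ⟨_, rfl⟩⟩
      · exact Or.inl h
  rw [glue_left, h3] at h1
  rw [glue_right, h4, ← glueOuter_assoc_aux] at h2
  unfold glueLoops at h1 h2 ⊢
  rw [← h1, ← h2]
  congr 1
  funext x
  rcases x with x | x <;> rfl

/-- The relation on `α ⊕ α` joining each point to its copy. -/
def idRel (α : Type u₁) : Setoid (α ⊕ α) := Setoid.ker (Sum.elim id id)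

theorem idRel_iff {x y : α ⊕ α} : idRel α x y ↔ Sum.elim id id x = Sum.elim id id y := Iff.rfl

theorem isMatching_idRel (α : Type u₁) : IsMatching (idRel α) := by
  intro x
  refine ⟨x.swap, ?_, ?_⟩
  · rcases x with x | x <;> simp [idRel_iff]
  · rcases x with x | x <;> rintro (y | y) <;> simp +contextual [idRel_iff, eq_comm]

theorem glue_idRel_left (S : Setoid (α ⊕ γ)) :
    glue (idRel α) S = S.comap (Sum.elim Sum.inl id) := by
  apply le_antisymm
  · refine sup_le (map_le_iff.2 ?_) (map_le_iff.2 ?_)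
    · rintro (x | x) (y | y) h <;> cases (show x = y from h) <;> exact S.refl _
    · exact fun x y h => h
  · have key : ∀ x : α ⊕ α ⊕ γ, glue (idRel α) S x (Sum.inr (Sum.elim Sum.inl id x)) := by
      rintro (x | x)
      · refine (le_sup_left : _ ≤ glue (idRel α) S) ?_
        exact Setoid.le_comap_map (f := Sum.map id Sum.inl)
          (show idRel α (Sum.inl x) (Sum.inr x) from rfl)
      · exact Setoid.refl' _ _
    intro x y h
    refine Setoid.trans' _ (key x) (Setoid.trans' _ ?_ (Setoid.symm' _ (key y)))
    exact (le_sup_right : _ ≤ glue (idRel α) S) (Setoid.le_comap_map h)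

theorem glue_idRel_right (R : Setoid (α ⊕ β)) :
    glue R (idRel β) = R.comap (Sum.map id (Sum.elim id id)) := by
  apply le_antisymm
  · refine sup_le (map_le_iff.2 ?_) (map_le_iff.2 ?_)
    · rintro (x | x) (y | y) h <;> exact h
    · rintro (x | x) (y | y) h <;> cases (show x = y from h) <;> exact R.refl _
  · have key : ∀ x : α ⊕ β ⊕ β, glue R (idRel β) x
        (Sum.map id Sum.inl (Sum.map id (Sum.elim id id) x)) := by
      rintro (x | x | x)
      · exact Setoid.refl' _ _
      · exact Setoid.refl' _ _
      · refine (le_sup_right : _ ≤ glue R (idRel β)) ?_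
        exact Setoid.le_comap_map (f := Sum.inr)
          (show idRel β (Sum.inr x) (Sum.inl x) from rfl)
    intro x y h
    refine Setoid.trans' _ (key x) (Setoid.trans' _ ?_ (Setoid.symm' _ (key y)))
    exact (le_sup_left : _ ≤ glue R (idRel β)) (Setoid.le_comap_map h)

theorem glueOuter_idRel_left (S : Setoid (α ⊕ γ)) : glueOuter (idRel α) S = S := by
  unfold glueOuter
  rw [glue_idRel_left, ← Setoid.comap_comp]
  convert Setoid.comap_id S using 2
  funext x
  rcases x with x | x <;> rfl

theorem glueOuter_idRel_right (R : Setoid (α ⊕ β)) : glueOuter R (idRel β) = R := by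
  unfold glueOuter
  rw [glue_idRel_right, ← Setoid.comap_comp]
  convert Setoid.comap_id R using 2
  funext x
  rcases x with x | x <;> rfl

theorem glueLoops_idRel_left (S : Setoid (α ⊕ γ)) : glueLoops (idRel α) S = 0 := by
  unfold glueLoops
  rw [glue_idRel_left]
  apply countMissing_eq_zero
  rintro (x | x | x)
  · exact ⟨Sum.inl x, S.refl _⟩
  · exact ⟨Sum.inl x, S.refl _⟩
  · exact ⟨Sum.inr x, S.refl _⟩

theorem glueLoops_idRel_right (R : Setoid (α ⊕ β)) : glueLoops R (idRel β) = 0 := by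
  unfold glueLoops
  rw [glue_idRel_right]
  apply countMissing_eq_zero
  rintro (x | x | x)
  · exact ⟨Sum.inl x, R.refl _⟩
  · exact ⟨Sum.inr x, R.refl _⟩
  · exact ⟨Sum.inr x, R.refl _⟩

section Disjoint

variable {U : Type*} {V : Type*} {W : Type*} {jL : U → W} {jR : V → W}

theorem map_sup_map_rel (R : Setoid U) (S : Setoid V)
    (h : Function.Bijective (Sum.elim jL jR)) (x y : U ⊕ V) :
    (R.map jL ⊔ S.map jR) (Sum.elim jL jR x) (Sum.elim jL jR y) ↔ Sum.LiftRel R S x y := by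
  constructor
  · let T : Setoid (U ⊕ V) :=
      { r := Sum.LiftRel R S
        iseqv := by
          refine ⟨?_, ?_, ?_⟩
          · rintro (x | x)
            · exact .inl (R.refl x)
            · exact .inr (S.refl x)
          · rintro _ _ (⟨h⟩ | ⟨h⟩)
            · exact .inl (R.symm h)
            · exact .inr (S.symm h)
          · rintro _ _ _ (⟨h⟩ | ⟨h⟩) (⟨h'⟩ | ⟨h'⟩)
            · exact .inl (R.trans h h')
            · exact .inr (S.trans h h') }
    have hT : R.map jL ⊔ S.map jR ≤ T.map (Sum.elim jL jR) := by
      refine sup_le (map_le_iff.2 fun x y h => ?_) (map_le_iff.2 fun x y h => ?_)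
      · exact Setoid.le_comap_map (f := Sum.elim jL jR)
          (show T (Sum.inl x) (Sum.inl y) from .inl h)
      · exact Setoid.le_comap_map (f := Sum.elim jL jR)
          (show T (Sum.inr x) (Sum.inr y) from .inr h)
    intro hxy
    have h2 : (T.map (Sum.elim jL jR)).comap (Sum.elim jL jR) x y := hT hxy
    rw [Setoid.comap_map_eq _ _ h.1] at h2
    exact h2
  · rintro (⟨h⟩ | ⟨h⟩)
    · exact (le_sup_left : R.map jL ≤ R.map jL ⊔ S.map jR) (Setoid.le_comap_map h)
    · exact (le_sup_right : S.map jR ≤ R.map jL ⊔ S.map jR) (Setoid.le_comap_map h)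

theorem isMatching_map_sup_map {R : Setoid U} {S : Setoid V}
    (h : Function.Bijective (Sum.elim jL jR)) (hR : IsMatching R) (hS : IsMatching S) :
    IsMatching (R.map jL ⊔ S.map jR) := by
  intro w
  obtain ⟨x, rfl⟩ := h.2 w
  rcases x with x | x
  · obtain ⟨y, ⟨hy1, hy2⟩, hy3⟩ := hR x
    refine ⟨Sum.elim jL jR (Sum.inl y), ⟨?_, (map_sup_map_rel R S h _ _).2 (.inl hy2)⟩, ?_⟩
    · exact fun e => hy1 (Sum.inl_injective (h.1 e))
    · rintro w ⟨hw1, hw2⟩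
      obtain ⟨z, rfl⟩ := h.2 w
      rcases (map_sup_map_rel R S h _ _).1 hw2 with @⟨_, z, hz⟩
      rw [hy3 z ⟨fun e => hw1 (by rw [e]), hz⟩]
  · obtain ⟨y, ⟨hy1, hy2⟩, hy3⟩ := hS x
    refine ⟨Sum.elim jL jR (Sum.inr y), ⟨?_, (map_sup_map_rel R S h _ _).2 (.inr hy2)⟩, ?_⟩
    · exact fun e => hy1 (Sum.inr_injective (h.1 e))
    · rintro w ⟨hw1, hw2⟩
      obtain ⟨z, rfl⟩ := h.2 w
      rcases (map_sup_map_rel R S h _ _).1 hw2 with _ | @⟨_, z, hz⟩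
      rw [hy3 z ⟨fun e => hw1 (by rw [e]), hz⟩]

variable {O : Type*} {OL : Type*} {OR : Type*} {iL : OL → O} {iR : OR → O}

theorem comap_map_sup_map (R : Setoid U) (S : Setoid V)
    (h : Function.Bijective (Sum.elim jL jR)) (h' : Function.Bijective (Sum.elim iL iR))
    {f : O → W} {fL : OL → U} {fR : OR → V} (hL : ∀ x, f (iL x) = jL (fL x))
    (hR : ∀ x, f (iR x) = jR (fR x)) :
    (R.map jL ⊔ S.map jR).comap f = (R.comap fL).map iL ⊔ (S.comap fR).map iR := by
  ext x y
  obtain ⟨x, rfl⟩ := h'.2 x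
  obtain ⟨y, rfl⟩ := h'.2 y
  have hf : ∀ z, f (Sum.elim iL iR z) = Sum.elim jL jR (Sum.map fL fR z) := by
    rintro (z | z)
    · exact hL z
    · exact hR z
  rw [Setoid.comap_rel, hf, hf, map_sup_map_rel _ _ h, map_sup_map_rel _ _ h']
  rcases x with x | x <;> rcases y with y | y <;> simp [Setoid.comap_rel]

theorem countMissing_map_sup_map [Finite W] (R : Setoid U) (S : Setoid V)
    (h : Function.Bijective (Sum.elim jL jR)) (h' : Function.Bijective (Sum.elim iL iR))
    {f : O → W} {fL : OL → U} {fR : OR → V} (hL : ∀ x, f (iL x) = jL (fL x))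
    (hR : ∀ x, f (iR x) = jR (fR x)) :
    countMissing (R.map jL ⊔ S.map jR) f = countMissing R fL + countMissing S fR := by
  have : Finite U := Finite.of_injective jL (fun x y e => Sum.inl_injective
    (h.1 (show Sum.elim jL jR (Sum.inl x) = Sum.elim jL jR (Sum.inl y) from e)))
  have : Finite V := Finite.of_injective jR (fun x y e => Sum.inr_injective
    (h.1 (show Sum.elim jL jR (Sum.inr x) = Sum.elim jL jR (Sum.inr y) from e)))
  have hrel := map_sup_map_rel R S h
  unfold countMissing
  rw [← Nat.card_sum]
  symm
  refine Nat.card_congr (Equiv.ofBijective (Sum.elim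
    (fun c => ⟨Quotient.map jL (fun _ _ e => (hrel (.inl _) (.inl _)).2 (.inl e)) c.1, ?_⟩)
    (fun c => ⟨Quotient.map jR (fun _ _ e => (hrel (.inr _) (.inr _)).2 (.inr e)) c.1, ?_⟩))
    ⟨?_, ?_⟩)
  · obtain ⟨c, hc⟩ := c
    induction c using Quotient.inductionOn with
    | h u =>
      intro a e
      have e' : (R.map jL ⊔ S.map jR) (f a) (jL u) := Quotient.exact e
      obtain ⟨a, rfl⟩ := h'.2 a
      rcases a with a | a
      · rw [Sum.elim_inl, hL] at e'
        rcases (hrel (.inl _) (.inl _)).1 e' with ⟨e'⟩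
        exact hc a (Quotient.sound e')
      · rw [Sum.elim_inr, hR] at e'
        cases (hrel (.inr _) (.inl _)).1 e'
  · obtain ⟨c, hc⟩ := c
    induction c using Quotient.inductionOn with
    | h u =>
      intro a e
      have e' : (R.map jL ⊔ S.map jR) (f a) (jR u) := Quotient.exact e
      obtain ⟨a, rfl⟩ := h'.2 a
      rcases a with a | a
      · rw [Sum.elim_inl, hL] at e'
        cases (hrel (.inl _) (.inr _)).1 e'
      · rw [Sum.elim_inr, hR] at e'
        rcases (hrel (.inr _) (.inr _)).1 e' with _ | ⟨e'⟩
        exact hc a (Quotient.sound e')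
  · rintro (⟨c, hc⟩ | ⟨c, hc⟩) (⟨c', hc'⟩ | ⟨c', hc'⟩) e <;>
    induction c using Quotient.inductionOn with
    | h u =>
      induction c' using Quotient.inductionOn with
      | h v =>
        have e' := Quotient.exact (congrArg Subtype.val e)
        first
        | rcases (hrel (.inl _) (.inl _)).1 e' with ⟨e'⟩
          exact congrArg Sum.inl (Subtype.ext (Quotient.sound e'))
        | cases (hrel (.inl _) (.inr _)).1 e'
        | cases (hrel (.inr _) (.inl _)).1 e'
        | rcases (hrel (.inr _) (.inr _)).1 e' with _ | ⟨e'⟩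
          exact congrArg Sum.inr (Subtype.ext (Quotient.sound e'))
  · rintro ⟨c, hc⟩
    induction c using Quotient.inductionOn with
    | h w =>
      obtain ⟨w, rfl⟩ := h.2 w
      rcases w with u | v
      · refine ⟨Sum.inl ⟨Quotient.mk _ u, fun a e => hc (iL a) ?_⟩, rfl⟩
        rw [hL]
        exact Quotient.sound ((hrel (.inl _) (.inl _)).2 (.inl (Quotient.exact e)))
      · refine ⟨Sum.inr ⟨Quotient.mk _ v, fun a e => hc (iR a) ?_⟩, rfl⟩
        rw [hR]
        exact Quotient.sound ((hrel (.inr _) (.inr _)).2 (.inr (Quotient.exact e)))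

end Disjoint

theorem IsMatching.exists_partner {R : Setoid α} (h : IsMatching R) :
    ∃ σ : α → α, (∀ x, σ x ≠ x) ∧ (∀ x, R x (σ x)) ∧ ∀ x y, R x y → y = x ∨ y = σ x := by
  choose σ h1 h2 using h
  refine ⟨σ, fun x => (h1 x).1, fun x => (h1 x).2, fun x y hxy => ?_⟩
  by_cases e : y = x
  · exact Or.inl e
  · exact Or.inr (h2 x y ⟨e, hxy⟩)

theorem IsMatching.sum_eq_zero [Fintype α] {R : Setoid α} (h : IsMatching R) (f : α → ZMod 2)
    (hf : ∀ x y, R x y → f x = f y) : ∑ x, f x = 0 := by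
  obtain ⟨σ, h1, h2, h3⟩ := h.exists_partner
  refine Finset.sum_involution (fun x _ => σ x) ?_ (fun x _ _ => h1 x) (fun _ _ => Finset.mem_univ _) ?_
  · intro x _
    rw [← hf x _ (h2 x)]
    exact CharTwo.add_self_eq_zero _
  · intro x _
    rcases h3 x _ (R.trans (h2 x) (h2 (σ x))) with e | e
    · exact e
    · exact absurd e (h1 (σ x))

theorem low_le_glue (R : Setoid (α ⊕ β)) (S : Setoid (β ⊕ γ)) {x y : α ⊕ β} (h : R x y) :
    glue R S (Sum.map id Sum.inl x) (Sum.map id Sum.inl y) :=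
  (le_sup_left : _ ≤ glue R S) (Setoid.le_comap_map h)

theorem up_le_glue (R : Setoid (α ⊕ β)) (S : Setoid (β ⊕ γ)) {x y : β ⊕ γ} (h : S x y) :
    glue R S (Sum.inr x) (Sum.inr y) :=
  (le_sup_right : _ ≤ glue R S) (Setoid.le_comap_map h)

theorem sum_glue [Fintype α] [Fintype β] [Fintype γ] {R : Setoid (α ⊕ β)} {S : Setoid (β ⊕ γ)}
    (hR : IsMatching R) (hS : IsMatching S) (g : α ⊕ β ⊕ γ → ZMod 2)
    (hg : ∀ x y, glue R S x y → g x = g y) :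
    ∑ x, g (Sum.inl x) + ∑ x, g (Sum.inr (Sum.inl x)) = 0 ∧
      ∑ x, g (Sum.inr (Sum.inl x)) + ∑ x, g (Sum.inr (Sum.inr x)) = 0 := by
  have h1 := hR.sum_eq_zero (fun x => g (Sum.map id Sum.inl x))
    (fun x y h => hg _ _ (low_le_glue R S h))
  have h2 := hS.sum_eq_zero (fun x => g (Sum.inr x)) (fun x y h => hg _ _ (up_le_glue R S h))
  rw [Fintype.sum_sum_type] at h1 h2
  exact ⟨h1, h2⟩

/-- A path component of the glued picture contains at most two outer end points. -/
theorem glueOuter_unique [Finite α] [Finite β] [Finite γ] {R : Setoid (α ⊕ β)}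
    {S : Setoid (β ⊕ γ)} (hR : IsMatching R) (hS : IsMatching S) {x y z : α ⊕ γ}
    (hxy : glueOuter R S x y) (hxz : glueOuter R S x z) (h1 : y ≠ x) (h2 : z ≠ x) : y = z := by
  classical
  by_contra h3
  obtain ⟨σ, -, -, hσ⟩ := hR.exists_partner
  obtain ⟨τ, -, -, hτ⟩ := hS.exists_partner
  have := Fintype.ofFinite α
  have := Fintype.ofFinite β
  have := Fintype.ofFinite γ
  have hlow : Function.Injective (Sum.map id Sum.inl : α ⊕ β → α ⊕ β ⊕ γ) :=
    Function.injective_id.sumMap Sum.inl_injective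
  have hout : Function.Injective (Sum.map id Sum.inr : α ⊕ γ → α ⊕ β ⊕ γ) :=
    Function.injective_id.sumMap Sum.inr_injective
  let G : SimpleGraph (α ⊕ β ⊕ γ) :=
    { Adj := fun u v => u ≠ v ∧
        (R.map (Sum.map id Sum.inl) u v ∨ S.map Sum.inr u v)
      symm := ⟨fun u v h => ⟨h.1.symm, h.2.imp (fun h => Setoid.symm' _ h)
        (fun h => Setoid.symm' _ h)⟩⟩
      loopless := ⟨fun u h => h.1 rfl⟩ }
  have hreach : glue R S ≤ G.reachableSetoid := by
    refine sup_le ?_ ?_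
    · intro u v h
      by_cases e : u = v
      · subst e; exact SimpleGraph.Reachable.refl _
      · exact SimpleGraph.Adj.reachable ⟨e, Or.inl h⟩
    · intro u v h
      by_cases e : u = v
      · subst e; exact SimpleGraph.Reachable.refl _
      · exact SimpleGraph.Adj.reachable ⟨e, Or.inr h⟩
  let nb : α ⊕ β ⊕ γ → Finset (α ⊕ β ⊕ γ) := fun v =>
    match v with
    | Sum.inl a => {Sum.map id Sum.inl (σ (Sum.inl a))}
    | Sum.inr (Sum.inl b) => {Sum.map id Sum.inl (σ (Sum.inr b)), Sum.inr (τ (Sum.inl b))}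
    | Sum.inr (Sum.inr c) => {Sum.inr (τ (Sum.inr c))}
  let wt : α ⊕ β ⊕ γ → ℕ := fun v =>
    match v with
    | Sum.inl _ => 1
    | Sum.inr (Sum.inl _) => 2
    | Sum.inr (Sum.inr _) => 1
  have hwt2 : ∀ v, wt v ≤ 2 := by
    rintro (a | b | c) <;> simp [wt]
  have hwt : ∀ v, (nb v).card ≤ wt v := by
    rintro (a | b | c)
    · simp [nb, wt]
    · exact Finset.card_le_two
    · simp [nb, wt]
  have hnb : ∀ u v, G.Adj u v → v ∈ nb u := by
    rintro u v ⟨hne, h | h⟩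
    · rcases (map_rel hlow).1 h with ⟨p, q, hpq, rfl, rfl⟩ | h
      · rcases hσ p q hpq with rfl | rfl
        · exact absurd rfl hne
        · rcases p with p | p <;> simp [nb]
      · exact absurd h hne
    · rcases (map_rel Sum.inr_injective).1 h with ⟨p, q, hpq, rfl, rfl⟩ | h
      · rcases hτ p q hpq with rfl | rfl
        · exact absurd rfl hne
        · rcases p with p | p <;> simp [nb]
      · exact absurd h hne
  let C := G.connectedComponentMk (Sum.map id Sum.inr x)
  have hC : ∀ w, glueOuter R S x w → Sum.map id Sum.inr w ∈ C.supp := by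
    intro w hw
    exact SimpleGraph.ConnectedComponent.sound (hreach hw).symm
  have hcon := C.connected_toSimpleGraph
  have hcard := hcon.card_vert_le_card_edgeSet_add_one
  have hdeg := C.toSimpleGraph.sum_degrees_eq_twice_card_edges
  have hdle : ∀ v : C, C.toSimpleGraph.degree v ≤ wt v.1 := by
    intro v
    refine le_trans ?_ (hwt v.1)
    rw [← SimpleGraph.card_neighborFinset_eq_degree]
    refine Finset.card_le_card_of_injOn Subtype.val ?_ Subtype.val_injective.injOn
    intro u hu
    apply hnb
    have hu' : C.toSimpleGraph.Adj v u := by simpa using hu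
    exact hu'
  have hsum : ∑ v : C, C.toSimpleGraph.degree v ≤ ∑ v : C, wt v.1 :=
    Finset.sum_le_sum fun v _ => hdle v
  have hsub : ∑ v : C, (2 - wt v.1) + ∑ v : C, wt v.1 = 2 * Nat.card C := by
    rw [← Finset.sum_add_distrib, Finset.sum_congr rfl
      (fun v _ => Nat.sub_add_cancel (hwt2 v.1))]
    simp [mul_comm, Nat.card_eq_fintype_card]
  have hE : Nat.card C.toSimpleGraph.edgeSet = C.toSimpleGraph.edgeFinset.card := by
    rw [Nat.card_eq_fintype_card, SimpleGraph.edgeFinset_card]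
  have h3' : 3 ≤ ∑ v : C, (2 - wt v.1) := by
    let X : C := ⟨Sum.map id Sum.inr x, hC x (Setoid.refl' _ _)⟩
    let Y : C := ⟨Sum.map id Sum.inr y, hC y hxy⟩
    let Z : C := ⟨Sum.map id Sum.inr z, hC z hxz⟩
    have hXY : X ≠ Y := fun e => h1 (hout (congrArg Subtype.val e)).symm
    have hXZ : X ≠ Z := fun e => h2 (hout (congrArg Subtype.val e)).symm
    have hYZ : Y ≠ Z := fun e => h3 (hout (congrArg Subtype.val e))
    have h1' : ∀ w : α ⊕ γ, 2 - wt (Sum.map id Sum.inr w) = 1 := by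
      rintro (w | w) <;> rfl
    calc 3 = ∑ v ∈ ({X, Y, Z} : Finset C), (2 - wt v.1) := by
          rw [Finset.sum_insert (by simp [hXY, hXZ]), Finset.sum_pair hYZ]
          rw [h1' x, h1' y, h1' z]
          rfl
      _ ≤ _ := Finset.sum_le_sum_of_subset (Finset.subset_univ _)
  omega

theorem isMatching_glueOuter [Finite α] [Finite β] [Finite γ] {R : Setoid (α ⊕ β)}
    {S : Setoid (β ⊕ γ)} (hR : IsMatching R) (hS : IsMatching S) :
    IsMatching (glueOuter R S) := by
  classical
  have := Fintype.ofFinite α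
  have := Fintype.ofFinite β
  have := Fintype.ofFinite γ
  intro x
  have hex : ∃ y, y ≠ x ∧ glueOuter R S x y := by
    by_contra hno
    push Not at hno
    obtain ⟨h1, h2⟩ := sum_glue hR hS
      (fun v => if glue R S (Sum.map id Sum.inr x) v then 1 else 0) (by
        intro u v huv
        have : glue R S (Sum.map id Sum.inr x) u ↔ glue R S (Sum.map id Sum.inr x) v :=
          ⟨fun h => Setoid.trans' _ h huv, fun h => Setoid.trans' _ h (Setoid.symm' _ huv)⟩
        simp only [this])
    have h3 : ∑ w : α ⊕ γ,
        (if glue R S (Sum.map id Sum.inr x) (Sum.map id Sum.inr w) then (1 : ZMod 2) else 0)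
          = 1 := by
      rw [Finset.sum_eq_single x]
      · rw [if_pos (Setoid.refl' _ _)]
      · intro w _ hw
        exact if_neg (hno w hw)
      · simp
    rw [Fintype.sum_sum_type] at h3
    have h5 : (1 : ZMod 2) = 0 := h3.symm.trans (CharTwo.add_eq_zero.2
      ((CharTwo.add_eq_zero.1 h1).trans (CharTwo.add_eq_zero.1 h2)))
    exact absurd h5 (by decide)
  obtain ⟨y, hy1, hy2⟩ := hex
  exact ⟨y, ⟨hy1, hy2⟩, fun z hz => glueOuter_unique hR hS hz.2 hy2 hz.1 hy1⟩

end Gluing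

section Planar

/-- The boundary of the rectangle, met clockwise from the lower right corner: first the `n` lower
points from right to left, then the `m` upper points from left to right. The point number `i` on the
lower edge has position `-(i + 1)` and the point number `j` on the upper edge has position `j`. -/
def pos {n m : ℕ} : Fin n ⊕ Fin m → ℤ
  | Sum.inl i => -((i : ℤ) + 1)
  | Sum.inr j => (j : ℤ)

/-- No two joined pairs of boundary points of the rectangle separate each other. -/
def NonCrossing {n m : ℕ} (R : Setoid (Fin n ⊕ Fin m)) : Prop :=
  ∀ a b c e, R a b → R c e → ¬ (pos a < pos c ∧ pos c < pos b ∧ pos b < pos e)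

theorem pos_injective {n m : ℕ} : Function.Injective (pos : Fin n ⊕ Fin m → ℤ) := by
  rintro (i | i) (j | j) h <;> simp only [pos] at h
  · congr 1; ext; omega
  · omega
  · omega
  · congr 1; ext; omega

/-- The number modulo two of points before `y`, weighted by `g`. -/
def wind {n m : ℕ} (g : Fin n ⊕ Fin m → ZMod 2) (y : Fin n ⊕ Fin m) : ZMod 2 :=
  ∑ x, if pos x < pos y then g x else 0

theorem separate_iff {a b y z : ℤ} (e1 : y ≠ a) (e2 : y ≠ b) (e3 : z ≠ a) (e4 : z ≠ b)
    (n1 : ¬ (a < y ∧ y < b ∧ b < z)) (n2 : ¬ (a < z ∧ z < b ∧ b < y))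
    (n3 : ¬ (b < y ∧ y < a ∧ a < z)) (n4 : ¬ (b < z ∧ z < a ∧ a < y))
    (n5 : ¬ (y < a ∧ a < z ∧ z < b)) (n6 : ¬ (y < b ∧ b < z ∧ z < a))
    (n7 : ¬ (z < a ∧ a < y ∧ y < b)) (n8 : ¬ (z < b ∧ b < y ∧ y < a)) :
    (a < y ↔ a < z) ↔ (b < y ↔ b < z) := by
  rcases e1.lt_or_gt with h1 | h1 <;> rcases e2.lt_or_gt with h2 | h2 <;>
    rcases e3.lt_or_gt with h3 | h3 <;> rcases e4.lt_or_gt with h4 | h4 <;>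
    first
    | exact absurd ⟨by assumption, by assumption, by assumption⟩ n1
    | exact absurd ⟨by assumption, by assumption, by assumption⟩ n2
    | exact absurd ⟨by assumption, by assumption, by assumption⟩ n3
    | exact absurd ⟨by assumption, by assumption, by assumption⟩ n4
    | exact absurd ⟨by assumption, by assumption, by assumption⟩ n5
    | exact absurd ⟨by assumption, by assumption, by assumption⟩ n6
    | exact absurd ⟨by assumption, by assumption, by assumption⟩ n7
    | exact absurd ⟨by assumption, by assumption, by assumption⟩ n8
    | simp [h1, h2, h3, h4, h1.not_gt, h2.not_gt, h3.not_gt, h4.not_gt]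

theorem ite_add_ite_two (p q : Prop) [Decidable p] [Decidable q] (t : ZMod 2) :
    (if p then t else 0) + (if q then t else 0) = if (p ↔ q) then 0 else t := by
  have h : t + t = 0 := CharTwo.add_self_eq_zero _
  by_cases hp : p <;> by_cases hq : q <;> simp [hp, hq, h]

theorem wind_eq {n m : ℕ} {R : Setoid (Fin n ⊕ Fin m)} (hR : IsMatching R) (hN : NonCrossing R)
    (g : Fin n ⊕ Fin m → ZMod 2) (hg : ∀ x y, R x y → g x = g y) {y z : Fin n ⊕ Fin m}
    (hyz : R y z) (hy : g y = 0) : wind g y = wind g z := by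
  rw [← sub_eq_zero, CharTwo.sub_eq_add]
  unfold wind
  rw [← Finset.sum_add_distrib]
  apply hR.sum_eq_zero
  intro a b hab
  rw [← hg a b hab]
  by_cases ha : g a = 0
  · simp [ha]
  have hya : ¬ R y a := fun h => ha (by rw [← hg y a h, hy])
  have hyb : ¬ R y b := fun h => hya (R.trans h (R.symm hab))
  have e1 : pos y ≠ pos a := fun e => hya (by rw [pos_injective e])
  have e2 : pos y ≠ pos b := fun e => hyb (by rw [pos_injective e])
  have e3 : pos z ≠ pos a := fun e => hya (by rw [← pos_injective e]; exact hyz)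
  have e4 : pos z ≠ pos b := fun e => hyb (by rw [← pos_injective e]; exact hyz)
  have n1 := hN a b y z hab hyz
  have n2 := hN a b z y hab (R.symm hyz)
  have n3 := hN b a y z (R.symm hab) hyz
  have n4 := hN b a z y (R.symm hab) (R.symm hyz)
  have n5 := hN y z a b hyz hab
  have n6 := hN y z b a hyz (R.symm hab)
  have n7 := hN z y a b (R.symm hyz) hab
  have n8 := hN z y b a (R.symm hyz) (R.symm hab)
  have key := separate_iff e1 e2 e3 e4 n1 n2 n3 n4 n5 n6 n7 n8
  rw [ite_add_ite_two, ite_add_ite_two]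
  simp only [key]

theorem wind_inl {n m : ℕ} (g : Fin n ⊕ Fin m → ZMod 2) (i : Fin n) :
    wind g (Sum.inl i) = ∑ x, if i < x then g (Sum.inl x) else 0 := by
  unfold wind
  rw [Fintype.sum_sum_type]
  have h2 : ∑ x : Fin m, (if pos (Sum.inr x : Fin n ⊕ Fin m) < pos (Sum.inl i : Fin n ⊕ Fin m)
      then g (Sum.inr x) else 0) = 0 := by
    refine Finset.sum_eq_zero fun x _ => if_neg ?_
    simp only [pos]
    omega
  rw [h2, add_zero]
  refine Finset.sum_congr rfl fun x _ => ?_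
  have : pos (Sum.inl x : Fin n ⊕ Fin m) < pos (Sum.inl i : Fin n ⊕ Fin m) ↔ i < x := by
    simp only [pos]
    rw [Fin.lt_def]
    omega
  simp only [this]

theorem wind_inr {n m : ℕ} (g : Fin n ⊕ Fin m → ZMod 2) (j : Fin m) :
    wind g (Sum.inr j) = ∑ x, g (Sum.inl x) + ∑ x, if x < j then g (Sum.inr x) else 0 := by
  unfold wind
  rw [Fintype.sum_sum_type]
  congr 1
  · refine Finset.sum_congr rfl fun x _ => if_pos ?_
    simp only [pos]
    omega
  · refine Finset.sum_congr rfl fun x _ => ?_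
    have : pos (Sum.inr x : Fin n ⊕ Fin m) < pos (Sum.inr j : Fin n ⊕ Fin m) ↔ x < j := by
      simp only [pos]
      rw [Fin.lt_def]
      omega
    simp only [this]

theorem sum_lt_add_sum_gt {m : ℕ} (g : Fin m → ZMod 2) (j : Fin m) (hj : g j = 0) :
    ∑ x, (if x < j then g x else 0) + ∑ x, (if j < x then g x else 0) = ∑ x, g x := by
  rw [← Finset.sum_add_distrib]
  refine Finset.sum_congr rfl fun x _ => ?_
  rcases lt_trichotomy x j with h | rfl | h
  · simp [h, h.not_gt]
  · simp [hj]
  · simp [h, h.not_gt]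

theorem nonCrossing_glueOuter {n m p : ℕ} {R : Setoid (Fin n ⊕ Fin m)} {S : Setoid (Fin m ⊕ Fin p)}
    (hR : IsMatching R) (hS : IsMatching S) (hRN : NonCrossing R) (hSN : NonCrossing S) :
    NonCrossing (glueOuter R S) := by
  classical
  intro a b c e hab hce ⟨l1, l2, l3⟩
  have hM := isMatching_glueOuter hR hS
  have hab' : ∀ x, glueOuter R S a x → x = a ∨ x = b := by
    intro x hx
    by_cases hxa : x = a
    · exact Or.inl hxa
    · refine Or.inr ((hM a).unique ⟨hxa, hx⟩ ⟨?_, hab⟩)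
      rintro rfl
      omega
  have hac : ¬ glueOuter R S a c := by
    intro h
    rcases hab' c h with rfl | rfl <;> omega
  let g : Fin n ⊕ Fin m ⊕ Fin p → ZMod 2 := fun v =>
    if glue R S (Sum.map id Sum.inr a) v then 1 else 0
  have hg : ∀ u v, glue R S u v → g u = g v := by
    intro u v huv
    have : glue R S (Sum.map id Sum.inr a) u ↔ glue R S (Sum.map id Sum.inr a) v :=
      ⟨fun h => Setoid.trans' _ h huv, fun h => Setoid.trans' _ h (Setoid.symm' _ huv)⟩
    simp only [g, this]
  obtain ⟨s1, s2⟩ := sum_glue hR hS g hg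
  have s1' := CharTwo.add_eq_zero.1 s1
  have s2' := CharTwo.add_eq_zero.1 s2
  let low : Fin n ⊕ Fin m → Fin n ⊕ Fin m ⊕ Fin p := Sum.map id Sum.inl
  let out : Fin n ⊕ Fin p → Fin n ⊕ Fin m ⊕ Fin p := Sum.map id Sum.inr
  let W : Fin n ⊕ Fin m ⊕ Fin p → ZMod 2 := fun v =>
    match v with
    | Sum.inl i => wind (g ∘ out) (Sum.inl i)
    | Sum.inr (Sum.inl j) => wind (g ∘ low) (Sum.inr j)
    | Sum.inr (Sum.inr k) => wind (g ∘ out) (Sum.inr k)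
  have hWlow : ∀ x, W (low x) = wind (g ∘ low) x := by
    rintro (i | j)
    · change wind (g ∘ out) (Sum.inl i) = wind (g ∘ low) (Sum.inl i)
      rw [wind_inl, wind_inl]
      rfl
    · rfl
  have hWup : ∀ x, g (Sum.inr x) = 0 → W (Sum.inr x) = wind (g ∘ Sum.inr) x := by
    rintro (j | k) h0
    · change wind (g ∘ low) (Sum.inr j) = wind (g ∘ Sum.inr) (Sum.inl j)
      rw [wind_inl, wind_inr]
      have h1 := sum_lt_add_sum_gt (fun j => g (Sum.inr (Sum.inl j))) j h0
      change ∑ x, g (Sum.inl x) + _ = _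
      rw [s1', ← h1]
      have h2 : ∀ u v : ZMod 2, u + v + u = v := by decide
      exact h2 _ _
    · change wind (g ∘ out) (Sum.inr k) = wind (g ∘ Sum.inr) (Sum.inr k)
      rw [wind_inr, wind_inr]
      change ∑ x, g (Sum.inl x) + _ = ∑ x, g (Sum.inr (Sum.inl x)) + _
      rw [s1']
      rfl
  have hWout : ∀ x, W (out x) = wind (g ∘ out) x := by
    rintro (i | k) <;> rfl
  have hle : glue R S ≤ Setoid.ker (fun v => (g v, if g v = 0 then W v else 0)) := by
    refine sup_le (map_le_iff.2 ?_) (map_le_iff.2 ?_)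
    · intro x y h
      have h1 := hg _ _ (low_le_glue R S h)
      refine Prod.ext h1 ?_
      change (if g (low x) = 0 then W (low x) else 0) = (if g (low y) = 0 then W (low y) else 0)
      change g (low x) = g (low y) at h1
      rw [← h1]
      split_ifs with h0
      · rw [hWlow, hWlow]
        exact wind_eq hR hRN (g ∘ low) (fun x y h => hg _ _ (low_le_glue R S h)) h h0
      · rfl
    · intro x y h
      have h1 := hg _ _ (up_le_glue R S h)
      refine Prod.ext h1 ?_
      change (if g (Sum.inr x) = 0 then W (Sum.inr x) else 0) =
        (if g (Sum.inr y) = 0 then W (Sum.inr y) else 0)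
      rw [← h1]
      split_ifs with h0
      · rw [hWup _ h0, hWup _ (h1 ▸ h0)]
        exact wind_eq hS hSN (g ∘ Sum.inr) (fun x y h => hg _ _ (up_le_glue R S h)) h h0
      · rfl
  have hgc : g (out c) = 0 := if_neg hac
  have hge : g (out e) = 0 := by rw [← hg _ _ hce]; exact hgc
  have hfin : wind (g ∘ out) c = wind (g ∘ out) e := by
    have h1 := congrArg Prod.snd (hle hce)
    change (if g (out c) = 0 then W (out c) else 0) =
      (if g (out e) = 0 then W (out e) else 0) at h1
    rwa [if_pos hgc, if_pos hge, hWout, hWout] at h1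
  have hgo : ∀ x, g (out x) = if x = a ∨ x = b then 1 else 0 := by
    intro x
    by_cases h : glueOuter R S a x
    · rw [if_pos (hab' x h)]
      exact if_pos h
    · rw [if_neg]
      · exact if_neg h
      · rintro (rfl | rfl)
        · exact h (Setoid.refl' _ _)
        · exact h hab
  have hc : wind (g ∘ out) c = 1 := by
    unfold wind
    rw [Finset.sum_eq_single a]
    · rw [if_pos l1, Function.comp_apply, hgo, if_pos (Or.inl rfl)]
    · intro x _ hx
      split_ifs with h
      · rw [Function.comp_apply, hgo, if_neg]
        rintro (rfl | rfl)
        · exact hx rfl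
        · omega
      · rfl
    · simp
  have he : wind (g ∘ out) e = 0 := by
    have hne : a ≠ b := by
      rintro rfl
      omega
    unfold wind
    rw [← Finset.sum_subset (Finset.subset_univ {a, b}), Finset.sum_pair hne, if_pos (by omega),
      if_pos l3, Function.comp_apply, Function.comp_apply, hgo, hgo, if_pos (Or.inl rfl),
      if_pos (Or.inr rfl)]
    · exact CharTwo.add_self_eq_zero _
    · intro x _ hx
      rw [Function.comp_apply, hgo, if_neg (c := x = a ∨ x = b) (by simpa using hx)]
      exact ite_self _
  rw [hc, he] at hfin
  exact absurd hfin (by decide)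

end Planar

section Diagrams

/-- A Kauffman diagram with `n` end points on the lower edge and `m` end points on the upper edge of
a rectangle: the isotopy class of a family of disjoint curves in the rectangle joining the end points
in pairs, i.e. a pairing of the end points in which no two pairs cross. -/
@[ext]
structure Diagram (n m : ℕ) where
  /-- two end points are related iff they are equal or joined by a curve -/
  rel : Setoid (Fin n ⊕ Fin m)
  matching : IsMatching rel
  nonCrossing : NonCrossing rel

instance (n m : ℕ) : Finite (Diagram n m) := by
  refine Finite.of_injective (fun D : Diagram n m => fun x y => D.rel x y) ?_
  intro D E h
  ext x y
  exact iff_of_eq (congrFun (congrFun h x) y)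

instance : Subsingleton (Diagram 0 0) := by
  refine ⟨fun D E => ?_⟩
  ext x y
  exact isEmptyElim x

/-- The diagram consisting of `n` vertical lines. -/
def Diagram.id (n : ℕ) : Diagram n n where
  rel := idRel (Fin n)
  matching := isMatching_idRel _
  nonCrossing := by
    rintro (a | a) (b | b) (c | c) (e | e) h1 h2 ⟨h3, h4, h5⟩ <;>
      cases (show a = b from h1) <;> cases (show c = e from h2) <;> simp only [pos] at h3 h4 h5 <;>
      omega

/-- Concatenation: `E` is put on top of `D` and the closed loops are removed. -/
def Diagram.comp {n m p : ℕ} (D : Diagram n m) (E : Diagram m p) : Diagram n p where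
  rel := glueOuter D.rel E.rel
  matching := isMatching_glueOuter D.matching E.matching
  nonCrossing := nonCrossing_glueOuter D.matching E.matching D.nonCrossing E.nonCrossing

/-- The number of closed loops which appear when `E` is put on top of `D`. -/
noncomputable def Diagram.loops {n m p : ℕ} (D : Diagram n m) (E : Diagram m p) : ℕ :=
  glueLoops D.rel E.rel

/-- The position of the end points of the left diagram in a juxtaposition. -/
def inLeft {n m : ℕ} (n' m' : ℕ) : Fin n ⊕ Fin m → Fin (n + n') ⊕ Fin (m + m') :=
  Sum.map (Fin.castAdd n') (Fin.castAdd m')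

/-- The position of the end points of the right diagram in a juxtaposition. -/
def inRight (n m : ℕ) {n' m' : ℕ} : Fin n' ⊕ Fin m' → Fin (n + n') ⊕ Fin (m + m') :=
  Sum.map (Fin.natAdd n) (Fin.natAdd m)

theorem bijective_fin (n n' : ℕ) :
    Function.Bijective (Sum.elim (Fin.castAdd n') (Fin.natAdd n) : Fin n ⊕ Fin n' → Fin (n + n')) :=
  (finSumFinEquiv (m := n) (n := n')).bijective

theorem bijective_sum {A B A' B' C C' : Type} {f : A → C} {g : B → C} {f' : A' → C'}
    {g' : B' → C'} (h : Function.Bijective (Sum.elim f g)) (h' : Function.Bijective (Sum.elim f' g')) :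
    Function.Bijective (Sum.elim (Sum.map f f') (Sum.map g g')) := by
  have : Sum.elim (Sum.map f f') (Sum.map g g') =
      Sum.map (Sum.elim f g) (Sum.elim f' g') ∘ Equiv.sumSumSumComm A A' B B' := by
    funext x
    rcases x with (x | x) | (x | x) <;> rfl
  rw [this]
  exact (Sum.map_bijective.2 ⟨h, h'⟩).comp (Equiv.bijective _)

theorem bijective_inLeft_inRight (n m n' m' : ℕ) :
    Function.Bijective (Sum.elim (inLeft (n := n) (m := m) n' m') (inRight n m)) :=
  bijective_sum (bijective_fin n n') (bijective_fin m m')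

theorem nonCrossing_tensor {n m n' m' : ℕ} {R : Setoid (Fin n ⊕ Fin m)}
    {S : Setoid (Fin n' ⊕ Fin m')} (hR : NonCrossing R) (hS : NonCrossing S) :
    NonCrossing (R.map (inLeft n' m') ⊔ S.map (inRight n m)) := by
  have hb := bijective_inLeft_inRight n m n' m'
  have hL : ∀ x : Fin n ⊕ Fin m, pos (inLeft n' m' x) = pos x := by
    rintro (x | x) <;> simp [pos, inLeft]
  have hRR : ∀ x y : Fin n' ⊕ Fin m', pos (inRight n m x) < pos (inRight n m y) → pos x < pos y := by
    rintro (x | x) (y | y) <;> simp [pos, inRight] <;> omega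
  have hbet : ∀ (x y : Fin n ⊕ Fin m) (z : Fin n' ⊕ Fin m'),
      pos (inLeft n' m' x) < pos (inRight n m z) →
      pos (inRight n m z) < pos (inLeft n' m' y) → False := by
    rintro (x | x) (y | y) (z | z) <;> simp [pos, inLeft, inRight] <;> omega
  intro a b c e hab hce ⟨h1, h2, h3⟩
  obtain ⟨a, rfl⟩ := hb.2 a
  obtain ⟨b, rfl⟩ := hb.2 b
  obtain ⟨c, rfl⟩ := hb.2 c
  obtain ⟨e, rfl⟩ := hb.2 e
  rcases (map_sup_map_rel R S hb _ _).1 hab with @⟨a, b, kab⟩ | @⟨a, b, kab⟩ <;>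
    rcases (map_sup_map_rel R S hb _ _).1 hce with @⟨c, e, kce⟩ | @⟨c, e, kce⟩ <;>
    simp only [Sum.elim_inl, Sum.elim_inr] at h1 h2 h3
  · rw [hL, hL] at h1 h2 h3
    exact hR a b c e kab kce ⟨h1, h2, h3⟩
  · exact hbet a b c h1 h2
  · exact hbet c e b h2 h3
  · exact hS a b c e kab kce ⟨hRR _ _ h1, hRR _ _ h2, hRR _ _ h3⟩

/-- Juxtaposition: `D` is put to the left of `E`. -/
def Diagram.tensor {n m n' m' : ℕ} (D : Diagram n m) (E : Diagram n' m') :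
    Diagram (n + n') (m + m') where
  rel := D.rel.map (inLeft n' m') ⊔ E.rel.map (inRight n m)
  matching := isMatching_map_sup_map (bijective_inLeft_inRight n m n' m') D.matching E.matching
  nonCrossing := nonCrossing_tensor D.nonCrossing E.nonCrossing

/-- The arc joining two points on the lower edge. -/
def Diagram.cap : Diagram (1 + 1) 0 where
  rel := ⊤
  matching := by
    rintro (x | x)
    · refine ⟨Sum.inl x.rev, ⟨?_, trivial⟩, ?_⟩
      · fin_cases x <;> decide
      · rintro (y | y) ⟨h, -⟩
        · fin_cases x <;> fin_cases y <;> first | rfl | exact absurd rfl h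
        · exact y.elim0
    · exact x.elim0
  nonCrossing := by
    rintro (a | a) (b | b) (c | c) (e | e) - - ⟨h1, h2, h3⟩ <;> simp only [pos] at h1 h2 h3 <;> omega

/-- The arc joining two points on the upper edge. -/
def Diagram.cup : Diagram 0 (1 + 1) where
  rel := ⊤
  matching := by
    rintro (x | x)
    · exact x.elim0
    · refine ⟨Sum.inr x.rev, ⟨?_, trivial⟩, ?_⟩
      · fin_cases x <;> decide
      · rintro (y | y) ⟨h, -⟩
        · exact y.elim0
        · fin_cases x <;> fin_cases y <;> first | rfl | exact absurd rfl h
  nonCrossing := by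
    rintro (a | a) (b | b) (c | c) (e | e) - - ⟨h1, h2, h3⟩ <;> simp only [pos] at h1 h2 h3 <;> omega

theorem Diagram.id_comp {n m : ℕ} (D : Diagram n m) : (Diagram.id n).comp D = D :=
  Diagram.ext (glueOuter_idRel_left D.rel)

theorem Diagram.comp_id {n m : ℕ} (D : Diagram n m) : D.comp (Diagram.id m) = D :=
  Diagram.ext (glueOuter_idRel_right D.rel)

theorem Diagram.assoc {n m p q : ℕ} (D : Diagram n m) (E : Diagram m p) (F : Diagram p q) :
    (D.comp E).comp F = D.comp (E.comp F) :=
  Diagram.ext (glueOuter_assoc D.rel E.rel F.rel)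

theorem Diagram.loops_id_left {n m : ℕ} (D : Diagram n m) : (Diagram.id n).loops D = 0 :=
  glueLoops_idRel_left D.rel

theorem Diagram.loops_id_right {n m : ℕ} (D : Diagram n m) : D.loops (Diagram.id m) = 0 :=
  glueLoops_idRel_right D.rel

theorem Diagram.loops_assoc {n m p q : ℕ} (D : Diagram n m) (E : Diagram m p) (F : Diagram p q) :
    D.loops E + (D.comp E).loops F = E.loops F + D.loops (E.comp F) :=
  glueLoops_assoc D.rel E.rel F.rel

theorem glue_tensor {n m p n' m' p' : ℕ} (R₁ : Setoid (Fin n ⊕ Fin m)) (R₂ : Setoid (Fin m ⊕ Fin p))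
    (S₁ : Setoid (Fin n' ⊕ Fin m')) (S₂ : Setoid (Fin m' ⊕ Fin p')) :
    glue (R₁.map (inLeft n' m') ⊔ S₁.map (inRight n m))
        (R₂.map (inLeft m' p') ⊔ S₂.map (inRight m p)) =
      (glue R₁ R₂).map (Sum.map (Fin.castAdd n') (inLeft m' p')) ⊔
        (glue S₁ S₂).map (Sum.map (Fin.natAdd n) (inRight m p)) := by
  unfold glue
  simp only [map_sup, map_map]
  rw [sup_sup_sup_comm]
  congr 2 <;> congr 1 <;> funext x <;> rcases x with x | x <;> rfl

theorem Diagram.tensor_comp {n m p n' m' p' : ℕ} (D₁ : Diagram n m) (D₂ : Diagram m p)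
    (E₁ : Diagram n' m') (E₂ : Diagram m' p') :
    (D₁.tensor E₁).comp (D₂.tensor E₂) = (D₁.comp D₂).tensor (E₁.comp E₂) := by
  apply Diagram.ext
  change Setoid.comap _ (glue _ _) = _
  simp only [Diagram.tensor]
  rw [glue_tensor]
  refine comap_map_sup_map _ _ (bijective_sum (bijective_fin n n')
    (bijective_inLeft_inRight m p m' p')) (bijective_inLeft_inRight n p n' p') ?_ ?_ <;>
  · rintro (x | x) <;> rfl

theorem Diagram.loops_tensor {n m p n' m' p' : ℕ} (D₁ : Diagram n m) (D₂ : Diagram m p)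
    (E₁ : Diagram n' m') (E₂ : Diagram m' p') :
    (D₁.tensor E₁).loops (D₂.tensor E₂) = D₁.loops D₂ + E₁.loops E₂ := by
  change countMissing (glue _ _) _ = _
  simp only [Diagram.tensor]
  rw [glue_tensor]
  refine countMissing_map_sup_map _ _ (bijective_sum (bijective_fin n n')
    (bijective_inLeft_inRight m p m' p')) (bijective_inLeft_inRight n p n' p') ?_ ?_ <;>
  · rintro (x | x) <;> rfl

theorem Diagram.tensor_id (n m : ℕ) :
    (Diagram.id n).tensor (Diagram.id m) = Diagram.id (n + m) := by
  apply Diagram.ext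
  change (idRel (Fin n)).map (inLeft m m) ⊔ (idRel (Fin m)).map (inRight n n) = idRel (Fin (n + m))
  ext x y
  have hb := bijective_inLeft_inRight n n m m
  obtain ⟨x, rfl⟩ := hb.2 x
  obtain ⟨y, rfl⟩ := hb.2 y
  refine (map_sup_map_rel _ _ hb x y).trans ?_
  have hne : ∀ (a : Fin n) (b : Fin m), Fin.castAdd m a ≠ Fin.natAdd n b := by
    intro a b h
    have := congrArg Fin.val h
    simp at this
    omega
  rcases x with (x | x) | (x | x) <;> rcases y with (y | y) | (y | y) <;>
    simp [idRel_iff, inLeft, inRight, hne, (hne _ _).symm]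

/-- Renumbering the end points along equalities. -/
def relabel {n m n' m' : ℕ} (hn : n = n') (hm : m = m') : Fin n ⊕ Fin m → Fin n' ⊕ Fin m' :=
  Sum.map (Fin.cast hn) (Fin.cast hm)

theorem Diagram.tensor_assoc_rel {n m n' m' n'' m'' : ℕ} (D : Diagram n m) (E : Diagram n' m')
    (F : Diagram n'' m'') :
    (D.tensor (E.tensor F)).rel =
      ((D.tensor E).tensor F).rel.map (relabel (Nat.add_assoc _ _ _) (Nat.add_assoc _ _ _)) := by
  have h1 : inLeft (n' + n'') (m' + m'') = relabel (Nat.add_assoc n n' n'')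
      (Nat.add_assoc m m' m'') ∘ inLeft n'' m'' ∘ inLeft n' m' := by
    funext x
    rcases x with x | x <;> rfl
  have h2 : inRight n m ∘ inLeft n'' m'' = relabel (Nat.add_assoc n n' n'')
      (Nat.add_assoc m m' m'') ∘ inLeft n'' m'' ∘ inRight n m := by
    funext x
    rcases x with x | x <;> rfl
  have h3 : inRight n m ∘ inRight n' m' = relabel (Nat.add_assoc n n' n'')
      (Nat.add_assoc m m' m'') ∘ inRight (n + n') (m + m') := by
    funext x
    rcases x with x | x <;> simp [inRight, relabel, Fin.ext_iff, Nat.add_assoc]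
  simp only [Diagram.tensor, map_sup, map_map]
  rw [h1, h2, h3, sup_assoc]

theorem Diagram.id_zero_tensor_rel {n m : ℕ} (D : Diagram n m) :
    D.rel = ((Diagram.id 0).tensor D).rel.map (relabel (Nat.zero_add _) (Nat.zero_add _)) := by
  have h0 : (Diagram.id 0).rel = ⊥ := by
    ext x y
    exact isEmptyElim x
  simp only [Diagram.tensor, map_sup, map_map]
  rw [h0, map_bot, bot_sup_eq]
  conv_lhs => rw [← map_id' D.rel]
  congr 1
  funext x
  rcases x with x | x <;> simp [inRight, relabel]

theorem Diagram.tensor_id_zero_rel {n m : ℕ} (D : Diagram n m) :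
    D.rel = (D.tensor (Diagram.id 0)).rel.map (relabel (Nat.add_zero _) (Nat.add_zero _)) := by
  have h0 : (Diagram.id 0).rel = ⊥ := by
    ext x y
    exact isEmptyElim x
  simp only [Diagram.tensor, map_sup, map_map]
  rw [h0, map_bot, sup_bot_eq]
  conv_lhs => rw [← map_id' D.rel]
  congr 1
  funext x
  rcases x with x | x <;> rfl

end Diagrams

section Category

/-- The Temperley-Lieb category with loop parameter `d`; its objects are the natural numbers. -/
structure TLCat (d : ℂ) where
  /-- the number of points -/
  strands : ℕ

variable {d : ℂ}

/-- Bilinear extension of the concatenation of diagrams, each closed loop being replaced by `d`. -/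
noncomputable def compLin (d : ℂ) (n m p : ℕ) :
    (Diagram n m →₀ ℂ) →ₗ[ℂ] (Diagram m p →₀ ℂ) →ₗ[ℂ] (Diagram n p →₀ ℂ) :=
  Finsupp.linearCombination ℂ fun D : Diagram n m =>
    Finsupp.linearCombination ℂ fun E : Diagram m p => Finsupp.single (D.comp E) (d ^ D.loops E)

/-- Bilinear extension of the juxtaposition of diagrams. -/
noncomputable def tensorLin (n m n' m' : ℕ) :
    (Diagram n m →₀ ℂ) →ₗ[ℂ] (Diagram n' m' →₀ ℂ) →ₗ[ℂ] (Diagram (n + n') (m + m') →₀ ℂ) :=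
  Finsupp.linearCombination ℂ fun D : Diagram n m =>
    Finsupp.linearCombination ℂ fun E : Diagram n' m' => Finsupp.single (D.tensor E) 1

theorem compLin_single {n m p : ℕ} (D : Diagram n m) (E : Diagram m p) (a b : ℂ) :
    compLin d n m p (Finsupp.single D a) (Finsupp.single E b) =
      Finsupp.single (D.comp E) (a * b * d ^ D.loops E) := by
  simp only [compLin, Finsupp.linearCombination_single, LinearMap.smul_apply, Finsupp.smul_single,
    smul_eq_mul, mul_assoc]

theorem tensorLin_single {n m n' m' : ℕ} (D : Diagram n m) (E : Diagram n' m') (a b : ℂ) :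
    tensorLin n m n' m' (Finsupp.single D a) (Finsupp.single E b) =
      Finsupp.single (D.tensor E) (a * b) := by
  simp only [tensorLin, Finsupp.linearCombination_single, LinearMap.smul_apply,
    Finsupp.smul_single, smul_eq_mul, mul_one]

theorem compLin_assoc {n m p q : ℕ} (f : Diagram n m →₀ ℂ) (g : Diagram m p →₀ ℂ)
    (h : Diagram p q →₀ ℂ) :
    compLin d n p q (compLin d n m p f g) h = compLin d n m q f (compLin d m p q g h) := by
  induction f using Finsupp.induction_linear with
  | zero => simp
  | add f₁ f₂ h₁ h₂ => simp [h₁, h₂]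
  | single D a =>
    induction g using Finsupp.induction_linear with
    | zero => simp
    | add f₁ f₂ h₁ h₂ => simp [h₁, h₂]
    | single E b =>
      induction h using Finsupp.induction_linear with
      | zero => simp
      | add f₁ f₂ h₁ h₂ => simp [h₁, h₂]
      | single F c =>
        simp only [compLin_single, Diagram.assoc]
        congr 1
        have h1 : d ^ D.loops E * d ^ (D.comp E).loops F =
            d ^ E.loops F * d ^ D.loops (E.comp F) := by
          rw [← pow_add, ← pow_add, Diagram.loops_assoc]
        linear_combination a * b * c * h1

theorem tensorLin_comp {n m p n' m' p' : ℕ} (f : Diagram n m →₀ ℂ) (f' : Diagram n' m' →₀ ℂ)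
    (g : Diagram m p →₀ ℂ) (g' : Diagram m' p' →₀ ℂ) :
    compLin d _ _ _ (tensorLin n m n' m' f f') (tensorLin m p m' p' g g') =
      tensorLin n p n' p' (compLin d _ _ _ f g) (compLin d _ _ _ f' g') := by
  induction f using Finsupp.induction_linear with
  | zero => simp
  | add f₁ f₂ h₁ h₂ => simp [h₁, h₂]
  | single D a =>
    induction g using Finsupp.induction_linear with
    | zero => simp
    | add f₁ f₂ h₁ h₂ => simp [h₁, h₂]
    | single E b =>
      induction f' using Finsupp.induction_linear with
      | zero => simp
      | add f₁ f₂ h₁ h₂ => simp [h₁, h₂]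
      | single D' a' =>
        induction g' using Finsupp.induction_linear with
        | zero => simp
        | add f₁ f₂ h₁ h₂ => simp [h₁, h₂]
        | single E' b' =>
          simp only [compLin_single, tensorLin_single, Diagram.tensor_comp, Diagram.loops_tensor]
          congr 1
          ring

noncomputable instance : Category (TLCat d) where
  Hom X Y := Diagram X.strands Y.strands →₀ ℂ
  id X := Finsupp.single (Diagram.id X.strands) 1
  comp f g := compLin d _ _ _ f g
  id_comp f := by
    induction f using Finsupp.induction_linear with
    | zero => simp
    | add f₁ f₂ h₁ h₂ => rw [map_add, h₁, h₂]
    | single D a => rw [compLin_single, Diagram.id_comp, Diagram.loops_id_left]; simp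
  comp_id f := by
    induction f using Finsupp.induction_linear with
    | zero => simp
    | add f₁ f₂ h₁ h₂ => rw [map_add, LinearMap.add_apply, h₁, h₂]
    | single D a => rw [compLin_single, Diagram.comp_id, Diagram.loops_id_right]; simp
  assoc f g h := compLin_assoc f g h

noncomputable instance : Preadditive (TLCat d) where
  homGroup X Y := inferInstanceAs (AddCommGroup (Diagram X.strands Y.strands →₀ ℂ))
  add_comp _ _ _ f g h := LinearMap.map_add₂ (compLin d _ _ _) f g h
  comp_add _ _ _ f g h := LinearMap.map_add (compLin d _ _ _ f) g h

noncomputable instance : Linear ℂ (TLCat d) where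
  homModule X Y := inferInstanceAs (Module ℂ (Diagram X.strands Y.strands →₀ ℂ))
  smul_comp _ _ _ r f g :=
    LinearMap.map_smul₂ (compLin d _ _ _) r f g
  comp_smul _ _ _ f r g := LinearMap.map_smul (compLin d _ _ _ f) r g

/-- A diagram as a morphism of the Temperley-Lieb category. -/
noncomputable def TLCat.ofDiagram {X Y : TLCat d} (D : Diagram X.strands Y.strands) : X ⟶ Y :=
  Finsupp.single D (1 : ℂ)

theorem TLCat.hom_induction {X Y : TLCat d} {P : (X ⟶ Y) → Prop} (f : X ⟶ Y) (h0 : P 0)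
    (hadd : ∀ f g, P f → P g → P (f + g))
    (hsmul : ∀ (a : ℂ) (D : Diagram X.strands Y.strands), P (a • TLCat.ofDiagram D)) : P f := by
  refine Finsupp.induction_linear (motive := P) f h0 hadd fun D a => ?_
  have : (Finsupp.single D a : Diagram X.strands Y.strands →₀ ℂ) =
      a • (Finsupp.single D 1 : Diagram X.strands Y.strands →₀ ℂ) := by simp
  rw [this]
  exact hsmul a D

noncomputable instance : MonoidalCategoryStruct (TLCat d) where
  tensorObj X Y := ⟨X.strands + Y.strands⟩
  tensorUnit := ⟨0⟩
  tensorHom f g := tensorLin _ _ _ _ f g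
  whiskerLeft X _ _ f := tensorLin _ _ _ _ (𝟙 X) f
  whiskerRight f Y := tensorLin _ _ _ _ f (𝟙 Y)
  associator _ _ _ := eqToIso (congrArg TLCat.mk (Nat.add_assoc _ _ _))
  leftUnitor _ := eqToIso (congrArg TLCat.mk (Nat.zero_add _))
  rightUnitor _ := eqToIso (congrArg TLCat.mk (Nat.add_zero _))

theorem TLCat.ofDiagram_eqToHom {X Y X' Y' : TLCat d} (hX : X = X') (hY : Y = Y')
    (D : Diagram X.strands Y.strands) (D' : Diagram X'.strands Y'.strands)
    (h : D'.rel = D.rel.map (relabel (congrArg TLCat.strands hX) (congrArg TLCat.strands hY))) :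
    TLCat.ofDiagram D ≫ eqToHom hY = eqToHom hX ≫ TLCat.ofDiagram D' := by
  subst hX
  subst hY
  have hid : relabel (rfl : X.strands = X.strands) (rfl : Y.strands = Y.strands) = id := by
    funext x
    rcases x with x | x <;> rfl
  have : D' = D := by
    apply Diagram.ext
    rw [h]
    change D.rel.map (relabel rfl rfl) = D.rel
    rw [hid, map_id']
  simp [this]

theorem TLCat.tensor_ofDiagram {X Y X' Y' : TLCat d} (D : Diagram X.strands Y.strands)
    (E : Diagram X'.strands Y'.strands) :
    MonoidalCategoryStruct.tensorHom (TLCat.ofDiagram D) (TLCat.ofDiagram E) =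
      TLCat.ofDiagram (X := X ⊗ X') (Y := Y ⊗ Y') (D.tensor E) := by
  change tensorLin _ _ _ _ (Finsupp.single D 1) (Finsupp.single E 1) = Finsupp.single _ 1
  rw [tensorLin_single, one_mul]

theorem TLCat.id_eq (X : TLCat d) : 𝟙 X = TLCat.ofDiagram (Diagram.id X.strands) := rfl

theorem TLCat.tensorHom_id_id (X Y : TLCat d) :
    MonoidalCategoryStruct.tensorHom (𝟙 X) (𝟙 Y) = 𝟙 (X ⊗ Y) := by
  rw [TLCat.id_eq, TLCat.id_eq, TLCat.tensor_ofDiagram, TLCat.id_eq, Diagram.tensor_id]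
  rfl

theorem TLCat.add_tensorHom {X Y X' Y' : TLCat d} (f g : X ⟶ Y) (h : X' ⟶ Y') :
    MonoidalCategoryStruct.tensorHom (f + g) h =
      MonoidalCategoryStruct.tensorHom f h + MonoidalCategoryStruct.tensorHom g h :=
  LinearMap.map_add₂ (tensorLin _ _ _ _) f g h

theorem TLCat.tensorHom_add {X Y X' Y' : TLCat d} (h : X ⟶ Y) (f g : X' ⟶ Y') :
    MonoidalCategoryStruct.tensorHom h (f + g) =
      MonoidalCategoryStruct.tensorHom h f + MonoidalCategoryStruct.tensorHom h g :=
  map_add (tensorLin _ _ _ _ h) f g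

theorem TLCat.smul_tensorHom {X Y X' Y' : TLCat d} (a : ℂ) (f : X ⟶ Y) (h : X' ⟶ Y') :
    MonoidalCategoryStruct.tensorHom (a • f) h = a • MonoidalCategoryStruct.tensorHom f h :=
  LinearMap.map_smul₂ (tensorLin _ _ _ _) a f h

theorem TLCat.tensorHom_smul {X Y X' Y' : TLCat d} (a : ℂ) (h : X ⟶ Y) (f : X' ⟶ Y') :
    MonoidalCategoryStruct.tensorHom h (a • f) = a • MonoidalCategoryStruct.tensorHom h f :=
  map_smul (tensorLin _ _ _ _ h) a f

theorem TLCat.zero_tensorHom {X Y X' Y' : TLCat d} (h : X' ⟶ Y') :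
    MonoidalCategoryStruct.tensorHom (0 : X ⟶ Y) h = 0 :=
  LinearMap.map_zero₂ (tensorLin _ _ _ _) h

theorem TLCat.tensorHom_zero {X Y X' Y' : TLCat d} (h : X ⟶ Y) :
    MonoidalCategoryStruct.tensorHom h (0 : X' ⟶ Y') = 0 :=
  map_zero (tensorLin _ _ _ _ h)

theorem TLCat.id_tensor_eqToHom {X Y : TLCat d} (h : X = Y) (Z : TLCat d) :
    MonoidalCategoryStruct.tensorHom (𝟙 Z) (eqToHom h) =
      eqToHom (congrArg (fun W => Z ⊗ W) h) := by
  subst h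
  exact TLCat.tensorHom_id_id _ _

theorem TLCat.eqToHom_tensor_id {X Y : TLCat d} (h : X = Y) (Z : TLCat d) :
    MonoidalCategoryStruct.tensorHom (eqToHom h) (𝟙 Z) =
      eqToHom (congrArg (fun W => W ⊗ Z) h) := by
  subst h
  exact TLCat.tensorHom_id_id _ _

theorem TLCat.associator_hom_eq (X Y Z : TLCat d) :
    (MonoidalCategoryStruct.associator X Y Z).hom =
      eqToHom (congrArg TLCat.mk (Nat.add_assoc _ _ _)) := rfl

theorem TLCat.leftUnitor_hom_eq (X : TLCat d) :
    (MonoidalCategoryStruct.leftUnitor X).hom =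
      eqToHom (congrArg TLCat.mk (Nat.zero_add _)) := rfl

theorem TLCat.rightUnitor_hom_eq (X : TLCat d) :
    (MonoidalCategoryStruct.rightUnitor X).hom =
      eqToHom (congrArg TLCat.mk (Nat.add_zero _)) := rfl

noncomputable instance : MonoidalCategory (TLCat d) :=
  MonoidalCategory.ofTensorHom
    (id_tensorHom_id := TLCat.tensorHom_id_id)
    (id_tensorHom := fun _ _ _ _ => rfl)
    (tensorHom_id := fun _ _ => rfl)
    (tensorHom_comp_tensorHom := fun f₁ f₂ g₁ g₂ => tensorLin_comp f₁ f₂ g₁ g₂)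
    (associator_naturality := by
      intro X₁ X₂ X₃ Y₁ Y₂ Y₃ f₁ f₂ f₃
      induction f₁ using TLCat.hom_induction with
      | h0 => simp [TLCat.zero_tensorHom]
      | hadd f g h₁ h₂ => simp [TLCat.add_tensorHom, h₁, h₂]
      | hsmul a D =>
        induction f₂ using TLCat.hom_induction with
        | h0 => simp [TLCat.zero_tensorHom, TLCat.tensorHom_zero]
        | hadd f g h₁ h₂ => simp [TLCat.add_tensorHom, TLCat.tensorHom_add, h₁, h₂]
        | hsmul b E =>
          induction f₃ using TLCat.hom_induction with
          | h0 => simp [TLCat.tensorHom_zero]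
          | hadd f g h₁ h₂ => simp [TLCat.tensorHom_add, h₁, h₂]
          | hsmul c F =>
            simp only [TLCat.smul_tensorHom, TLCat.tensorHom_smul, Linear.smul_comp,
              Linear.comp_smul, TLCat.tensor_ofDiagram]
            congr 3
            exact TLCat.ofDiagram_eqToHom (congrArg TLCat.mk (Nat.add_assoc _ _ _))
              (congrArg TLCat.mk (Nat.add_assoc _ _ _)) _ _ (Diagram.tensor_assoc_rel D E F))
    (leftUnitor_naturality := by
      intro X Y f
      induction f using TLCat.hom_induction with
      | h0 => simp [TLCat.tensorHom_zero]
      | hadd f g h₁ h₂ => simp [TLCat.tensorHom_add, h₁, h₂]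
      | hsmul a D =>
        simp only [TLCat.tensorHom_smul, Linear.smul_comp, Linear.comp_smul, TLCat.id_eq,
          TLCat.tensor_ofDiagram]
        congr 1
        exact TLCat.ofDiagram_eqToHom (congrArg TLCat.mk (Nat.zero_add _))
          (congrArg TLCat.mk (Nat.zero_add _)) _ _ (Diagram.id_zero_tensor_rel D))
    (rightUnitor_naturality := by
      intro X Y f
      induction f using TLCat.hom_induction with
      | h0 => simp [TLCat.zero_tensorHom]
      | hadd f g h₁ h₂ => simp [TLCat.add_tensorHom, h₁, h₂]
      | hsmul a D =>
        simp only [TLCat.smul_tensorHom, Linear.smul_comp, Linear.comp_smul, TLCat.id_eq,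
          TLCat.tensor_ofDiagram]
        congr 1
        exact TLCat.ofDiagram_eqToHom (congrArg TLCat.mk (Nat.add_zero _))
          (congrArg TLCat.mk (Nat.add_zero _)) _ _ (Diagram.tensor_id_zero_rel D))
    (pentagon := by
      intro W X Y Z
      simp only [TLCat.associator_hom_eq]
      rw [TLCat.eqToHom_tensor_id, TLCat.id_tensor_eqToHom]
      simp only [eqToHom_trans])
    (triangle := by
      intro X Y
      simp only [TLCat.associator_hom_eq, TLCat.leftUnitor_hom_eq, TLCat.rightUnitor_hom_eq]
      rw [TLCat.eqToHom_tensor_id, TLCat.id_tensor_eqToHom]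
      simp only [eqToHom_trans])

instance : MonoidalPreadditive (TLCat d) where
  whiskerLeft_zero {X _ _} := TLCat.tensorHom_zero (𝟙 X)
  zero_whiskerRight {X _ _} := TLCat.zero_tensorHom (𝟙 X)
  whiskerLeft_add {X _ _} f g := TLCat.tensorHom_add (𝟙 X) f g
  add_whiskerRight {X _ _} f g := TLCat.add_tensorHom f g (𝟙 X)

instance : MonoidalLinear ℂ (TLCat d) where
  whiskerLeft_smul X _ _ r f := TLCat.tensorHom_smul r (𝟙 X) f
  smul_whiskerRight r _ _ f X := TLCat.smul_tensorHom r f (𝟙 X)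

/-- The generating object `X = 1`. -/
def TLCat.X (d : ℂ) : TLCat d := ⟨1⟩

/-- The pairing `ε : X ⊗ X ⟶ I` given by the arc. -/
noncomputable def TLCat.ε (d : ℂ) : TLCat.X d ⊗ TLCat.X d ⟶ 𝟙_ (TLCat d) :=
  TLCat.ofDiagram (X := ⟨1 + 1⟩) (Y := ⟨0⟩) Diagram.cap

/-- The copairing `δ : I ⟶ X ⊗ X` given by the arc. -/
noncomputable def TLCat.δ (d : ℂ) : 𝟙_ (TLCat d) ⟶ TLCat.X d ⊗ TLCat.X d :=
  TLCat.ofDiagram (X := ⟨0⟩) (Y := ⟨1 + 1⟩) Diagram.cup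

end Category

end TemperleyLieb

section TensorCategories

universe u v u' v'

/-- Strictness of a monoidal category: the tensor product of objects is strictly associative and
unital, and the associativity and unit constraints are identities. -/
class IsStrictMonoidal (C : Type u) [Category.{v} C] [MonoidalCategory C] : Prop where
  tensor_assoc : ∀ X Y Z : C, (X ⊗ Y) ⊗ Z = X ⊗ (Y ⊗ Z)
  unit_tensor : ∀ X : C, 𝟙_ C ⊗ X = X
  tensor_unit : ∀ X : C, X ⊗ 𝟙_ C = X
  associator_hom : ∀ X Y Z : C, (α_ X Y Z).hom = eqToHom (tensor_assoc X Y Z)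
  leftUnitor_hom : ∀ X : C, (λ_ X).hom = eqToHom (unit_tensor X)
  rightUnitor_hom : ∀ X : C, (ρ_ X).hom = eqToHom (tensor_unit X)

/-- A tensor category: a strict finite-dimensional `ℂ`-linear monoidal category (with bilinear
tensor product of morphisms) such that the endomorphisms of the unit object are scalars. -/
class TensorCategory (C : Type u) [Category.{v} C] [Preadditive C] [Linear ℂ C]
    [MonoidalCategory C] : Prop extends MonoidalPreadditive C, MonoidalLinear ℂ C,
    IsStrictMonoidal C where
  finiteDimensional_hom : ∀ X Y : C, FiniteDimensional ℂ (X ⟶ Y)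
  end_unit : ∀ f : 𝟙_ C ⟶ 𝟙_ C, ∃ c : ℂ, f = c • 𝟙 (𝟙_ C)

/-- A (strictly) monoidal functor: `F(I) = I`, `F(X ⊗ Y) = F(X) ⊗ F(Y)` and
`F(f ⊗ g) = F(f) ⊗ F(g)`. -/
structure IsMonoidalFunctor {C : Type u} [Category.{v} C] [MonoidalCategory C] {D : Type u'}
    [Category.{v'} D] [MonoidalCategory D] (F : C ⥤ D) : Prop where
  obj_unit : F.obj (𝟙_ C) = 𝟙_ D
  obj_tensor : ∀ X Y : C, F.obj (X ⊗ Y) = F.obj X ⊗ F.obj Y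
  map_tensor : ∀ {X X' Y Y' : C} (f : X ⟶ X') (g : Y ⟶ Y'),
    F.map (f ⊗ₘ g) = eqToHom (obj_tensor X Y) ≫ (F.map f ⊗ₘ F.map g) ≫
      eqToHom (obj_tensor X' Y').symm

instance (d : ℂ) : TensorCategory (TemperleyLieb.TLCat d) where
  tensor_assoc _ _ _ := congrArg TemperleyLieb.TLCat.mk (Nat.add_assoc _ _ _)
  unit_tensor _ := congrArg TemperleyLieb.TLCat.mk (Nat.zero_add _)
  tensor_unit _ := congrArg TemperleyLieb.TLCat.mk (Nat.add_zero _)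
  associator_hom _ _ _ := rfl
  leftUnitor_hom _ := rfl
  rightUnitor_hom _ := rfl
  finiteDimensional_hom X Y := inferInstanceAs
    (FiniteDimensional ℂ (TemperleyLieb.Diagram X.strands Y.strands →₀ ℂ))
  end_unit f := by
    induction f using TemperleyLieb.TLCat.hom_induction with
    | h0 => exact ⟨0, by simp⟩
    | hadd f g h₁ h₂ =>
      obtain ⟨a, rfl⟩ := h₁
      obtain ⟨b, rfl⟩ := h₂
      exact ⟨a + b, by rw [add_smul]⟩
    | hsmul a D =>
      refine ⟨a, ?_⟩
      rw [TemperleyLieb.TLCat.id_eq]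
      congr 2
      exact Subsingleton.elim (α := TemperleyLieb.Diagram 0 0) _ _

end TensorCategories

/-! The functor has to send the object n to the n-th tensor power of Y, and a diagram to the
morphism that ε_Y and δ_Y build along its arcs. The problem is well-definedness, and a normal form
solves it. A diagram that is not an identity contains an arc joining two neighbours on one edge: an
innermost arc is of this kind (`Diagram.exists_upper_arc`, `Diagram.exists_lower_arc`), and if no
arc joins two points of one edge, then all lines are vertical. So the diagram is a smaller one with
a cup put on top or a cap put at the bottom (`Diagram.decompose`). Iterating writes it as a word
with caps below and cups above, in which no loop ever closes. `Realizes Y D f` says that f is the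
value in T of such a word for D.

The value depends only on D (`Realizes.unique`), by induction on n + m, comparing the outer
generators of two words. Two cups sharing one foot cannot both lie on top of the same diagram: the
cap that closes one of them into a loop only straightens a zigzag with the other. Two cups with
disjoint feet, or a cup on top and a cap at the bottom, can both be peeled off, leaving a common
smaller diagram; the generators then commute in T by naturality, or by associativity alone.

Values compose up to the factor d to the number of loops (`Realizes.comp`). The only configuration
to be reduced is a cap on top of a cup: at the same place it gives d, just as one loop is removed;
at neighbouring places it gives an identity, by the duality equations; at distant places the two
slide past each other. For tensor products, adding vertical lines to a word only shifts the places
of its generators, and f ⊗ g is f ⊗ 1 followed by 1 ⊗ g (`Realizes.tensor`).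

The underlying identities between diagrams rest on `IsMatching.eq_of_le`: a matching contained in a
relation whose classes have at most two points is equal to it. Most of them then reduce to a
labelling of the points that is constant along the curves, checked by linear arithmetic. -/

namespace TemperleyLieb

/-! ### Creation and contraction of adjacent pairs in a monoidal category. -/

section Generators

universe v u

variable {C : Type u} [Category.{v} C] [MonoidalCategory C]

/-- The `n`-th tensor power of `Y`. -/
def tensorPow (Y : C) : ℕ → C
  | 0 => 𝟙_ C
  | n + 1 => tensorPow Y n ⊗ Y

variable (Y : C)

/-- The canonical isomorphism between `Y ^ n ⊗ Y ^ k` and `Y ^ (n + k)`. -/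
def tensorPowAdd (n : ℕ) : (k : ℕ) → (tensorPow Y n ⊗ tensorPow Y k ≅ tensorPow Y (n + k))
  | 0 => ρ_ _
  | k + 1 => (α_ _ _ _).symm ≪≫ whiskerRightIso (tensorPowAdd n k) Y

/-- The map `f ⊗ 𝟙` between the next tensor powers. -/
def powWhisker {N M : ℕ} (f : tensorPow Y N ⟶ tensorPow Y M) :
    tensorPow Y (N + 1) ⟶ tensorPow Y (M + 1) := f ▷ Y

theorem powWhisker_comp {N M P : ℕ} (f : tensorPow Y N ⟶ tensorPow Y M)
    (g : tensorPow Y M ⟶ tensorPow Y P) :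
    powWhisker Y (f ≫ g) = powWhisker Y f ≫ powWhisker Y g := comp_whiskerRight _ _ _

theorem powWhisker_id (N : ℕ) : powWhisker Y (𝟙 (tensorPow Y N)) = 𝟙 _ := id_whiskerRight _ _

theorem powWhisker_smul [Preadditive C] [Linear ℂ C] [MonoidalPreadditive C]
    [MonoidalLinear ℂ C] {N M : ℕ} (a : ℂ) (f : tensorPow Y N ⟶ tensorPow Y M) : powWhisker Y (a • f) = a • powWhisker Y f :=
  MonoidalLinear.smul_whiskerRight _ _ _

variable [ExactPairing Y Y]

/-- Insertion of a pair of factors `Y` on the right. -/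
def createPair (A : C) : A ⟶ (A ⊗ Y) ⊗ Y :=
  (ρ_ A).inv ≫ A ◁ η_ Y Y ≫ (α_ A Y Y).inv

/-- Contraction of the last two factors `Y`. -/
def contractPair (A : C) : (A ⊗ Y) ⊗ Y ⟶ A :=
  (α_ A Y Y).hom ≫ A ◁ ε_ Y Y ≫ (ρ_ A).hom

/-- The interchange law: `f` acts on factors disjoint from the new pair. Together with its
counterpart for contractions, this is the source of all relations between generators at distant
places. -/
theorem createPair_naturality {A B : C} (f : A ⟶ B) :
    f ≫ createPair Y B = createPair Y A ≫ f ▷ Y ▷ Y := by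
  simp only [createPair, Category.assoc]
  rw [rightUnitor_inv_naturality_assoc, ← whisker_exchange_assoc]
  simp

theorem contractPair_naturality {A B : C} (f : A ⟶ B) :
    contractPair Y A ≫ f = f ▷ Y ▷ Y ≫ contractPair Y B := by
  simp only [contractPair, Category.assoc]
  rw [← rightUnitor_naturality, whisker_exchange_assoc]
  simp

theorem createPair_contractPair [Preadditive C] [Linear ℂ C] [MonoidalPreadditive C]
    [MonoidalLinear ℂ C] {d : ℂ} (hY : η_ Y Y ≫ ε_ Y Y = d • 𝟙 (𝟙_ C)) (A : C) :
    createPair Y A ≫ contractPair Y A = d • 𝟙 A := by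
  simp only [createPair, contractPair, Category.assoc, Iso.inv_hom_id_assoc]
  rw [← whiskerLeft_comp_assoc, hY]
  simp

/-- The left member of the new pair is contracted with the factor `Y` before it, a zigzag
straightened by one of the two duality equations. `createPair_whisker_contractPair` rests on the
other one. -/
theorem createPair_contractPair_whisker (A : C) :
    createPair Y (A ⊗ Y) ≫ contractPair Y A ▷ Y = 𝟙 _ := by
  calc _ = 𝟙 _ ⊗≫ A ◁ (Y ◁ η_ Y Y ⊗≫ ε_ Y Y ▷ Y) ⊗≫ 𝟙 _ := by
        simp only [createPair, contractPair]; monoidal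
    _ = _ := by rw [ExactPairing.coevaluation_evaluation'' Y Y]; monoidal

theorem createPair_whisker_contractPair (A : C) :
    createPair Y A ▷ Y ≫ contractPair Y (A ⊗ Y) = 𝟙 _ := by
  calc _ = 𝟙 _ ⊗≫ A ◁ (η_ Y Y ▷ Y ⊗≫ Y ◁ ε_ Y Y) ⊗≫ 𝟙 _ := by
        simp only [createPair, contractPair]; monoidal
    _ = _ := by rw [ExactPairing.evaluation_coevaluation'' Y Y]; monoidal

variable [Preadditive C]

/-- The morphism creating a pair of adjacent factors with `r` factors to their right. -/
def cupHom : (N r : ℕ) → (tensorPow Y N ⟶ tensorPow Y (N + 2))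
  | N, 0 => createPair Y (tensorPow Y N)
  -- The counter `r` runs from the right because `tensorPow` grows there, so that a recursive step
  -- is whiskering by `Y`. This branch is reached exactly when `r > N` and holds a junk value.
  | 0, _ + 1 => 0
  | N + 1, r + 1 => powWhisker Y (cupHom N r)

/-- The morphism contracting a pair of adjacent factors with `r` factors to their right. -/
def capHom : (N r : ℕ) → (tensorPow Y (N + 2) ⟶ tensorPow Y N)
  | N, 0 => contractPair Y (tensorPow Y N)
  | 0, _ + 1 => 0
  | N + 1, r + 1 => powWhisker Y (capHom N r)

theorem cupHom_zero (N : ℕ) : cupHom Y N 0 = createPair Y (tensorPow Y N) := by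
  cases N <;> rfl

theorem capHom_zero (N : ℕ) : capHom Y N 0 = contractPair Y (tensorPow Y N) := by
  cases N <;> rfl

theorem cupHom_succ (N r : ℕ) : cupHom Y (N + 1) (r + 1) = powWhisker Y (cupHom Y N r) := rfl

theorem capHom_succ (N r : ℕ) : capHom Y (N + 1) (r + 1) = powWhisker Y (capHom Y N r) := rfl

/-- Whiskering lowers both counters together, which leaves `r = 0`, where this is naturality of
`createPair` in the other morphism. The counter becomes `s + 2` because the pair created first lies
to the right of the second place. The next three relations have the same proof. -/
theorem cupHom_cupHom {N r s : ℕ} (h : r ≤ s) (h' : s ≤ N) :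
    cupHom Y N r ≫ cupHom Y (N + 2) (s + 2) = cupHom Y N s ≫ cupHom Y (N + 2) r := by
  induction r generalizing N s with
  | zero =>
    rw [cupHom_zero, cupHom_zero]
    exact (createPair_naturality Y _).symm
  | succ r ih =>
    obtain ⟨s, rfl⟩ := Nat.exists_eq_succ_of_ne_zero (show s ≠ 0 by omega)
    obtain ⟨N, rfl⟩ := Nat.exists_eq_succ_of_ne_zero (show N ≠ 0 by omega)
    have := congrArg (powWhisker Y)
      (ih (Nat.le_of_succ_le_succ h) (Nat.le_of_succ_le_succ h'))
    rwa [powWhisker_comp, powWhisker_comp] at this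

theorem capHom_capHom {N r s : ℕ} (h : r ≤ s) (h' : s ≤ N) :
    capHom Y (N + 2) (s + 2) ≫ capHom Y N r = capHom Y (N + 2) r ≫ capHom Y N s := by
  induction r generalizing N s with
  | zero =>
    rw [capHom_zero, capHom_zero]
    exact (contractPair_naturality Y _).symm
  | succ r ih =>
    obtain ⟨s, rfl⟩ := Nat.exists_eq_succ_of_ne_zero (show s ≠ 0 by omega)
    obtain ⟨N, rfl⟩ := Nat.exists_eq_succ_of_ne_zero (show N ≠ 0 by omega)
    have := congrArg (powWhisker Y)
      (ih (Nat.le_of_succ_le_succ h) (Nat.le_of_succ_le_succ h'))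
    rwa [powWhisker_comp, powWhisker_comp] at this

theorem cupHom_capHom_of_le {N r s : ℕ} (h : r ≤ s) (h' : s ≤ N) :
    cupHom Y (N + 2) r ≫ capHom Y (N + 2) (s + 2) = capHom Y N s ≫ cupHom Y N r := by
  induction r generalizing N s with
  | zero =>
    rw [cupHom_zero, cupHom_zero]
    exact (createPair_naturality Y _).symm
  | succ r ih =>
    obtain ⟨s, rfl⟩ := Nat.exists_eq_succ_of_ne_zero (show s ≠ 0 by omega)
    obtain ⟨N, rfl⟩ := Nat.exists_eq_succ_of_ne_zero (show N ≠ 0 by omega)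
    have := congrArg (powWhisker Y)
      (ih (Nat.le_of_succ_le_succ h) (Nat.le_of_succ_le_succ h'))
    rwa [powWhisker_comp, powWhisker_comp] at this

theorem cupHom_capHom_of_ge {N r s : ℕ} (h : r ≤ s) (h' : s ≤ N) :
    cupHom Y (N + 2) (s + 2) ≫ capHom Y (N + 2) r = capHom Y N r ≫ cupHom Y N s := by
  induction r generalizing N s with
  | zero =>
    rw [capHom_zero, capHom_zero]
    exact (contractPair_naturality Y _).symm
  | succ r ih =>
    obtain ⟨s, rfl⟩ := Nat.exists_eq_succ_of_ne_zero (show s ≠ 0 by omega)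
    obtain ⟨N, rfl⟩ := Nat.exists_eq_succ_of_ne_zero (show N ≠ 0 by omega)
    have := congrArg (powWhisker Y)
      (ih (Nat.le_of_succ_le_succ h) (Nat.le_of_succ_le_succ h'))
    rwa [powWhisker_comp, powWhisker_comp] at this

theorem cupHom_capHom_self [Linear ℂ C] [MonoidalPreadditive C] [MonoidalLinear ℂ C] {d : ℂ}
    (hY : η_ Y Y ≫ ε_ Y Y = d • 𝟙 (𝟙_ C)) {N r : ℕ} (h : r ≤ N) :
    cupHom Y N r ≫ capHom Y N r = d • 𝟙 _ := by
  induction r generalizing N with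
  | zero =>
    rw [cupHom_zero, capHom_zero]
    exact createPair_contractPair Y hY _
  | succ r ih =>
    obtain ⟨N, rfl⟩ := Nat.exists_eq_succ_of_ne_zero (show N ≠ 0 by omega)
    have := congrArg (powWhisker Y) (ih (Nat.le_of_succ_le_succ h))
    rwa [powWhisker_comp, powWhisker_smul, powWhisker_id] at this

theorem cupHom_capHom_succ {N r : ℕ} (h : r ≤ N) :
    cupHom Y (N + 1) r ≫ capHom Y (N + 1) (r + 1) = 𝟙 _ := by
  induction r generalizing N with
  | zero =>
    rw [cupHom_zero, capHom_succ, capHom_zero]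
    exact createPair_contractPair_whisker Y _
  | succ r ih =>
    obtain ⟨N, rfl⟩ := Nat.exists_eq_succ_of_ne_zero (show N ≠ 0 by omega)
    have := congrArg (powWhisker Y) (ih (Nat.le_of_succ_le_succ h))
    rwa [powWhisker_comp, powWhisker_id] at this

theorem cupHom_succ_capHom {N r : ℕ} (h : r ≤ N) :
    cupHom Y (N + 1) (r + 1) ≫ capHom Y (N + 1) r = 𝟙 _ := by
  induction r generalizing N with
  | zero =>
    rw [capHom_zero, cupHom_succ, cupHom_zero]
    exact createPair_whisker_contractPair Y _
  | succ r ih =>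
    obtain ⟨N, rfl⟩ := Nat.exists_eq_succ_of_ne_zero (show N ≠ 0 by omega)
    have := congrArg (powWhisker Y) (ih (Nat.le_of_succ_le_succ h))
    rwa [powWhisker_comp, powWhisker_id] at this

end Generators


/-! ### Equality of matchings, and labels of glued pictures. -/

section Matchings

variable {α β γ : Type*}

/-- Every class of `R` has at most two elements. -/
def AtMostTwo (R : Setoid α) : Prop := ∀ x y z, R x y → R x z → y ≠ x → z ≠ x → y = z

theorem IsMatching.atMostTwo {R : Setoid α} (h : IsMatching R) : AtMostTwo R :=
  fun x _ _ hy hz hyx hzx => (h x).unique ⟨hyx, hy⟩ ⟨hzx, hz⟩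

theorem AtMostTwo.isMatching {R : Setoid α} (h : AtMostTwo R) (h' : ∀ x, ∃ y, y ≠ x ∧ R x y) :
    IsMatching R := by
  intro x
  obtain ⟨y, hy, hxy⟩ := h' x
  exact ⟨y, ⟨hy, hxy⟩, fun z hz => h x z y hz.2 hxy hz.1 hy⟩

theorem IsMatching.comap_equiv {R : Setoid α} (h : IsMatching R) (e : β ≃ α) :
    IsMatching (R.comap e) := by
  intro x
  obtain ⟨y, ⟨hy, hxy⟩, hu⟩ := h (e x)
  refine ⟨e.symm y, ⟨fun h => hy (by rw [← h, e.apply_symm_apply]), ?_⟩, ?_⟩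
  · rw [Setoid.comap_rel, e.apply_symm_apply]
    exact hxy
  · rintro z ⟨hz, hxz⟩
    rw [← hu (e z) ⟨fun h => hz (e.injective h), hxz⟩, e.symm_apply_apply]

/-- A class of `S` has room for one further point, and the partner under `R` already takes it.
Identities between diagrams therefore need only one inclusion. -/
theorem IsMatching.eq_of_le {R S : Setoid α} (hR : IsMatching R) (hS : AtMostTwo S) (h : R ≤ S) :
    R = S := by
  refine le_antisymm h fun x y hxy => ?_
  by_cases e : y = x
  · exact e ▸ R.refl _
  · obtain ⟨z, ⟨hz, hxz⟩, -⟩ := hR x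
    exact hS x y z hxy (h hxz) e hz ▸ hxz

theorem glue_le_ker {R : Setoid (α ⊕ β)} {S : Setoid (β ⊕ γ)} {X : Type*} (g : α ⊕ β ⊕ γ → X)
    (hR : ∀ x y, R x y → g (Sum.map id Sum.inl x) = g (Sum.map id Sum.inl y))
    (hS : ∀ x y, S x y → g (Sum.inr x) = g (Sum.inr y)) : glue R S ≤ Setoid.ker g :=
  sup_le (map_le_iff.2 hR) (map_le_iff.2 hS)

/-- Labels of the three rows that are constant along the curves of both pictures are constant along
the glued curves. If no outer label occurs more than twice, `IsMatching.eq_of_le` turns this into a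
computation of the composite. -/
theorem glueOuter_le_ker {R : Setoid (α ⊕ β)} {S : Setoid (β ⊕ γ)} {X : Type*}
    {l : α → X} {c : β → X} {u : γ → X}
    (hR : R ≤ Setoid.ker (Sum.elim l c)) (hS : S ≤ Setoid.ker (Sum.elim c u)) :
    glueOuter R S ≤ Setoid.ker (Sum.elim l u) := by
  have h : glue R S ≤ Setoid.ker (Sum.elim l (Sum.elim c u)) := by
    refine glue_le_ker _ (fun x y hxy => ?_) (fun x y hxy => hS hxy)
    have := hR hxy
    rcases x with x | x <;> rcases y with y | y <;> exact this
  intro x y hxy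
  have := h hxy
  rcases x with x | x <;> rcases y with y | y <;> exact this

theorem glueLoops_eq_zero {R : Setoid (α ⊕ β)} {S : Setoid (β ⊕ γ)}
    (h : ∀ b, (∃ x, glue R S (Sum.map id Sum.inr x) (Sum.inr (Sum.inl b)))) :
    glueLoops R S = 0 := by
  refine countMissing_eq_zero _ _ ?_
  rintro (x | x | x)
  · exact ⟨Sum.inl x, Setoid.refl' _ _⟩
  · exact h x
  · exact ⟨Sum.inr x, Setoid.refl' _ _⟩

end Matchings

/-! ### Diagrams with a single cup or cap. -/

section Generators

/-- The strand met by the lower points of a diagram with a cup on top. -/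
def cupLower (N r : ℕ) (k : Fin N) : ℕ := if (k : ℕ) + r < N then k else k + 2

/-- The strand met by the upper points of a diagram with a cup on top. -/
def cupUpper (N r : ℕ) {M : ℕ} (k : Fin M) : ℕ := if (k : ℕ) + r = N + 1 then k - 1 else k

/-- Strands are numbered by their upper ends, and the feet `N - r` and `N - r + 1` of the cup share
the number of the left foot. -/
theorem cup_atMostTwo (N M r : ℕ) :
    AtMostTwo (Setoid.ker (Sum.elim (cupLower N r) (cupUpper N r (M := M)))) := by
  rintro (x | x) (y | y) (z | z) h1 h2 h3 h4 <;>
    simp only [Setoid.ker_def, Sum.elim_inl, Sum.elim_inr, cupLower, cupUpper, ne_eq,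
      Sum.inl.injEq, Sum.inr.injEq, Fin.ext_iff, reduceCtorEq] at h1 h2 h3 h4 ⊢ <;>
    split_ifs at h1 h2 <;> omega

theorem isMatching_cup (N M r : ℕ) (hM : M = N + 2) (hr : r ≤ N) :
    IsMatching (Setoid.ker (Sum.elim (cupLower N r) (cupUpper N r (M := M)))) := by
  subst hM
  refine (cup_atMostTwo N (N + 2) r).isMatching ?_
  rintro (x | x)
  · refine ⟨Sum.inr ⟨cupLower N r x, ?_⟩, by simp, ?_⟩
    · unfold cupLower; split_ifs <;> omega
    · simp only [Setoid.ker_def, Sum.elim_inl, Sum.elim_inr, cupLower, cupUpper]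
      split_ifs <;> omega
  -- Four positions: left of the cup, its left foot `x + r = N`, its right foot `x + r = N + 1`,
  -- right of the cup.
  · rcases lt_trichotomy ((x : ℕ) + r) N with h | h | h
    · refine ⟨Sum.inl ⟨x, by omega⟩, by simp, ?_⟩
      simp only [Setoid.ker_def, Sum.elim_inl, Sum.elim_inr, cupLower, cupUpper]
      split_ifs <;> omega
    · refine ⟨Sum.inr ⟨x + 1, by omega⟩, by simp [Fin.ext_iff], ?_⟩
      simp only [Setoid.ker_def, Sum.elim_inr, cupUpper]
      split_ifs <;> omega
    · by_cases h' : (x : ℕ) + r = N + 1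
      · refine ⟨Sum.inr ⟨x - 1, by omega⟩, by simp [Fin.ext_iff]; omega, ?_⟩
        simp only [Setoid.ker_def, Sum.elim_inr, cupUpper]
        split_ifs <;> omega
      · refine ⟨Sum.inl ⟨x - 2, by omega⟩, by simp, ?_⟩
        simp only [Setoid.ker_def, Sum.elim_inl, Sum.elim_inr, cupLower, cupUpper]
        split_ifs <;> omega

theorem isMatching_cap (N M r : ℕ) (hM : M = N + 2) (hr : r ≤ N) :
    IsMatching (Setoid.ker (Sum.elim (cupUpper N r (M := M)) (cupLower N r))) := by
  have h := (isMatching_cup N M r hM hr).comap_equiv (Equiv.sumComm (Fin M) (Fin N))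
  convert h using 1
  ext x y
  rcases x with x | x <;> rcases y with y | y <;> rfl

/-- The diagram with a single cup, which has `r` vertical lines to its right. -/
def cupDiagram (N M r : ℕ) (hM : M = N + 2) (hr : r ≤ N) : Diagram N M where
  rel := Setoid.ker (Sum.elim (cupLower N r) (cupUpper N r))
  matching := isMatching_cup N M r hM hr
  nonCrossing := by
    subst hM
    rintro (a | a) (b | b) (c | c) (e | e) h1 h2 ⟨h3, h4, h5⟩ <;>
      simp only [Setoid.ker_def, Sum.elim_inl, Sum.elim_inr, cupLower, cupUpper, pos] at * <;>
      split_ifs at * <;> omega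

/-- The diagram with a single cap, which has `r` vertical lines to its right. -/
def capDiagram (M N r : ℕ) (hM : M = N + 2) (hr : r ≤ N) : Diagram M N where
  rel := Setoid.ker (Sum.elim (cupUpper N r) (cupLower N r))
  matching := isMatching_cap N M r hM hr
  nonCrossing := by
    subst hM
    rintro (a | a) (b | b) (c | c) (e | e) h1 h2 ⟨h3, h4, h5⟩ <;>
      simp only [Setoid.ker_def, Sum.elim_inl, Sum.elim_inr, cupLower, cupUpper, pos] at * <;>
      split_ifs at * <;> omega

/-- The relation on the end points of a rectangle given by labels of the lower and upper points. -/
def labelRel (n m : ℕ) (l u : ℕ → ℕ) : Setoid (Fin n ⊕ Fin m) :=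
  Setoid.ker (Sum.elim (fun k : Fin n => l k) (fun k : Fin m => u k))

theorem labelRel_iff {n m : ℕ} {l u : ℕ → ℕ} {x y : Fin n ⊕ Fin m} : labelRel n m l u x y ↔
    Sum.elim (fun k : Fin n => l k) (fun k : Fin m => u k) x =
      Sum.elim (fun k : Fin n => l k) (fun k : Fin m => u k) y := Iff.rfl

/-- The hypotheses are agreement along the vertical lines and at the two feet. They say that both
labellings are `u` applied to the strand number. -/
theorem cupDiagram_rel_le {N M r : ℕ} {hM : M = N + 2} {hr : r ≤ N} {l u : ℕ → ℕ}
    (h : ∀ k, k < N → l k = u (if k + r < N then k else k + 2))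
    (h' : u (N - r) = u (N - r + 1)) :
    (cupDiagram N M r hM hr).rel ≤
      labelRel N M l u := by
  have hl : ∀ k : Fin N, l k = u (cupLower N r k) := fun k => h k k.2
  have hu : ∀ k : Fin M, u k = u (cupUpper N r k) := by
    intro k
    unfold cupUpper
    split_ifs with hk
    · rw [show (k : ℕ) = N - r + 1 by omega, ← h']
      rfl
    · rfl
  rintro (x | x) (y | y) hxy <;> replace hxy := congrArg u hxy <;>
    simpa [labelRel_iff, hl, ← hu] using hxy

theorem capDiagram_rel_le {N M r : ℕ} {hM : M = N + 2} {hr : r ≤ N} {l u : ℕ → ℕ}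
    (h : ∀ k, k < N → l k = u (if k + r < N then k else k + 2))
    (h' : u (N - r) = u (N - r + 1)) :
    (capDiagram M N r hM hr).rel ≤
      labelRel M N u l := by
  intro x y hxy
  have := cupDiagram_rel_le (M := M) (hM := hM) (hr := hr) h h' (x := x.swap) (y := y.swap)
  rcases x with x | x <;> rcases y with y | y <;> exact this hxy

/-- To compute a composite, the labelling `c` of the middle row is the only auxiliary datum to be
found. -/
theorem Diagram.rel_comp {n m p : ℕ} {D : Diagram n m} {E : Diagram m p} {l u : ℕ → ℕ}
    (c : ℕ → ℕ)
    (hA : AtMostTwo (labelRel n p l u))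
    (hD : D.rel ≤ labelRel n m l c)
    (hE : E.rel ≤ labelRel m p c u) :
    (D.comp E).rel = labelRel n p l u :=
  (D.comp E).matching.eq_of_le hA (glueOuter_le_ker hD hE)

theorem AtMostTwo.swap {n m : ℕ} {l u : ℕ → ℕ} (h : AtMostTwo (labelRel n m l u)) :
    AtMostTwo (labelRel m n u l) := by
  intro x y z hxy hxz hy hz
  have := h x.swap y.swap z.swap
    (by rcases x with x | x <;> rcases y with y | y <;> exact hxy)
    (by rcases x with x | x <;> rcases z with z | z <;> exact hxz)
    (fun e => hy (by simpa using congrArg Sum.swap e))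
    (fun e => hz (by simpa using congrArg Sum.swap e))
  simpa using congrArg Sum.swap this

/-- The labels are positions in a row of `N + 4` points in which the right foot of each arc is
identified with its left foot; the lower arc has feet `N - s`, `N - s + 1` and the upper arc `N + 2
- r`, `N + 3 - r`. -/
theorem atMostTwo_cap_cup {N r s : ℕ} (h : r ≤ s) (h' : s ≤ N) :
    AtMostTwo (labelRel (N + 2) (N + 2)
      (fun k => if k + s = N + 1 then k - 1 else if k + r < N + 2 then k else k + 2)
      (fun k => if k + s < N then k else if k + r = N + 1 then k + 1 else k + 2)) := by
  rintro (x | x) (y | y) (z | z) h1 h2 h3 h4 <;>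
    simp only [labelRel_iff, Sum.elim_inl, Sum.elim_inr, ne_eq,
      Sum.inl.injEq, Sum.inr.injEq, Fin.ext_iff, reduceCtorEq] at h1 h2 h3 h4 ⊢ <;>
    split_ifs at h1 h2 <;> omega

theorem cup_comp_cap_of_le {N r s : ℕ} (h : r ≤ s) (h' : s ≤ N) :
    (cupDiagram (N + 2) (N + 2 + 2) r rfl (by omega)).comp
        (capDiagram (N + 2 + 2) (N + 2) (s + 2) rfl (by omega)) =
      (capDiagram (N + 2) N s rfl h').comp (cupDiagram N (N + 2) r rfl (by omega)) := by
  refine Diagram.ext ((Diagram.rel_comp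
    (fun k => if k + s = N + 1 ∨ k + r = N + 3 then k - 1 else k)
    (atMostTwo_cap_cup h h') (cupDiagram_rel_le ?_ ?_) (capDiagram_rel_le ?_ ?_)).trans
    -- The middle row of `N` points is embedded in the row of `N + 4` points by leaving out the feet
    -- of both arcs.
    (Diagram.rel_comp (fun k => if k + s < N then k else if k + r < N then k + 2 else k + 4)
    (atMostTwo_cap_cup h h') (capDiagram_rel_le ?_ ?_) (cupDiagram_rel_le ?_ ?_)).symm) <;>
  · intros
    split_ifs <;> omega

/-- The picture of `cup_comp_cap_of_le` upside down: the labels of the two edges are exchanged,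
those of the middle rows stay. -/
theorem cup_comp_cap_of_ge {N r s : ℕ} (h : r ≤ s) (h' : s ≤ N) :
    (cupDiagram (N + 2) (N + 2 + 2) (s + 2) rfl (by omega)).comp
        (capDiagram (N + 2 + 2) (N + 2) r rfl (by omega)) =
      (capDiagram (N + 2) N r rfl (by omega)).comp (cupDiagram N (N + 2) s rfl h') := by
  refine Diagram.ext ((Diagram.rel_comp
    (fun k => if k + s = N + 1 ∨ k + r = N + 3 then k - 1 else k)
    (atMostTwo_cap_cup h h').swap (cupDiagram_rel_le ?_ ?_) (capDiagram_rel_le ?_ ?_)).trans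
    (Diagram.rel_comp (fun k => if k + s < N then k else if k + r < N then k + 2 else k + 4)
    (atMostTwo_cap_cup h h').swap (capDiagram_rel_le ?_ ?_) (cupDiagram_rel_le ?_ ?_)).symm) <;>
  · intros
    split_ifs <;> omega

end Generators

/-! ### Composites of a cup with a cap, and their loops. -/

section Relations

/-- The same injective labelling on both edges leaves room for vertical lines only, so the composite
and the identity are both equal to the label relation. -/
theorem Diagram.comp_eq_id {n m : ℕ} {D : Diagram n m} {E : Diagram m n} {l : ℕ → ℕ}
    (c : ℕ → ℕ) (hl : Function.Injective l) (hD : D.rel ≤ labelRel n m l c)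
    (hE : E.rel ≤ labelRel m n c l) : D.comp E = Diagram.id n := by
  have hA : AtMostTwo (labelRel n n l l) := by
    rintro (x | x) (y | y) (z | z) h1 h2 h3 h4 <;>
      simp only [labelRel_iff, Sum.elim_inl, Sum.elim_inr, ne_eq, Sum.inl.injEq, Sum.inr.injEq,
        Fin.ext_iff, reduceCtorEq] at h1 h2 h3 h4 ⊢ <;>
      replace h1 := hl h1 <;> replace h2 := hl h2 <;> omega
  refine Diagram.ext ((Diagram.rel_comp c hA hD hE).trans
    ((Diagram.id n).matching.eq_of_le hA ?_).symm)
  rintro (x | x) (y | y) h <;> cases (show x = y from h) <;> exact rfl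

theorem cup_comp_cap_self {N r : ℕ} (h : r ≤ N) :
    (cupDiagram N (N + 2) r rfl h).comp (capDiagram (N + 2) N r rfl h) = Diagram.id N := by
  refine Diagram.comp_eq_id (l := fun k => if k + r < N then k else k + 2)
    (fun k => if k + r = N + 1 then k - 1 else k) ?_
    (cupDiagram_rel_le ?_ ?_) (capDiagram_rel_le ?_ ?_)
  · intro a b
    dsimp only
    split_ifs <;> omega
  all_goals
    intros
    split_ifs <;> omega

/-- The two arcs share a foot, so the middle points `N - r`, `N - r + 1` and `N - r + 2` lie on one
zigzag line; `c` gives all three the label `N - r`. -/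
theorem cup_comp_cap_succ {N r : ℕ} (h : r ≤ N) :
    (cupDiagram (N + 1) (N + 1 + 2) r rfl (by omega)).comp
      (capDiagram (N + 1 + 2) (N + 1) (r + 1) rfl (by omega)) = Diagram.id (N + 1) := by
  refine Diagram.comp_eq_id (l := fun k => if k + r ≤ N then k else k + 2)
    (fun k => if k + r = N + 1 then k - 1 else if k + r = N + 2 then k - 2 else k) ?_
    (cupDiagram_rel_le ?_ ?_) (capDiagram_rel_le ?_ ?_)
  · intro a b
    dsimp only
    split_ifs <;> omega
  all_goals
    intros
    split_ifs <;> omega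

theorem cup_succ_comp_cap {N r : ℕ} (h : r ≤ N) :
    (cupDiagram (N + 1) (N + 1 + 2) (r + 1) rfl (by omega)).comp
      (capDiagram (N + 1 + 2) (N + 1) r rfl (by omega)) = Diagram.id (N + 1) := by
  refine Diagram.comp_eq_id (l := fun k => if k + r ≤ N then k else k + 2)
    (fun k => if k + r = N + 1 then k - 1 else if k + r = N + 2 then k - 2 else k) ?_
    (cupDiagram_rel_le ?_ ?_) (capDiagram_rel_le ?_ ?_)
  · intro a b
    dsimp only
    split_ifs <;> omega
  all_goals
    intros
    split_ifs <;> omega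

/-- A cup diagram joins each lower point to the upper point in its place. -/
theorem cupDiagram_rel_vertical {N M r : ℕ} {hM : M = N + 2} {hr : r ≤ N} {i : Fin N} {j : Fin M}
    (h : (j : ℕ) = if (i : ℕ) + r < N then (i : ℕ) else i + 2) :
    (cupDiagram N M r hM hr).rel (Sum.inl i) (Sum.inr j) := by
  change cupLower N r i = cupUpper N r j
  unfold cupLower cupUpper
  split_ifs at h ⊢ <;> omega

theorem cupDiagram_rel_arc {N M r : ℕ} {hM : M = N + 2} {hr : r ≤ N} {i j : Fin M}
    (hi : (i : ℕ) + r = N) (hj : (j : ℕ) = i + 1) :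
    (cupDiagram N M r hM hr).rel (Sum.inr i) (Sum.inr j) := by
  change cupUpper N r i = cupUpper N r j
  unfold cupUpper
  split_ifs <;> omega

theorem capDiagram_rel_vertical {N M r : ℕ} {hM : M = N + 2} {hr : r ≤ N} {i : Fin N} {j : Fin M}
    (h : (j : ℕ) = if (i : ℕ) + r < N then (i : ℕ) else i + 2) :
    (capDiagram M N r hM hr).rel (Sum.inl j) (Sum.inr i) :=
  (cupDiagram_rel_vertical (hM := hM) (hr := hr) h).symm

theorem capDiagram_rel_arc {N M r : ℕ} {hM : M = N + 2} {hr : r ≤ N} {i j : Fin M}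
    (hi : (i : ℕ) + r = N) (hj : (j : ℕ) = i + 1) :
    (capDiagram M N r hM hr).rel (Sum.inl i) (Sum.inl j) :=
  cupDiagram_rel_arc (hM := hM) (hr := hr) hi hj

/-- No component is closed if every middle point reaches an outer edge. The third alternative, over
an arc of `D` and then along a line of `E`, serves the central point of a zigzag. -/
theorem Diagram.loops_eq_zero {n m p : ℕ} {D : Diagram n m} {E : Diagram m p}
    (h : ∀ j, (∃ i, D.rel (Sum.inl i) (Sum.inr j)) ∨ (∃ k, E.rel (Sum.inr k) (Sum.inl j)) ∨
      ∃ j' k, D.rel (Sum.inr j') (Sum.inr j) ∧ E.rel (Sum.inr k) (Sum.inl j')) :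
    D.loops E = 0 := by
  refine glueLoops_eq_zero fun j => ?_
  rcases h j with ⟨i, hi⟩ | ⟨k, hk⟩ | ⟨j', k, h1, h2⟩
  · exact ⟨Sum.inl i, low_le_glue D.rel E.rel hi⟩
  · exact ⟨Sum.inr k, up_le_glue D.rel E.rel hk⟩
  · exact ⟨Sum.inr k, Setoid.trans' _ (up_le_glue D.rel E.rel h2) (low_le_glue D.rel E.rel h1)⟩

theorem loops_cup {n N M r : ℕ} (D : Diagram n N) (hM : M = N + 2) (hr : r ≤ N) :
    D.loops (cupDiagram N M r hM hr) = 0 := by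
  refine Diagram.loops_eq_zero fun j => Or.inr (Or.inl ?_)
  refine ⟨⟨if (j : ℕ) + r < N then (j : ℕ) else j + 2, ?_⟩, ?_⟩
  · split_ifs <;> omega
  · exact Setoid.symm' _ (cupDiagram_rel_vertical rfl)

theorem loops_cap {n N M r : ℕ} (D : Diagram N n) (hM : M = N + 2) (hr : r ≤ N) :
    (capDiagram M N r hM hr).loops D = 0 := by
  refine Diagram.loops_eq_zero fun j => Or.inl ?_
  refine ⟨⟨if (j : ℕ) + r < N then (j : ℕ) else j + 2, ?_⟩, ?_⟩
  · split_ifs <;> omega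
  · exact capDiagram_rel_vertical rfl

theorem loops_cup_cap_of_le {N r s : ℕ} (h : r ≤ s) (h' : s ≤ N) :
    (cupDiagram (N + 2) (N + 2 + 2) r rfl (by omega)).loops
        (capDiagram (N + 2 + 2) (N + 2) (s + 2) rfl (by omega)) = 0 := by
  refine Diagram.loops_eq_zero fun j => ?_
  rcases lt_or_ge ((j : ℕ) + r) (N + 2) with hj | hj
  · exact Or.inl ⟨⟨j, by omega⟩, cupDiagram_rel_vertical (by dsimp only; split_ifs <;> rfl)⟩
  · refine Or.inr (Or.inl ⟨⟨j - 2, by omega⟩, Setoid.symm' _ (capDiagram_rel_vertical ?_)⟩)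
    dsimp only
    split_ifs <;> omega

theorem loops_cup_cap_of_ge {N r s : ℕ} (h : r ≤ s) (h' : s ≤ N) :
    (cupDiagram (N + 2) (N + 2 + 2) (s + 2) rfl (by omega)).loops
        (capDiagram (N + 2 + 2) (N + 2) r rfl (by omega)) = 0 := by
  refine Diagram.loops_eq_zero fun j => ?_
  rcases lt_or_ge ((j : ℕ) + r) (N + 2) with hj | hj
  · refine Or.inr (Or.inl ⟨⟨j, by omega⟩, Setoid.symm' _ (capDiagram_rel_vertical ?_)⟩)
    dsimp only
    split_ifs <;> rfl
  · refine Or.inl ⟨⟨j - 2, by omega⟩, cupDiagram_rel_vertical ?_⟩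
    dsimp only
    split_ifs <;> omega

theorem loops_cup_cap_succ {N r : ℕ} (h : r ≤ N) :
    (cupDiagram (N + 1) (N + 1 + 2) r rfl (by omega)).loops
      (capDiagram (N + 1 + 2) (N + 1) (r + 1) rfl (by omega)) = 0 := by
  refine Diagram.loops_eq_zero fun j => ?_
  rcases lt_trichotomy ((j : ℕ) + r) (N + 1) with hj | hj | hj
  · exact Or.inl ⟨⟨j, by omega⟩, cupDiagram_rel_vertical (by dsimp only; split_ifs <;> rfl)⟩
  · refine Or.inr (Or.inr ⟨⟨j + 1, by omega⟩, ⟨j - 1, by omega⟩, Setoid.symm' _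
      (cupDiagram_rel_arc hj rfl), Setoid.symm' _ (capDiagram_rel_vertical ?_)⟩)
    dsimp only
    split_ifs <;> omega
  · refine Or.inr (Or.inl ⟨⟨j - 2, by omega⟩, Setoid.symm' _ (capDiagram_rel_vertical ?_)⟩)
    dsimp only
    split_ifs <;> omega

theorem loops_cup_succ_cap {N r : ℕ} (h : r ≤ N) :
    (cupDiagram (N + 1) (N + 1 + 2) (r + 1) rfl (by omega)).loops
      (capDiagram (N + 1 + 2) (N + 1) r rfl (by omega)) = 0 := by
  refine Diagram.loops_eq_zero fun j => ?_
  rcases lt_trichotomy ((j : ℕ) + r) (N + 1) with hj | hj | hj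
  · refine Or.inr (Or.inl ⟨⟨j, by omega⟩, Setoid.symm' _ (capDiagram_rel_vertical ?_)⟩)
    dsimp only
    split_ifs <;> rfl
  · refine Or.inr (Or.inr ⟨⟨j - 1, by omega⟩, ⟨j - 1, by omega⟩,
      cupDiagram_rel_arc ?_ ?_, Setoid.symm' _ (capDiagram_rel_vertical ?_)⟩) <;>
      dsimp only
    · omega
    · omega
    · split_ifs <;> omega
  · refine Or.inl ⟨⟨j - 2, by omega⟩, cupDiagram_rel_vertical ?_⟩
    dsimp only
    split_ifs <;> omega

/-- Middle points other than the two feet lie on vertical lines. The feet form one component, and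
their label `N - r` is taken by no outer point. -/
theorem loops_cup_cap_self {N r : ℕ} (h : r ≤ N) :
    (cupDiagram N (N + 2) r rfl h).loops (capDiagram (N + 2) N r rfl h) = 1 := by
  set R := (cupDiagram N (N + 2) r rfl h).rel with hR
  set S := (capDiagram (N + 2) N r rfl h).rel with hS
  change glueLoops R S = 1
  let a : Fin (N + 2) := ⟨N - r, by omega⟩
  have hker : glue R S ≤ Setoid.ker (Sum.elim (cupLower N r)
      (Sum.elim (cupUpper N r) (cupLower N r)) : Fin N ⊕ Fin (N + 2) ⊕ Fin N → ℕ) := by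
    refine glue_le_ker _ (fun x y hxy => ?_) fun x y hxy => hxy
    rcases x with x | x <;> rcases y with y | y <;> exact hxy
  unfold glueLoops countMissing
  rw [Nat.card_eq_one_iff_unique]
  refine ⟨⟨?_⟩, ⟨⟨Quotient.mk _ (Sum.inr (Sum.inl a)), ?_⟩⟩⟩
  · have key : ∀ c : Quotient (glue R S), (∀ x, Quotient.mk _ (Sum.map id Sum.inr x) ≠ c) →
        c = Quotient.mk _ (Sum.inr (Sum.inl a)) := by
      intro c hc
      induction c using Quotient.inductionOn with
      | h x =>
        rcases x with x | x | x
        · exact absurd rfl (hc (Sum.inl x))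
        · rcases lt_trichotomy ((x : ℕ) + r) N with hx | hx | hx
          · refine absurd (Quotient.sound ?_) (hc (Sum.inl ⟨x, by omega⟩))
            exact low_le_glue R S (x := Sum.inl _) (y := Sum.inr x)
              (cupDiagram_rel_vertical (by dsimp only; split_ifs <;> rfl))
          · rw [show x = a from Fin.ext (by simp only [a]; omega)]
          · by_cases hx' : (x : ℕ) = N - r + 1
            · refine Quotient.sound (Setoid.symm' _ (up_le_glue R S
                (x := Sum.inl a) (y := Sum.inl x) (capDiagram_rel_arc ?_ hx')))
              simp only [a]
              omega
            · refine absurd (Quotient.sound ?_) (hc (Sum.inl ⟨x - 2, by omega⟩))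
              refine low_le_glue R S (x := Sum.inl _) (y := Sum.inr x)
                (cupDiagram_rel_vertical ?_)
              dsimp only
              split_ifs <;> omega
        · exact absurd rfl (hc (Sum.inr x))
    rintro ⟨c, hc⟩ ⟨c', hc'⟩
    exact Subtype.ext ((key c hc).trans (key c' hc').symm)
  · intro x hx
    have := hker (Quotient.exact hx)
    rcases x with x | x <;>
    · simp only [Setoid.ker_def, Sum.map_inl, Sum.map_inr, Sum.elim_inl, Sum.elim_inr, id,
        cupLower, cupUpper, a] at this
      split_ifs at this <;> omega

/-! ### Splitting off an arc between neighbours. -/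

theorem cap_comp_cup_rel {N r : ℕ} (hr : r ≤ N) :
    ((capDiagram (N + 2) N r rfl hr).comp (cupDiagram N (N + 2) r rfl hr)).rel =
      labelRel (N + 2) (N + 2) (fun k => if k + r = N + 1 then k - 1 else k)
        (fun k => if k + r = N ∨ k + r = N + 1 then N + 2 else k) := by
  -- The label `N + 2` of the upper arc is not a position in the row and keeps that arc apart from
  -- the lower one, labelled `N - r`. The middle row is embedded by skipping the feet.
  refine Diagram.rel_comp (fun k => if k + r < N then k else k + 2) ?_
    (capDiagram_rel_le ?_ ?_) (cupDiagram_rel_le ?_ ?_)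
  · rintro (x | x) (y | y) (z | z) h1 h2 h3 h4 <;>
      simp only [labelRel_iff, Sum.elim_inl, Sum.elim_inr, ne_eq, Sum.inl.injEq, Sum.inr.injEq,
        Fin.ext_iff, reduceCtorEq] at h1 h2 h3 h4 ⊢ <;>
      split_ifs at h1 h2 <;> omega
  all_goals
    intros
    split_ifs <;> omega

/-- A diagram with an arc joining neighbours on the upper edge ends in a cup. -/
theorem Diagram.comp_cap_comp_cup {n N r : ℕ} (D : Diagram n (N + 2)) (hr : r ≤ N)
    {i j : Fin (N + 2)} (hi : (i : ℕ) + r = N) (hj : (j : ℕ) = i + 1)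
    (h : D.rel (Sum.inr i) (Sum.inr j)) :
    (D.comp (capDiagram (N + 2) N r rfl hr)).comp (cupDiagram N (N + 2) r rfl hr) = D := by
  rw [Diagram.assoc]
  set U := (capDiagram (N + 2) N r rfl hr).comp (cupDiagram N (N + 2) r rfl hr) with hU
  have hrel := cap_comp_cup_rel hr
  rw [← hU] at hrel
  -- It suffices that every arc of `D` survives: the arc from `i` to `j` reappears as the cup of
  -- `U`, and the others avoid `i` and `j` and continue along the vertical lines of `U`.
  refine (Diagram.ext (D.matching.eq_of_le (D.comp U).matching.atMostTwo ?_)).symm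
  have hne : (Sum.inr j : Fin n ⊕ Fin (N + 2)) ≠ Sum.inr i := by
    simp [Fin.ext_iff]; omega
  have harc : glueOuter D.rel U.rel (Sum.inr i) (Sum.inr j) := by
    refine up_le_glue D.rel U.rel (x := Sum.inr i) (y := Sum.inr j) ?_
    rw [hrel, labelRel_iff]
    simp only [Sum.elim_inr]
    split_ifs <;> omega
  have hmem : ∀ x y, D.rel x y → y ≠ x → (x = Sum.inr i ∨ x = Sum.inr j) →
      glueOuter D.rel U.rel x y := by
    rintro x y hxy hyx (rfl | rfl)
    · rw [(D.matching _).unique ⟨hyx, hxy⟩ ⟨hne, h⟩]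
      exact harc
    · rw [(D.matching _).unique ⟨hyx, hxy⟩ ⟨hne.symm, D.rel.symm h⟩]
      exact Setoid.symm' _ harc
  have hpath : ∀ x : Fin n ⊕ Fin (N + 2), x ≠ Sum.inr i → x ≠ Sum.inr j →
      glue D.rel U.rel (Sum.map (fun i => i) Sum.inl x) (Sum.map (fun i => i) Sum.inr x) := by
    rintro (x | x) hxi hxj
    · exact Setoid.refl' _ _
    · refine up_le_glue D.rel U.rel (x := Sum.inl x) (y := Sum.inr x) ?_
      rw [hrel, labelRel_iff]
      simp only [ne_eq, Sum.inr.injEq, Fin.ext_iff] at hxi hxj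
      simp only [Sum.elim_inl, Sum.elim_inr]
      split_ifs <;> omega
  intro x y hxy
  by_cases e : y = x
  · exact e ▸ Setoid.refl' _ _
  by_cases hx : x = Sum.inr i ∨ x = Sum.inr j
  · exact hmem x y hxy e hx
  by_cases hy : y = Sum.inr i ∨ y = Sum.inr j
  · exact Setoid.symm' _ (hmem y x (D.rel.symm hxy) (Ne.symm e) hy)
  rw [not_or] at hx hy
  exact Setoid.trans' (glue D.rel U.rel) (Setoid.symm' _ (hpath x hx.1 hx.2))
    (Setoid.trans' _ (low_le_glue D.rel U.rel hxy) (hpath y hy.1 hy.2))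

theorem cap_comp_cup_rel' {N r : ℕ} (hr : r ≤ N) :
    ((capDiagram (N + 2) N r rfl hr).comp (cupDiagram N (N + 2) r rfl hr)).rel =
      labelRel (N + 2) (N + 2) (fun k => if k + r = N ∨ k + r = N + 1 then N + 2 else k)
        (fun k => if k + r = N + 1 then k - 1 else k) := by
  refine Diagram.rel_comp (fun k => if k + r < N then k else k + 2) ?_
    (capDiagram_rel_le ?_ ?_) (cupDiagram_rel_le ?_ ?_)
  · rintro (x | x) (y | y) (z | z) h1 h2 h3 h4 <;>
      simp only [labelRel_iff, Sum.elim_inl, Sum.elim_inr, ne_eq, Sum.inl.injEq, Sum.inr.injEq,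
        Fin.ext_iff, reduceCtorEq] at h1 h2 h3 h4 ⊢ <;>
      split_ifs at h1 h2 <;> omega
  all_goals
    intros
    split_ifs <;> omega

/-- A diagram with an arc joining neighbours on the lower edge starts with a cap. -/
theorem Diagram.cap_comp_cup_comp {n N r : ℕ} (D : Diagram (N + 2) n) (hr : r ≤ N)
    {i j : Fin (N + 2)} (hi : (i : ℕ) + r = N) (hj : (j : ℕ) = i + 1)
    (h : D.rel (Sum.inl i) (Sum.inl j)) :
    (capDiagram (N + 2) N r rfl hr).comp ((cupDiagram N (N + 2) r rfl hr).comp D) = D := by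
  rw [← Diagram.assoc]
  set U := (capDiagram (N + 2) N r rfl hr).comp (cupDiagram N (N + 2) r rfl hr) with hU
  have hrel := cap_comp_cup_rel' hr
  rw [← hU] at hrel
  refine (Diagram.ext (D.matching.eq_of_le (U.comp D).matching.atMostTwo ?_)).symm
  have hne : (Sum.inl j : Fin (N + 2) ⊕ Fin n) ≠ Sum.inl i := by
    simp [Fin.ext_iff]; omega
  have harc : glueOuter U.rel D.rel (Sum.inl i) (Sum.inl j) := by
    refine low_le_glue U.rel D.rel (x := Sum.inl i) (y := Sum.inl j) ?_
    rw [hrel, labelRel_iff]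
    simp only [Sum.elim_inl]
    split_ifs <;> omega
  have hmem : ∀ x y, D.rel x y → y ≠ x → (x = Sum.inl i ∨ x = Sum.inl j) →
      glueOuter U.rel D.rel x y := by
    rintro x y hxy hyx (rfl | rfl)
    · rw [(D.matching _).unique ⟨hyx, hxy⟩ ⟨hne, h⟩]
      exact harc
    · rw [(D.matching _).unique ⟨hyx, hxy⟩ ⟨hne.symm, D.rel.symm h⟩]
      exact Setoid.symm' _ harc
  have hpath : ∀ x : Fin (N + 2) ⊕ Fin n, x ≠ Sum.inl i → x ≠ Sum.inl j →
      glue U.rel D.rel (Sum.inr x) (Sum.map (fun i => i) Sum.inr x) := by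
    rintro (x | x) hxi hxj
    · refine low_le_glue U.rel D.rel (x := Sum.inr x) (y := Sum.inl x) ?_
      rw [hrel, labelRel_iff]
      simp only [ne_eq, Sum.inl.injEq, Fin.ext_iff] at hxi hxj
      simp only [Sum.elim_inl, Sum.elim_inr]
      split_ifs <;> omega
    · exact Setoid.refl' _ _
  intro x y hxy
  by_cases e : y = x
  · exact e ▸ Setoid.refl' _ _
  by_cases hx : x = Sum.inl i ∨ x = Sum.inl j
  · exact hmem x y hxy e hx
  by_cases hy : y = Sum.inl i ∨ y = Sum.inl j
  · exact Setoid.symm' _ (hmem y x (D.rel.symm hxy) (Ne.symm e) hy)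
  rw [not_or] at hx hy
  exact Setoid.trans' (glue U.rel D.rel) (Setoid.symm' _ (hpath x hx.1 hx.2))
    (Setoid.trans' _ (up_le_glue U.rel D.rel hxy) (hpath y hy.1 hy.2))

/-- Descent to an innermost arc: non-crossing confines the partner of the point next to `i` to the
interval between `i` and `j`, which gives a shorter arc. Here `k` counts the points strictly between
the ends. -/
theorem Diagram.exists_upper_arc {n m : ℕ} (D : Diagram n m) :
    ∀ (k : ℕ) (i j : Fin m), (j : ℕ) = i + k + 1 → D.rel (Sum.inr i) (Sum.inr j) →
      ∃ i j : Fin m, (j : ℕ) = i + 1 ∧ D.rel (Sum.inr i) (Sum.inr j) := by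
  intro k
  induction k using Nat.strong_induction_on with
  | _ k ih =>
    intro i j hj h
    by_cases hk : k = 0
    · exact ⟨i, j, by omega, h⟩
    obtain ⟨y, ⟨hy, hcy⟩, -⟩ := D.matching (Sum.inr ⟨i + 1, by omega⟩)
    have hni : ¬ D.rel (Sum.inr ⟨i + 1, by omega⟩) (Sum.inr i) := by
      intro h'
      have := D.matching.atMostTwo _ _ _ (D.rel.symm h') h (by simp [Fin.ext_iff])
        (by simp [Fin.ext_iff]; omega)
      simp [Fin.ext_iff] at this
      omega
    have hnj : ¬ D.rel (Sum.inr ⟨i + 1, by omega⟩) (Sum.inr j) := fun h' =>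
      hni (D.rel.trans h' (D.rel.symm h))
    have n1 := D.nonCrossing _ _ _ _ h hcy
    have n2 := D.nonCrossing _ _ _ _ (D.rel.symm hcy) h
    rcases y with y | y
    · simp only [pos] at n1 n2
      omega
    · have h1 : (y : ℕ) ≠ i := fun e => hni (by rwa [Fin.ext e] at hcy)
      have h2 : (y : ℕ) ≠ j := fun e => hnj (by rwa [Fin.ext e] at hcy)
      have h3 : (y : ℕ) ≠ i + 1 := fun e => hy (by rw [Sum.inr.injEq]; exact Fin.ext e)
      simp only [pos] at n1 n2
      exact ih (y - (i + 1) - 1) (by omega) _ y (by dsimp only; omega) hcy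

theorem Diagram.exists_lower_arc {n m : ℕ} (D : Diagram n m) :
    ∀ (k : ℕ) (i j : Fin n), (j : ℕ) = i + k + 1 → D.rel (Sum.inl i) (Sum.inl j) →
      ∃ i j : Fin n, (j : ℕ) = i + 1 ∧ D.rel (Sum.inl i) (Sum.inl j) := by
  intro k
  induction k using Nat.strong_induction_on with
  | _ k ih =>
    intro i j hj h
    by_cases hk : k = 0
    · exact ⟨i, j, by omega, h⟩
    obtain ⟨y, ⟨hy, hcy⟩, -⟩ := D.matching (Sum.inl ⟨i + 1, by omega⟩)
    have hni : ¬ D.rel (Sum.inl ⟨i + 1, by omega⟩) (Sum.inl i) := by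
      intro h'
      have := D.matching.atMostTwo _ _ _ (D.rel.symm h') h (by simp [Fin.ext_iff])
        (by simp [Fin.ext_iff]; omega)
      simp [Fin.ext_iff] at this
      omega
    have hnj : ¬ D.rel (Sum.inl ⟨i + 1, by omega⟩) (Sum.inl j) := fun h' =>
      hni (D.rel.trans h' (D.rel.symm h))
    -- On the lower edge `pos` decreases from left to right, so the arc from `i` to `j` enters with
    -- its ends exchanged.
    have n1 := D.nonCrossing _ _ _ _ (D.rel.symm h) hcy
    have n2 := D.nonCrossing _ _ _ _ (D.rel.symm hcy) (D.rel.symm h)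
    rcases y with y | y
    · have h1 : (y : ℕ) ≠ i := fun e => hni (by rwa [Fin.ext e] at hcy)
      have h2 : (y : ℕ) ≠ j := fun e => hnj (by rwa [Fin.ext e] at hcy)
      have h3 : (y : ℕ) ≠ i + 1 := fun e => hy (by rw [Sum.inl.injEq]; exact Fin.ext e)
      simp only [pos] at n1 n2
      exact ih (y - (i + 1) - 1) (by omega) _ y (by dsimp only; omega) hcy
    · simp only [pos] at n1 n2
      omega

/-- A diagram without arcs joining two points of the same edge is an identity. -/
theorem Diagram.eq_id_of_no_arcs {n m : ℕ} (D : Diagram n m)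
    (hu : ∀ i j, D.rel (Sum.inr i) (Sum.inr j) → i = j)
    (hl : ∀ i j, D.rel (Sum.inl i) (Sum.inl j) → i = j) :
    ∃ h : n = m, h ▸ D = Diagram.id m := by
  have hex : ∀ i : Fin n, ∃ j : Fin m, D.rel (Sum.inl i) (Sum.inr j) := by
    intro i
    obtain ⟨y, ⟨hy, hiy⟩, -⟩ := D.matching (Sum.inl i)
    rcases y with y | y
    · exact absurd (by rw [hl _ _ hiy]) hy
    · exact ⟨y, hiy⟩
  choose σ hσ using hex
  -- Lower positions are negative and reversed, so two lines arriving in the wrong order would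
  -- cross. An increasing bijection of `Fin n` is then the identity.
  have hmono : StrictMono σ := by
    intro i i' hii
    by_contra hlt
    have hne : σ i' ≠ σ i := by
      intro e
      have := hl _ _ (D.rel.trans (hσ i) (D.rel.symm (e ▸ hσ i')))
      exact absurd this hii.ne
    have hlt' : σ i' < σ i := lt_of_le_of_ne (not_lt.1 hlt) hne
    refine D.nonCrossing _ _ _ _ (hσ i') (hσ i) ?_
    simp only [pos]
    rw [Fin.lt_def] at hii hlt'
    omega
  have hsurj : Function.Surjective σ := by
    intro j
    obtain ⟨y, ⟨hy, hjy⟩, -⟩ := D.matching (Sum.inr j)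
    rcases y with y | y
    · exact ⟨y, hu _ _ (D.rel.trans (D.rel.symm (hσ y)) (D.rel.symm hjy))⟩
    · exact absurd (by rw [hu _ _ hjy]) hy
  have hnm : n = m := by
    simpa using Fintype.card_congr (Equiv.ofBijective σ ⟨hmono.injective, hsurj⟩)
  subst hnm
  refine ⟨rfl, ?_⟩
  have hid : ∀ i, σ i = i := by
    intro i
    have := Subsingleton.elim (hmono.orderIsoOfSurjective σ hsurj) (OrderIso.refl (Fin n))
    exact congrArg (fun e : Fin n ≃o Fin n => e i) this
  refine (Diagram.ext ((Diagram.id n).matching.eq_of_le D.matching.atMostTwo ?_)).symm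
  have key : ∀ i, D.rel (Sum.inl i) (Sum.inr i) := fun i => by
    have := hσ i
    rwa [hid] at this
  rintro (x | x) (y | y) h <;> cases (show x = y from h)
  · exact D.rel.refl _
  · exact key x
  · exact D.rel.symm (key x)
  · exact D.rel.refl _

/-- Every diagram is an identity, or it ends in a cup, or it starts with a cap. -/
theorem Diagram.decompose {n m : ℕ} (D : Diagram n m) :
    (∃ h : n = m, h ▸ D = Diagram.id m) ∨
      (∃ (N r : ℕ) (hM : m = N + 2) (hr : r ≤ N) (E : Diagram n N),
        D = E.comp (cupDiagram N m r hM hr)) ∨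
      (∃ (N r : ℕ) (hM : n = N + 2) (hr : r ≤ N) (E : Diagram N m),
        D = (capDiagram n N r hM hr).comp E) := by
  by_cases hu : ∃ i j : Fin m, i < j ∧ D.rel (Sum.inr i) (Sum.inr j)
  · obtain ⟨i, j, hij, h⟩ := hu
    rw [Fin.lt_def] at hij
    obtain ⟨i, j, hij, h⟩ := D.exists_upper_arc (j - i - 1) i j (by omega) h
    obtain ⟨N, rfl⟩ : ∃ N, m = N + 2 := ⟨m - 2, by omega⟩
    exact Or.inr (Or.inl ⟨N, N - i, rfl, by omega, _,
      (D.comp_cap_comp_cup (by omega) (by omega) hij h).symm⟩)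
  by_cases hl : ∃ i j : Fin n, i < j ∧ D.rel (Sum.inl i) (Sum.inl j)
  · obtain ⟨i, j, hij, h⟩ := hl
    rw [Fin.lt_def] at hij
    obtain ⟨i, j, hij, h⟩ := D.exists_lower_arc (j - i - 1) i j (by omega) h
    obtain ⟨N, rfl⟩ : ∃ N, n = N + 2 := ⟨n - 2, by omega⟩
    exact Or.inr (Or.inr ⟨N, N - i, rfl, by omega, _,
      (D.cap_comp_cup_comp (by omega) (by omega) hij h).symm⟩)
  push Not at hu hl
  refine Or.inl (D.eq_id_of_no_arcs (fun i j h => ?_) fun i j h => ?_)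
  · rcases lt_trichotomy i j with h' | h' | h'
    · exact absurd h (hu i j h')
    · exact h'
    · exact absurd (D.rel.symm h) (hu j i h')
  · rcases lt_trichotomy i j with h' | h' | h'
    · exact absurd h (hl i j h')
    · exact h'
    · exact absurd (D.rel.symm h) (hl j i h')

end Relations

/-! ### Words in cups and caps that realize a diagram. -/

section Realization

universe v u

variable {C : Type u} [Category.{v} C] [Preadditive C] [MonoidalCategory C]
  (Y : C) [ExactPairing Y Y]

/-- `cupHom` with a flexible target. -/
def cupHom' (N M r : ℕ) (hM : M = N + 2) : tensorPow Y N ⟶ tensorPow Y M :=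
  cupHom Y N r ≫ eqToHom (congrArg (tensorPow Y) hM.symm)

/-- `capHom` with a flexible source. -/
def capHom' (M N r : ℕ) (hM : M = N + 2) : tensorPow Y M ⟶ tensorPow Y N :=
  eqToHom (congrArg (tensorPow Y) hM) ≫ capHom Y N r

/-- The free number `M` is kept because, for instance, `(N + 2) + k` and `(N + k) + 2` are not
definitionally equal, and because it permits case analysis on `Realizes`. -/
theorem cupHom'_rfl (N r : ℕ) : cupHom' Y N (N + 2) r rfl = cupHom Y N r := by
  simp [cupHom']

theorem capHom'_rfl (N r : ℕ) : capHom' Y (N + 2) N r rfl = capHom Y N r := by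
  simp [capHom']

/-- `Realizes Y D f` means that `f` is a composition of creations and contractions of pairs which
builds up the diagram `D` without closed loops. -/
inductive Realizes : ∀ {n m : ℕ}, Diagram n m → (tensorPow Y n ⟶ tensorPow Y m) → Prop
  | id (n : ℕ) : Realizes (Diagram.id n) (𝟙 _)
  -- Cups go only on top and caps only at the bottom. Neither step can close a loop (`loops_cup`,
  -- `loops_cap`), so no factor `d` enters, and each raises `n + m` by two.
  | cup {n N M r : ℕ} (hM : M = N + 2) (hr : r ≤ N) {D : Diagram n N}
      {f : tensorPow Y n ⟶ tensorPow Y N} (h : Realizes D f) :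
      Realizes (D.comp (cupDiagram N M r hM hr)) (f ≫ cupHom' Y N M r hM)
  | cap {n N M r : ℕ} (hM : M = N + 2) (hr : r ≤ N) {D : Diagram N n}
      {f : tensorPow Y N ⟶ tensorPow Y n} (h : Realizes D f) :
      Realizes ((capDiagram M N r hM hr).comp D) (capHom' Y M N r hM ≫ f)

variable {Y}

theorem exists_realizes {n m : ℕ} (D : Diagram n m) : ∃ f, Realizes Y D f := by
  induction hk : n + m using Nat.strong_induction_on generalizing n m with
  | _ k ih =>
    rcases D.decompose with ⟨rfl, h⟩ | ⟨N, r, hM, hr, E, rfl⟩ | ⟨N, r, hM, hr, E, rfl⟩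
    · exact ⟨_, h ▸ Realizes.id _⟩
    · obtain ⟨f, hf⟩ := ih (n + N) (by omega) E rfl
      exact ⟨_, hf.cup hM hr⟩
    · obtain ⟨f, hf⟩ := ih (N + m) (by omega) E rfl
      exact ⟨_, hf.cap hM hr⟩

/-- Equations take the place of unified indices, so that two realizations of one diagram can be
compared case by case. -/
theorem Realizes.inversion {n m : ℕ} {D : Diagram n m} {f : tensorPow Y n ⟶ tensorPow Y m}
    (h : Realizes Y D f) :
    (∃ e : n = m, D = e ▸ Diagram.id n ∧ f = eqToHom (congrArg (tensorPow Y) e)) ∨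
      (∃ (N r : ℕ) (hM : m = N + 2) (hr : r ≤ N) (E : Diagram n N) (g : _),
        Realizes Y E g ∧ D = E.comp (cupDiagram N m r hM hr) ∧ f = g ≫ cupHom' Y N m r hM) ∨
      (∃ (N r : ℕ) (hM : n = N + 2) (hr : r ≤ N) (E : Diagram N m) (g : _),
        Realizes Y E g ∧ D = (capDiagram n N r hM hr).comp E ∧ f = capHom' Y n N r hM ≫ g) := by
  cases h with
  | id => exact Or.inl ⟨rfl, rfl, rfl⟩
  | cup hM hr h => exact Or.inr (Or.inl ⟨_, _, hM, hr, _, _, h, rfl, rfl⟩)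
  | cap hM hr h => exact Or.inr (Or.inr ⟨_, _, hM, hr, _, _, h, rfl, rfl⟩)

/-! ### Uniqueness of the realization. -/

theorem comp_cup_comp_cap {n N r : ℕ} (D : Diagram n N) (hr : r ≤ N) :
    (D.comp (cupDiagram N (N + 2) r rfl hr)).comp (capDiagram (N + 2) N r rfl hr) = D := by
  rw [Diagram.assoc, cup_comp_cap_self, Diagram.comp_id]

theorem cup_comp_cap_comp {n N r : ℕ} (D : Diagram N n) (hr : r ≤ N) :
    (cupDiagram N (N + 2) r rfl hr).comp ((capDiagram (N + 2) N r rfl hr).comp D) = D := by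
  rw [← Diagram.assoc, cup_comp_cap_self, Diagram.id_comp]

theorem loops_comp_cup {n m N M r : ℕ} (D : Diagram n N) (hM : M = N + 2) (hr : r ≤ N)
    (E : Diagram M m) : (D.comp (cupDiagram N M r hM hr)).loops E =
      (cupDiagram N M r hM hr).loops E + D.loops ((cupDiagram N M r hM hr).comp E) := by
  have := D.loops_assoc (cupDiagram N M r hM hr) E
  rwa [loops_cup, zero_add] at this

theorem loops_cap_comp {n m N M r : ℕ} (D : Diagram n M) (hM : M = N + 2) (hr : r ≤ N)
    (E : Diagram N m) : D.loops ((capDiagram M N r hM hr).comp E) =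
      D.loops (capDiagram M N r hM hr) + (D.comp (capDiagram M N r hM hr)).loops E := by
  have := D.loops_assoc (capDiagram M N r hM hr) E
  rw [loops_cap, zero_add] at this
  exact this.symm

/-- The loop count with a cap detects a cup on top of a diagram; this rules out the incompatible
pairs of words in the uniqueness proof. -/
theorem loops_comp_cup_cap_self {n N r : ℕ} (D : Diagram n N) (hr : r ≤ N) :
    (D.comp (cupDiagram N (N + 2) r rfl hr)).loops (capDiagram (N + 2) N r rfl hr) = 1 := by
  rw [loops_comp_cup, loops_cup_cap_self, cup_comp_cap_self, Diagram.loops_id_right]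

theorem loops_cup_cap_comp_self {n N r : ℕ} (D : Diagram N n) (hr : r ≤ N) :
    (cupDiagram N (N + 2) r rfl hr).loops ((capDiagram (N + 2) N r rfl hr).comp D) = 1 := by
  rw [loops_cap_comp, loops_cup_cap_self, cup_comp_cap_self, Diagram.loops_id_left]

/-- Capping off each cup in turn shows that `D` and `E` arise from one smaller diagram by adding the
other cup. The induction hypothesis lets `f` and `g` be computed from a word for that diagram, and
`cupHom_cupHom` exchanges the two creations. -/
theorem realizes_unique_cups_of_lt {n N r s : ℕ} {D E : Diagram n N} (hr : r ≤ N) (hs : s ≤ N)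
    (hrs : r < s)
    (ih : ∀ {F : Diagram n N} {f g}, Realizes Y F f → Realizes Y F g → f = g)
    {f g : tensorPow Y n ⟶ tensorPow Y N} (hD : Realizes Y D f) (hE : Realizes Y E g)
    (h : D.comp (cupDiagram N (N + 2) s rfl hs) = E.comp (cupDiagram N (N + 2) r rfl hr)) :
    f ≫ cupHom Y N s = g ≫ cupHom Y N r := by
  -- Cups at neighbouring places share a foot. The cap with counter `s` closes a loop on one side
  -- and straightens a zigzag on the other, so the loop counts give `1 = 0`.
  obtain rfl | hne := eq_or_ne s (r + 1)
  · obtain ⟨N, rfl⟩ : ∃ K, N = K + 1 := ⟨N - 1, by omega⟩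
    have h1 := loops_comp_cup_cap_self D hs
    rw [h, loops_comp_cup, loops_cup_cap_succ (by omega), cup_comp_cap_succ (by omega),
      Diagram.loops_id_right] at h1
    omega
  · obtain ⟨s, rfl⟩ : ∃ t, s = t + 2 := ⟨s - 2, by omega⟩
    obtain ⟨N, rfl⟩ : ∃ K, N = K + 2 := ⟨N - 2, by omega⟩
    have hrs' : r ≤ s := by omega
    have hs' : s ≤ N := by omega
    have h1 : D = (E.comp (capDiagram (N + 2) N s rfl hs')).comp
        (cupDiagram N (N + 2) r rfl (by omega)) := by
      rw [← comp_cup_comp_cap D hs, h, Diagram.assoc, cup_comp_cap_of_le hrs' hs', Diagram.assoc]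
    have h2 : E = (E.comp (capDiagram (N + 2) N s rfl hs')).comp
        (cupDiagram N (N + 2) s rfl (by omega)) := by
      conv_lhs => rw [← comp_cup_comp_cap E hr, ← h, Diagram.assoc, cup_comp_cap_of_ge hrs' hs',
        ← Diagram.assoc, h1, comp_cup_comp_cap]
    obtain ⟨k, hk⟩ := exists_realizes (Y := Y) (E.comp (capDiagram (N + 2) N s rfl hs'))
    have e1 := ih (h1 ▸ hD) (hk.cup rfl (show r ≤ N by omega))
    have e2 := ih (h2 ▸ hE) (hk.cup rfl hs')
    rw [e1, e2, cupHom'_rfl, cupHom'_rfl, Category.assoc, Category.assoc,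
      cupHom_cupHom Y hrs' hs']

theorem realizes_unique_caps_of_lt {n N r s : ℕ} {D E : Diagram N n} (hr : r ≤ N) (hs : s ≤ N)
    (hrs : r < s)
    (ih : ∀ {F : Diagram N n} {f g}, Realizes Y F f → Realizes Y F g → f = g)
    {f g : tensorPow Y N ⟶ tensorPow Y n} (hD : Realizes Y D f) (hE : Realizes Y E g)
    (h : (capDiagram (N + 2) N s rfl hs).comp D = (capDiagram (N + 2) N r rfl hr).comp E) :
    capHom Y N s ≫ f = capHom Y N r ≫ g := by
  obtain rfl | hne := eq_or_ne s (r + 1)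
  · obtain ⟨N, rfl⟩ : ∃ K, N = K + 1 := ⟨N - 1, by omega⟩
    have h1 := loops_cup_cap_comp_self D hs
    rw [h, loops_cap_comp, loops_cup_succ_cap (by omega), cup_succ_comp_cap (by omega),
      Diagram.loops_id_left] at h1
    omega
  · obtain ⟨s, rfl⟩ : ∃ t, s = t + 2 := ⟨s - 2, by omega⟩
    obtain ⟨N, rfl⟩ : ∃ K, N = K + 2 := ⟨N - 2, by omega⟩
    have hrs' : r ≤ s := by omega
    have hs' : s ≤ N := by omega
    have h1 : D = (capDiagram (N + 2) N r rfl (by omega)).comp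
        ((cupDiagram N (N + 2) s rfl hs').comp E) := by
      rw [← cup_comp_cap_comp D hs, h, ← Diagram.assoc, cup_comp_cap_of_ge hrs' hs', Diagram.assoc]
    have h2 : E = (capDiagram (N + 2) N s rfl hs').comp
        ((cupDiagram N (N + 2) s rfl hs').comp E) := by
      conv_lhs => rw [← cup_comp_cap_comp E hr, ← h, ← Diagram.assoc, cup_comp_cap_of_le hrs' hs',
        Diagram.assoc, h1, cup_comp_cap_comp]
    obtain ⟨k, hk⟩ := exists_realizes (Y := Y) ((cupDiagram N (N + 2) s rfl hs').comp E)
    have e1 := ih (h1 ▸ hD) (hk.cap rfl (show r ≤ N by omega))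
    have e2 := ih (h2 ▸ hE) (hk.cap rfl hs')
    rw [e1, e2, capHom'_rfl, capHom'_rfl, ← Category.assoc, ← Category.assoc,
      capHom_capHom Y hrs' hs']

theorem Realizes.unique {n m : ℕ} {D : Diagram n m} {f g : tensorPow Y n ⟶ tensorPow Y m}
    (hf : Realizes Y D f) (hg : Realizes Y D g) : f = g := by
  induction hk : n + m using Nat.strong_induction_on generalizing n m with
  | _ k ih =>
    -- Under the matching cap an identity yields no loop, but a cup on top yields one.
    have id_cup : ∀ {n N r : ℕ} (hM : n = N + 2) (hr : r ≤ N) (E : Diagram n N),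
        Diagram.id n ≠ E.comp (cupDiagram N n r hM hr) := by
      intro n N r hM hr E h
      subst hM
      have := loops_comp_cup_cap_self E hr
      rw [← h, Diagram.loops_id_left] at this
      omega
    have id_cap : ∀ {n N r : ℕ} (hM : n = N + 2) (hr : r ≤ N) (E : Diagram N n),
        Diagram.id n ≠ (capDiagram n N r hM hr).comp E := by
      intro n N r hM hr E h
      subst hM
      have := loops_cup_cap_comp_self E hr
      rw [← h, Diagram.loops_id_right] at this
      omega
    -- A cup on top and a cap at the bottom do not interact: with both removed one diagram remains,
    -- and the two words then differ by associativity alone.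
    have cup_cap : ∀ {n m N M r s : ℕ} (hM : m = N + 2) (hr : r ≤ N) (hM' : n = M + 2)
        (hs : s ≤ M) (D : Diagram n N) (E : Diagram M m) {f g}, n + m = k →
        D.comp (cupDiagram N m r hM hr) = (capDiagram n M s hM' hs).comp E →
        Realizes Y D f → Realizes Y E g →
          f ≫ cupHom' Y N m r hM = capHom' Y n M s hM' ≫ g := by
      intro n m N M r s hM hr hM' hs D E f g hk h hD hE
      subst hM hM'
      have h1 : D = (capDiagram (M + 2) M s rfl hs).comp
          (E.comp (capDiagram (N + 2) N r rfl hr)) := by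
        rw [← comp_cup_comp_cap D hr, h, Diagram.assoc]
      have h2 : E = (E.comp (capDiagram (N + 2) N r rfl hr)).comp
          (cupDiagram N (N + 2) r rfl hr) := by
        conv_lhs => rw [← cup_comp_cap_comp E hs, ← h, h1, Diagram.assoc, cup_comp_cap_comp]
      obtain ⟨l, hl⟩ := exists_realizes (Y := Y) (E.comp (capDiagram (N + 2) N r rfl hr))
      have e1 := ih (M + 2 + N) (by omega) (h1 ▸ hD) (hl.cap rfl hs) rfl
      have e2 := ih (M + (N + 2)) (by omega) (h2 ▸ hE) (hl.cup rfl hr) rfl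
      rw [e1, e2, Category.assoc]
    rcases hf.inversion with ⟨rfl, rfl, rfl⟩ | ⟨N, r, rfl, hr, E, e, hE, rfl, rfl⟩ |
        ⟨N, r, rfl, hr, E, e, hE, rfl, rfl⟩
    · rcases hg.inversion with ⟨h, -, rfl⟩ | ⟨N, r, hM, hr, E, e, hE, h, rfl⟩ |
        ⟨N, r, hM, hr, E, e, hE, h, rfl⟩
      · rfl
      · exact absurd h (id_cup hM hr E)
      · exact absurd h (id_cap hM hr E)
    · rcases hg.inversion with ⟨rfl, h, rfl⟩ | ⟨N', s, hM, hs, E', e', hE', h, rfl⟩ |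
        ⟨N', s, hM, hs, E', e', hE', h, rfl⟩
      · exact absurd h.symm (id_cup rfl hr E)
      · obtain rfl : N = N' := by omega
        rw [cupHom'_rfl, cupHom'_rfl]
        rcases lt_trichotomy r s with hrs | rfl | hrs
        · exact (realizes_unique_cups_of_lt hr hs hrs
            (fun h1 h2 => ih (n + N) (by omega) h1 h2 rfl) hE' hE h.symm).symm
        · have : E = E' := by
            rw [← comp_cup_comp_cap E hr, h, comp_cup_comp_cap]
          subst this
          rw [ih (n + N) (by omega) hE hE' rfl]
        · exact realizes_unique_cups_of_lt hs hr hrs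
            (fun h1 h2 => ih (n + N) (by omega) h1 h2 rfl) hE hE' h
      · exact cup_cap rfl hr hM hs E E' hk h hE hE'
    · rcases hg.inversion with ⟨rfl, h, rfl⟩ | ⟨N', s, hM, hs, E', e', hE', h, rfl⟩ |
        ⟨N', s, hM, hs, E', e', hE', h, rfl⟩
      · exact absurd h.symm (id_cap rfl hr E)
      · exact (cup_cap hM hs rfl hr E' E hk h.symm hE' hE).symm
      · obtain rfl : N = N' := by omega
        rw [capHom'_rfl, capHom'_rfl]
        rcases lt_trichotomy r s with hrs | rfl | hrs
        · exact (realizes_unique_caps_of_lt hr hs hrs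
            (fun h1 h2 => ih (N + m) (by omega) h1 h2 rfl) hE' hE h.symm).symm
        · have : E = E' := by
            rw [← cup_comp_cap_comp E hr, h, cup_comp_cap_comp]
          subst this
          rw [ih (N + m) (by omega) hE hE' rfl]
        · exact realizes_unique_caps_of_lt hs hr hrs
            (fun h1 h2 => ih (N + m) (by omega) h1 h2 rfl) hE hE' h

/-! ### Realizations compose up to a factor `d` for each loop. -/

section Composition

variable [Linear ℂ C] [MonoidalPreadditive C] [MonoidalLinear ℂ C] {d : ℂ}

/-- The cap is pushed down through the word of `D`. A cup at the same place forms a loop with it and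
gives `d`; one at a neighbouring place cancels it in a zigzag; one at a distance slides past, and
the induction hypothesis carries the cap further. Caps of `D` remain at the bottom. -/
theorem Realizes.comp_cap (hY : η_ Y Y ≫ ε_ Y Y = d • 𝟙 (𝟙_ C)) {n M : ℕ} {D : Diagram n M}
    {f : tensorPow Y n ⟶ tensorPow Y M} (h : Realizes Y D f) :
    ∀ {N r : ℕ} (hM : M = N + 2) (hr : r ≤ N), ∃ g,
      Realizes Y (D.comp (capDiagram M N r hM hr)) g ∧
        f ≫ capHom' Y M N r hM = d ^ D.loops (capDiagram M N r hM hr) • g := by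
  induction h with
  | id n =>
    intro N r hM hr
    refine ⟨capHom' Y n N r hM ≫ 𝟙 _, ?_, ?_⟩
    · rw [Diagram.id_comp, ← (capDiagram n N r hM hr).comp_id]
      exact (Realizes.id N).cap hM hr
    · rw [Diagram.loops_id_left]
      simp
  | @cap n P M s hP hs D f h ih =>
    intro N r hM hr
    obtain ⟨g, hg, e⟩ := ih hM hr
    refine ⟨capHom' Y M P s hP ≫ g, ?_, ?_⟩
    · rw [Diagram.assoc]
      exact hg.cap hP hs
    · have hl := (capDiagram M P s hP hs).loops_assoc D (capDiagram n N r hM hr)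
      rw [loops_cap, loops_cap, zero_add, add_zero] at hl
      rw [hl, Category.assoc, e, Linear.comp_smul]
  | @cup n P M s hP hs D f h ih =>
    intro N r hM hr
    subst hM
    obtain rfl : P = N := by omega
    rw [loops_comp_cup, Diagram.assoc, Category.assoc, cupHom'_rfl, capHom'_rfl]
    rcases lt_trichotomy r s with hrs | rfl | hrs
    · obtain rfl | hne := eq_or_ne s (r + 1)
      · obtain ⟨P, rfl⟩ : ∃ K, P = K + 1 := ⟨P - 1, by omega⟩
        rw [cup_succ_comp_cap (by omega), loops_cup_succ_cap (by omega), Diagram.loops_id_right,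
          Diagram.comp_id, cupHom_succ_capHom Y (by omega)]
        exact ⟨f, h, by simp⟩
      · obtain ⟨s, rfl⟩ : ∃ t, s = t + 2 := ⟨s - 2, by omega⟩
        obtain ⟨P, rfl⟩ : ∃ K, P = K + 2 := ⟨P - 2, by omega⟩
        have hrs' : r ≤ s := by omega
        have hs' : s ≤ P := by omega
        obtain ⟨g, hg, e⟩ := ih (N := P) (r := r) rfl (by omega)
        rw [capHom'_rfl] at e
        rw [cup_comp_cap_of_ge hrs' hs', loops_cup_cap_of_ge hrs' hs',
          cupHom_capHom_of_ge Y hrs' hs', ← Diagram.assoc, ← Category.assoc, e, loops_cap_comp,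
          loops_cup, add_zero, zero_add, Linear.smul_comp]
        refine ⟨_, hg.cup rfl hs', ?_⟩
        rw [cupHom'_rfl]
    · rw [cup_comp_cap_self, loops_cup_cap_self, Diagram.loops_id_right, Diagram.comp_id,
        cupHom_capHom_self Y hY hr]
      exact ⟨f, h, by simp⟩
    · obtain rfl | hne := eq_or_ne r (s + 1)
      · obtain ⟨P, rfl⟩ : ∃ K, P = K + 1 := ⟨P - 1, by omega⟩
        rw [cup_comp_cap_succ (by omega), loops_cup_cap_succ (by omega), Diagram.loops_id_right,
          Diagram.comp_id, cupHom_capHom_succ Y (by omega)]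
        exact ⟨f, h, by simp⟩
      · obtain ⟨r, rfl⟩ : ∃ t, r = t + 2 := ⟨r - 2, by omega⟩
        obtain ⟨P, rfl⟩ : ∃ K, P = K + 2 := ⟨P - 2, by omega⟩
        have hrs' : s ≤ r := by omega
        have hr' : r ≤ P := by omega
        obtain ⟨g, hg, e⟩ := ih (N := P) (r := r) rfl (by omega)
        rw [capHom'_rfl] at e
        rw [cup_comp_cap_of_le hrs' hr', loops_cup_cap_of_le hrs' hr',
          cupHom_capHom_of_le Y hrs' hr', ← Diagram.assoc, ← Category.assoc, e, loops_cap_comp,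
          loops_cup, add_zero, zero_add, Linear.smul_comp]
        refine ⟨_, hg.cup rfl (show s ≤ P by omega), ?_⟩
        rw [cupHom'_rfl]

/-- Induction on the word of `E`: a cup stays on top, while a cap at its bottom is absorbed into `D`
by `Realizes.comp_cap`. Hence `D` has to vary in the induction. -/
theorem Realizes.comp (hY : η_ Y Y ≫ ε_ Y Y = d • 𝟙 (𝟙_ C)) {n m p : ℕ} {D : Diagram n m}
    {E : Diagram m p} {f : tensorPow Y n ⟶ tensorPow Y m} {g : tensorPow Y m ⟶ tensorPow Y p}
    (hf : Realizes Y D f) (hg : Realizes Y E g) :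
    ∃ k, Realizes Y (D.comp E) k ∧ f ≫ g = d ^ D.loops E • k := by
  induction hg generalizing n with
  | id n =>
    rw [Diagram.comp_id, Diagram.loops_id_right]
    exact ⟨f, hf, by simp⟩
  | @cup m P M s hP hs E g h ih =>
    obtain ⟨k, hk, e⟩ := ih hf
    refine ⟨k ≫ cupHom' Y P M s hP, ?_, ?_⟩
    · rw [← Diagram.assoc]
      exact hk.cup hP hs
    · have hl := D.loops_assoc E (cupDiagram P M s hP hs)
      rw [loops_cup, loops_cup, add_zero, zero_add] at hl
      rw [← hl, ← Category.assoc, e, Linear.smul_comp]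
  | @cap m P M s hP hs E g h ih =>
    obtain ⟨k, hk, e⟩ := hf.comp_cap hY hP hs
    obtain ⟨l, hl, e'⟩ := ih hk
    refine ⟨l, ?_, ?_⟩
    · rw [← Diagram.assoc]
      exact hl
    · rw [← Category.assoc, e, Linear.smul_comp, e', smul_smul, loops_cap_comp, pow_add]

end Composition

end Realization

/-! ### Juxtaposition of a single cup or cap with vertical lines. -/

section TensorDiagrams

theorem cupDiagram_rel_iff {N M r : ℕ} {hM : M = N + 2} {hr : r ≤ N} {x y : Fin N ⊕ Fin M} :
    (cupDiagram N M r hM hr).rel x y ↔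
      Sum.elim (cupLower N r) (cupUpper N r) x = Sum.elim (cupLower N r) (cupUpper N r) y :=
  Iff.rfl

theorem capDiagram_rel_iff {N M r : ℕ} {hM : M = N + 2} {hr : r ≤ N} {x y : Fin M ⊕ Fin N} :
    (capDiagram M N r hM hr).rel x y ↔
      Sum.elim (cupUpper N r) (cupLower N r) x = Sum.elim (cupUpper N r) (cupLower N r) y :=
  Iff.rfl

/-- Lines on the left leave the counter `r` alone, whereas those on the right in `cup_tensor_id`
raise it by `k`. One inclusion suffices, checked on each of the two pieces. -/
theorem id_tensor_cup (k N M r : ℕ) (hM : M = N + 2) (hr : r ≤ N) :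
    (Diagram.id k).tensor (cupDiagram N M r hM hr) =
      cupDiagram (k + N) (k + M) r (by omega) (by omega) := by
  refine Diagram.ext ((Diagram.matching _).eq_of_le (Diagram.matching _).atMostTwo ?_)
  refine sup_le (map_le_iff.2 ?_) (map_le_iff.2 ?_)
  · rintro (x | x) (y | y) h <;> cases (show x = y from h) <;>
      simp only [Setoid.comap_rel, cupDiagram_rel_iff, inLeft, Sum.map_inl, Sum.map_inr,
        Sum.elim_inl, Sum.elim_inr, cupLower, cupUpper, Fin.val_castAdd] <;>
      split_ifs <;> omega
  · rintro (x | x) (y | y) h <;>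
      simp only [Setoid.comap_rel, cupDiagram_rel_iff, inRight, Sum.map_inl, Sum.map_inr,
        Sum.elim_inl, Sum.elim_inr, cupLower, cupUpper, Fin.val_natAdd] at h ⊢ <;>
      split_ifs at h ⊢ <;> omega

theorem id_tensor_cap (k N M r : ℕ) (hM : M = N + 2) (hr : r ≤ N) :
    (Diagram.id k).tensor (capDiagram M N r hM hr) =
      capDiagram (k + M) (k + N) r (by omega) (by omega) := by
  refine Diagram.ext ((Diagram.matching _).eq_of_le (Diagram.matching _).atMostTwo ?_)
  refine sup_le (map_le_iff.2 ?_) (map_le_iff.2 ?_)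
  · rintro (x | x) (y | y) h <;> cases (show x = y from h) <;>
      simp only [Setoid.comap_rel, capDiagram_rel_iff, inLeft, Sum.map_inl, Sum.map_inr,
        Sum.elim_inl, Sum.elim_inr, cupLower, cupUpper, Fin.val_castAdd] <;>
      split_ifs <;> omega
  · rintro (x | x) (y | y) h <;>
      simp only [Setoid.comap_rel, capDiagram_rel_iff, inRight, Sum.map_inl, Sum.map_inr,
        Sum.elim_inl, Sum.elim_inr, cupLower, cupUpper, Fin.val_natAdd] at h ⊢ <;>
      split_ifs at h ⊢ <;> omega

theorem cup_tensor_id (k N M r : ℕ) (hM : M = N + 2) (hr : r ≤ N) :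
    (cupDiagram N M r hM hr).tensor (Diagram.id k) =
      cupDiagram (N + k) (M + k) (r + k) (by omega) (by omega) := by
  refine Diagram.ext ((Diagram.matching _).eq_of_le (Diagram.matching _).atMostTwo ?_)
  refine sup_le (map_le_iff.2 ?_) (map_le_iff.2 ?_)
  · rintro (x | x) (y | y) h <;>
      simp only [Setoid.comap_rel, cupDiagram_rel_iff, inLeft, Sum.map_inl, Sum.map_inr,
        Sum.elim_inl, Sum.elim_inr, cupLower, cupUpper, Fin.val_castAdd] at h ⊢ <;>
      split_ifs at h ⊢ <;> omega
  · rintro (x | x) (y | y) h <;> cases (show x = y from h) <;>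
      simp only [Setoid.comap_rel, cupDiagram_rel_iff, inRight, Sum.map_inl, Sum.map_inr,
        Sum.elim_inl, Sum.elim_inr, cupLower, cupUpper, Fin.val_natAdd] <;>
      split_ifs <;> omega

theorem cap_tensor_id (k N M r : ℕ) (hM : M = N + 2) (hr : r ≤ N) :
    (capDiagram M N r hM hr).tensor (Diagram.id k) =
      capDiagram (M + k) (N + k) (r + k) (by omega) (by omega) := by
  refine Diagram.ext ((Diagram.matching _).eq_of_le (Diagram.matching _).atMostTwo ?_)
  refine sup_le (map_le_iff.2 ?_) (map_le_iff.2 ?_)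
  · rintro (x | x) (y | y) h <;>
      simp only [Setoid.comap_rel, capDiagram_rel_iff, inLeft, Sum.map_inl, Sum.map_inr,
        Sum.elim_inl, Sum.elim_inr, cupLower, cupUpper, Fin.val_castAdd] at h ⊢ <;>
      split_ifs at h ⊢ <;> omega
  · rintro (x | x) (y | y) h <;> cases (show x = y from h) <;>
      simp only [Setoid.comap_rel, capDiagram_rel_iff, inRight, Sum.map_inl, Sum.map_inr,
        Sum.elim_inl, Sum.elim_inr, cupLower, cupUpper, Fin.val_natAdd] <;>
      split_ifs <;> omega

end TensorDiagrams

/-! ### Tensor products of realizations. -/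

section TensorHoms

universe v u

variable {C : Type u} [Category.{v} C] [MonoidalCategory C] (Y : C)

theorem tensorPowAdd_succ (n k : ℕ) : (tensorPowAdd Y n (k + 1)).hom =
    (α_ (tensorPow Y n) (tensorPow Y k) Y).inv ≫ (tensorPowAdd Y n k).hom ▷ Y := rfl

/-- The induction step of `whiskerLeft_cupHom` and `whiskerLeft_capHom`. Arbitrary `e`, `e'` replace
the isomorphisms `tensorPowAdd`, of which only the recursive shape matters. -/
theorem whiskerLeft_powWhisker {A B B' P P' : C} (x : B ⟶ B') (x' : P ⟶ P') (e : A ⊗ B ⟶ P)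
    (e' : A ⊗ B' ⟶ P') (h : A ◁ x ≫ e' = e ≫ x') :
    A ◁ (x ▷ Y) ≫ (α_ A B' Y).inv ≫ e' ▷ Y = ((α_ A B Y).inv ≫ e ▷ Y) ≫ x' ▷ Y := by
  rw [Category.assoc, ← comp_whiskerRight, ← h]
  simp

theorem whiskerRight_powWhisker {A A' B P P' : C} (x : A ⟶ A') (x' : P ⟶ P') (e : A ⊗ B ⟶ P)
    (e' : A' ⊗ B ⟶ P') (h : x ▷ B ≫ e' = e ≫ x') :
    x ▷ (B ⊗ Y) ≫ (α_ A' B Y).inv ≫ e' ▷ Y = ((α_ A B Y).inv ≫ e ▷ Y) ≫ x' ▷ Y := by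
  rw [Category.assoc, ← comp_whiskerRight, ← h]
  simp

variable [ExactPairing Y Y]

/-- The case `r = 0` of `whiskerLeft_cupHom`: the long composite is `tensorPowAdd` unfolded twice,
with `e` standing for its value at `N`. -/
theorem whiskerLeft_createPair {A B P : C} (e : A ⊗ B ⟶ P) :
    A ◁ createPair Y B ≫ (α_ A (B ⊗ Y) Y).inv ≫ ((α_ A B Y).inv ≫ e ▷ Y) ▷ Y =
      e ≫ createPair Y P := by
  rw [createPair_naturality]
  simp only [createPair]
  monoidal

theorem whiskerLeft_contractPair {A B P : C} (e : A ⊗ B ⟶ P) :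
    A ◁ contractPair Y B ≫ e =
      ((α_ A (B ⊗ Y) Y).inv ≫ ((α_ A B Y).inv ≫ e ▷ Y) ▷ Y) ≫ contractPair Y P := by
  have := contractPair_naturality Y e
  rw [comp_whiskerRight, Category.assoc, Category.assoc, ← this]
  simp only [contractPair]
  monoidal

variable [Preadditive C]

theorem whiskerLeft_cupHom (k : ℕ) {N r : ℕ} (hr : r ≤ N) :
    tensorPow Y k ◁ cupHom Y N r ≫ (tensorPowAdd Y k (N + 2)).hom =
      (tensorPowAdd Y k N).hom ≫ cupHom Y (k + N) r := by
  induction r generalizing N with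
  | zero =>
    rw [cupHom_zero, cupHom_zero]
    exact whiskerLeft_createPair Y _
  | succ r ih =>
    obtain ⟨N, rfl⟩ := Nat.exists_eq_succ_of_ne_zero (show N ≠ 0 by omega)
    exact whiskerLeft_powWhisker Y _ _ _ _ (ih (Nat.le_of_succ_le_succ hr))

theorem whiskerLeft_capHom (k : ℕ) {N r : ℕ} (hr : r ≤ N) :
    tensorPow Y k ◁ capHom Y N r ≫ (tensorPowAdd Y k N).hom =
      (tensorPowAdd Y k (N + 2)).hom ≫ capHom Y (k + N) r := by
  induction r generalizing N with
  | zero =>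
    rw [capHom_zero, capHom_zero]
    exact whiskerLeft_contractPair Y _
  | succ r ih =>
    obtain ⟨N, rfl⟩ := Nat.exists_eq_succ_of_ne_zero (show N ≠ 0 by omega)
    exact whiskerLeft_powWhisker Y _ _ _ _ (ih (Nat.le_of_succ_le_succ hr))

theorem cupHom'_succ {N M r : ℕ} (hM : M = N + 2) (hM' : M + 1 = N + 1 + 2) :
    cupHom' Y (N + 1) (M + 1) (r + 1) hM' = powWhisker Y (cupHom' Y N M r hM) := by
  subst hM
  rw [cupHom'_rfl, cupHom'_rfl]
  rfl

theorem capHom'_succ {N M r : ℕ} (hM : M = N + 2) (hM' : M + 1 = N + 1 + 2) :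
    capHom' Y (M + 1) (N + 1) (r + 1) hM' = powWhisker Y (capHom' Y M N r hM) := by
  subst hM
  rw [capHom'_rfl, capHom'_rfl]
  rfl

/-- Each factor added on the right is one more whiskering and raises the counter by one. The
induction runs over these factors, so no bound on `r` is needed. -/
theorem whiskerRight_cupHom' (k : ℕ) {N M r : ℕ} (hM : M = N + 2) (hM' : M + k = N + k + 2) :
    cupHom' Y N M r hM ▷ tensorPow Y k ≫ (tensorPowAdd Y M k).hom =
      (tensorPowAdd Y N k).hom ≫ cupHom' Y (N + k) (M + k) (r + k) hM' := by
  induction k with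
  | zero => exact rightUnitor_naturality _
  | succ k ih =>
    have hk : M + k = N + k + 2 := by omega
    exact (whiskerRight_powWhisker Y _ _ _ _ (ih hk)).trans
      (congrArg _ (cupHom'_succ Y hk hM').symm)

theorem whiskerRight_capHom' (k : ℕ) {N M r : ℕ} (hM : M = N + 2) (hM' : M + k = N + k + 2) :
    capHom' Y M N r hM ▷ tensorPow Y k ≫ (tensorPowAdd Y N k).hom =
      (tensorPowAdd Y M k).hom ≫ capHom' Y (M + k) (N + k) (r + k) hM' := by
  induction k with
  | zero => exact rightUnitor_naturality _
  | succ k ih =>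
    have hk : M + k = N + k + 2 := by omega
    exact (whiskerRight_powWhisker Y _ _ _ _ (ih hk)).trans
      (congrArg _ (capHom'_succ Y hk hM').symm)

theorem whiskerLeft_cupHom' (k : ℕ) {N M r : ℕ} (hr : r ≤ N) (hM : M = N + 2)
    (hM' : k + M = k + N + 2) :
    tensorPow Y k ◁ cupHom' Y N M r hM ≫ (tensorPowAdd Y k M).hom =
      (tensorPowAdd Y k N).hom ≫ cupHom' Y (k + N) (k + M) r hM' := by
  subst hM
  rw [cupHom'_rfl, whiskerLeft_cupHom Y k hr]
  exact congrArg _ (cupHom'_rfl Y (k + N) r).symm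

theorem whiskerLeft_capHom' (k : ℕ) {N M r : ℕ} (hr : r ≤ N) (hM : M = N + 2)
    (hM' : k + M = k + N + 2) :
    tensorPow Y k ◁ capHom' Y M N r hM ≫ (tensorPowAdd Y k N).hom =
      (tensorPowAdd Y k M).hom ≫ capHom' Y (k + M) (k + N) r hM' := by
  subst hM
  rw [capHom'_rfl, whiskerLeft_capHom Y k hr]
  exact congrArg _ (capHom'_rfl Y (k + N) r).symm

variable {Y}

theorem realizes_cap : Realizes Y Diagram.cap (contractPair Y (𝟙_ C)) := by
  have h : capDiagram 2 0 0 rfl le_rfl = Diagram.cap :=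
    Diagram.ext ((Diagram.matching _).eq_of_le Diagram.cap.matching.atMostTwo le_top)
  have := (Realizes.id (Y := Y) 0).cap rfl (le_refl 0)
  rw [Diagram.comp_id, capHom'_rfl, Category.comp_id, h] at this
  exact this

theorem realizes_cup : Realizes Y Diagram.cup (createPair Y (𝟙_ C)) := by
  have h : cupDiagram 0 2 0 rfl le_rfl = Diagram.cup :=
    Diagram.ext ((Diagram.matching _).eq_of_le Diagram.cup.matching.atMostTwo le_top)
  have := (Realizes.id (Y := Y) 0).cup rfl (le_refl 0)
  rw [Diagram.id_comp, cupHom'_rfl, Category.id_comp, h] at this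
  exact this

theorem Realizes.id_tensor (k : ℕ) {n m : ℕ} {D : Diagram n m}
    {f : tensorPow Y n ⟶ tensorPow Y m} (h : Realizes Y D f) :
    Realizes Y ((Diagram.id k).tensor D)
      ((tensorPowAdd Y k n).inv ≫ tensorPow Y k ◁ f ≫ (tensorPowAdd Y k m).hom) := by
  induction h with
  | id n =>
    rw [Diagram.tensor_id]
    simpa using Realizes.id (Y := Y) (k + n)
  | @cup n N M r hM hr D f h ih =>
    have := ih.cup (M := k + M) (r := r) (by omega) (by omega)
    rw [← id_tensor_cup k N M r hM hr, Diagram.tensor_comp, Diagram.id_comp] at this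
    convert this using 1
    simp only [Category.assoc]
    rw [← whiskerLeft_cupHom' Y k hr hM, whiskerLeft_comp, Category.assoc]
  | @cap n N M r hM hr D f h ih =>
    have := ih.cap (M := k + M) (r := r) (by omega) (by omega)
    rw [← id_tensor_cap k N M r hM hr, Diagram.tensor_comp, Diagram.id_comp] at this
    convert this using 1
    rw [whiskerLeft_comp, Category.assoc, Iso.inv_comp_eq, ← Category.assoc, ← Category.assoc,
      ← whiskerLeft_capHom' Y k hr hM]
    simp

theorem Realizes.tensor_id (k : ℕ) {n m : ℕ} {D : Diagram n m}
    {f : tensorPow Y n ⟶ tensorPow Y m} (h : Realizes Y D f) :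
    Realizes Y (D.tensor (Diagram.id k))
      ((tensorPowAdd Y n k).inv ≫ f ▷ tensorPow Y k ≫ (tensorPowAdd Y m k).hom) := by
  induction h with
  | id n =>
    rw [Diagram.tensor_id]
    simpa using Realizes.id (Y := Y) (n + k)
  | @cup n N M r hM hr D f h ih =>
    have := ih.cup (M := M + k) (r := r + k) (by omega) (by omega)
    rw [← cup_tensor_id k N M r hM hr, Diagram.tensor_comp, Diagram.id_comp] at this
    convert this using 1
    simp only [Category.assoc]
    rw [← whiskerRight_cupHom' Y k hM, comp_whiskerRight, Category.assoc]
  | @cap n N M r hM hr D f h ih =>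
    have := ih.cap (M := M + k) (r := r + k) (by omega) (by omega)
    rw [← cap_tensor_id k N M r hM hr, Diagram.tensor_comp, Diagram.id_comp] at this
    convert this using 1
    rw [comp_whiskerRight, Category.assoc, Iso.inv_comp_eq, ← Category.assoc, ← Category.assoc,
      ← whiskerRight_capHom' Y k hM]
    simp

/-- The tensor product is `f ⊗ 1` followed by `1 ⊗ g`. Both factors are realized, and their
composite closes no loop, so the power of `d` is `1`. -/
theorem Realizes.tensor [Linear ℂ C] [MonoidalPreadditive C] [MonoidalLinear ℂ C] {d : ℂ}
    (hY : η_ Y Y ≫ ε_ Y Y = d • 𝟙 (𝟙_ C)) {n m n' m' : ℕ} {D : Diagram n m}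
    {E : Diagram n' m'} {f : tensorPow Y n ⟶ tensorPow Y m}
    {g : tensorPow Y n' ⟶ tensorPow Y m'} (hf : Realizes Y D f) (hg : Realizes Y E g) :
    Realizes Y (D.tensor E)
      ((tensorPowAdd Y n n').inv ≫ (f ⊗ₘ g) ≫ (tensorPowAdd Y m m').hom) := by
  obtain ⟨k, hk, e⟩ := (hf.tensor_id n').comp hY (hg.id_tensor m)
  rw [Diagram.tensor_comp, Diagram.comp_id, Diagram.id_comp] at hk
  rw [Diagram.loops_tensor, Diagram.loops_id_left, Diagram.loops_id_right, add_zero, pow_zero,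
    one_smul] at e
  convert hk using 1
  rw [← e, MonoidalCategory.tensorHom_def]
  simp

end TensorHoms

/-! ### The linear functor defined by realizations. -/

section Functor

universe v u

variable {C : Type u} [Category.{v} C] [Preadditive C] [Linear ℂ C] [MonoidalCategory C]
  (Y : C) [ExactPairing Y Y]

/-- The linear extension of the realization of diagrams. -/
noncomputable def realize (n m : ℕ) :
    (Diagram n m →₀ ℂ) →ₗ[ℂ] (tensorPow Y n ⟶ tensorPow Y m) :=
  Finsupp.linearCombination ℂ fun D => (exists_realizes (Y := Y) D).choose

variable {Y}

/-- Uniqueness of realizations makes the choice in `realize` immaterial. -/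
theorem Realizes.realize_single {n m : ℕ} {D : Diagram n m} {f : tensorPow Y n ⟶ tensorPow Y m}
    (h : Realizes Y D f) (a : ℂ) : realize Y n m (Finsupp.single D a) = a • f := by
  rw [realize, Finsupp.linearCombination_single,
    (exists_realizes (Y := Y) D).choose_spec.unique h]

variable [MonoidalPreadditive C] [MonoidalLinear ℂ C] {d : ℂ}

theorem realize_comp (hY : η_ Y Y ≫ ε_ Y Y = d • 𝟙 (𝟙_ C)) {n m p : ℕ} (f : Diagram n m →₀ ℂ)
    (g : Diagram m p →₀ ℂ) :
    realize Y n p (compLin d n m p f g) = realize Y n m f ≫ realize Y m p g := by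
  induction f using Finsupp.induction_linear with
  | zero => simp
  | add f₁ f₂ h₁ h₂ => simp [h₁, h₂]
  | single D a =>
    induction g using Finsupp.induction_linear with
    | zero => simp
    | add f₁ f₂ h₁ h₂ => simp [h₁, h₂]
    | single E b =>
      obtain ⟨f, hf⟩ := exists_realizes (Y := Y) D
      obtain ⟨g, hg⟩ := exists_realizes (Y := Y) E
      obtain ⟨k, hk, e⟩ := hf.comp hY hg
      rw [compLin_single, hk.realize_single, hf.realize_single, hg.realize_single,
        Linear.smul_comp, Linear.comp_smul, e, smul_smul, smul_smul, mul_assoc]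

theorem realize_tensor (hY : η_ Y Y ≫ ε_ Y Y = d • 𝟙 (𝟙_ C)) {n m n' m' : ℕ}
    (f : Diagram n m →₀ ℂ) (g : Diagram n' m' →₀ ℂ) :
    realize Y _ _ (tensorLin n m n' m' f g) =
      (tensorPowAdd Y n n').inv ≫ (realize Y n m f ⊗ₘ realize Y n' m' g) ≫
        (tensorPowAdd Y m m').hom := by
  induction f using Finsupp.induction_linear with
  | zero => simp
  | add f₁ f₂ h₁ h₂ => simp [h₁, h₂, MonoidalPreadditive.add_tensor]
  | single D a =>
    induction g using Finsupp.induction_linear with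
    | zero => simp
    | add f₁ f₂ h₁ h₂ => simp [h₁, h₂, MonoidalPreadditive.tensor_add]
    | single E b =>
      obtain ⟨f, hf⟩ := exists_realizes (Y := Y) D
      obtain ⟨g, hg⟩ := exists_realizes (Y := Y) E
      rw [tensorLin_single, (hf.tensor hY hg).realize_single, hf.realize_single,
        hg.realize_single]
      simp [MonoidalCategory.tensorHom_def, smul_smul, mul_comm]

/-- The functor from the Temperley-Lieb category given by a self-dual object of dimension `d`. -/
noncomputable def realizationFunctor (hY : η_ Y Y ≫ ε_ Y Y = d • 𝟙 (𝟙_ C)) : TLCat d ⥤ C where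
  obj X := tensorPow Y X.strands
  map {X X'} f := realize Y X.strands X'.strands f
  map_id X := by
    refine ((Realizes.id X.strands).realize_single 1).trans ?_
    rw [one_smul]
  map_comp f g := realize_comp hY f g

theorem realizationFunctor_map_ofDiagram (hY : η_ Y Y ≫ ε_ Y Y = d • 𝟙 (𝟙_ C)) {X X' : TLCat d}
    {D : Diagram X.strands X'.strands} {f} (h : Realizes Y D f) :
    (realizationFunctor hY).map (TLCat.ofDiagram D) = f :=
  (h.realize_single 1).trans (one_smul _ _)

end Functor

/-! ### Strictness: the comparison isomorphisms are transports along equalities. -/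

section Strict

universe v u

variable {C : Type u} [Category.{v} C] [MonoidalCategory C] [IsStrictMonoidal C] (Y : C)

theorem tensorPow_add (n : ℕ) : ∀ k, tensorPow Y (n + k) = tensorPow Y n ⊗ tensorPow Y k
  | 0 => (IsStrictMonoidal.tensor_unit _).symm
  | k + 1 => (congrArg (· ⊗ Y) (tensorPow_add n k)).trans (IsStrictMonoidal.tensor_assoc _ _ _)

theorem tensorPow_one : tensorPow Y 1 = Y := IsStrictMonoidal.unit_tensor Y

theorem tensorPowAdd_hom_eq (n k : ℕ) :
    (tensorPowAdd Y n k).hom = eqToHom (tensorPow_add Y n k).symm := by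
  induction k with
  | zero => exact IsStrictMonoidal.rightUnitor_hom _
  | succ k ih =>
    have h : (α_ (tensorPow Y n) (tensorPow Y k) Y).inv =
        eqToHom (IsStrictMonoidal.tensor_assoc _ _ _).symm := by
      rw [← cancel_epi (α_ (tensorPow Y n) (tensorPow Y k) Y).hom, Iso.hom_inv_id,
        IsStrictMonoidal.associator_hom, eqToHom_trans, eqToHom_refl]
    rw [tensorPowAdd_succ, ih, eqToHom_whiskerRight, h]
    exact eqToHom_trans _ _

theorem tensorPowAdd_inv_eq (n k : ℕ) :
    (tensorPowAdd Y n k).inv = eqToHom (tensorPow_add Y n k) := by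
  rw [← cancel_epi (tensorPowAdd Y n k).hom, Iso.hom_inv_id, tensorPowAdd_hom_eq, eqToHom_trans,
    eqToHom_refl]

variable [ExactPairing Y Y]

/-- By coherence only the left unit constraint of the first factor remains, and strictness makes it
a transport. The proof `h` is left free so as to match the one in the final statement. -/
theorem contractPair_unit {h : (𝟙_ C ⊗ Y) ⊗ Y = Y ⊗ Y} :
    contractPair Y (𝟙_ C) = eqToHom h ≫ ε_ Y Y := by
  have : contractPair Y (𝟙_ C) = (λ_ Y).hom ▷ Y ≫ ε_ Y Y := by
    simp only [contractPair]
    monoidal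
  rw [this, IsStrictMonoidal.leftUnitor_hom, eqToHom_whiskerRight]

theorem createPair_unit {h : Y ⊗ Y = (𝟙_ C ⊗ Y) ⊗ Y} :
    createPair Y (𝟙_ C) = η_ Y Y ≫ eqToHom h := by
  have : createPair Y (𝟙_ C) ≫ (λ_ Y).hom ▷ Y = η_ Y Y := by
    simp only [createPair]
    monoidal
  rw [← this, IsStrictMonoidal.leftUnitor_hom, eqToHom_whiskerRight]
  simp

end Strict

end TemperleyLieb

/-- With `Y` as its own dual, the axioms of `ExactPairing` are the two duality equations, `η_ Y Y`
being δ_Y and `ε_ Y Y` being ε_Y. Transports appear because the functor sends X to `𝟙_ T ⊗ Y`, which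
is `Y` by strictness but not by definition. -/
theorem mainTheorem6 {T : Type*} [Category T] [Preadditive T] [Linear ℂ T] [MonoidalCategory T]
    [TensorCategory T] (Y : T) [ExactPairing Y Y] (d : ℂ) (hd : d ≠ 0)
    (hY : η_ Y Y ≫ ε_ Y Y = d • 𝟙 (𝟙_ T)) :
    ∃ (F : TemperleyLieb.TLCat d ⥤ T) (hF : IsMonoidalFunctor F)
      (hX : F.obj (TemperleyLieb.TLCat.X d) = Y),
      F.Additive ∧ F.Linear ℂ ∧
      F.map (TemperleyLieb.TLCat.ε d) =
        eqToHom (by rw [hF.obj_tensor, hX]) ≫ ε_ Y Y ≫ eqToHom hF.obj_unit.symm ∧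
      F.map (TemperleyLieb.TLCat.δ d) =
        eqToHom hF.obj_unit ≫ η_ Y Y ≫ eqToHom (by rw [hF.obj_tensor, hX]) := by
  have hF : IsMonoidalFunctor (TemperleyLieb.realizationFunctor hY) :=
    { obj_unit := rfl
      obj_tensor := fun X X' => TemperleyLieb.tensorPow_add Y X.strands X'.strands
      map_tensor := fun {X X' Z Z'} f g => by
        refine (TemperleyLieb.realize_tensor hY f g).trans ?_
        rw [TemperleyLieb.tensorPowAdd_inv_eq, TemperleyLieb.tensorPowAdd_hom_eq]
        rfl }
  refine ⟨TemperleyLieb.realizationFunctor hY, hF, TemperleyLieb.tensorPow_one Y,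
    ⟨fun {_ _ f g} => map_add (TemperleyLieb.realize Y _ _) f g⟩,
    ⟨fun f a => map_smul (TemperleyLieb.realize Y _ _) a f⟩, ?_, ?_⟩
  · refine (TemperleyLieb.realizationFunctor_map_ofDiagram hY TemperleyLieb.realizes_cap).trans ?_
    -- The unit object is preserved by definition, so the transport along `obj_unit` is an identity
    -- morphism.
    exact (TemperleyLieb.contractPair_unit Y).trans (congrArg _ (Category.comp_id _).symm)
  · refine (TemperleyLieb.realizationFunctor_map_ofDiagram hY TemperleyLieb.realizes_cup).trans ?_
    exact (TemperleyLieb.createPair_unit Y).trans (Category.id_comp _).symm
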